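/- **Notation.** Put $z^s=|z|^se^{is\arg z}$ with $-\pi<\arg z\le\pi$ and $\mathrm{sgn}(x)=x/|x|$. For $g=\begin{pmatrix}a&b\\c&d\end{pmatrix}\in SL(2,\mathbb R)$ and $z$ in the upper half plane put $gz=\frac{az+b}{cz+d}$ and $J(g,z)=cz+d$. Let $\widetilde G=\{(g,\theta)\in SL(2,\mathbb R)\times\mathbb R : J(g,i)e^{i\theta}=|J(g,i)|\}$ be the universal covering group of $SL(2,\mathbb R)$, with product $(g_1,\theta_1)(g_2,\theta_2)=\bigl(g_1g_2,\ \theta_1+\theta_2-\arg\frac{J(g_1,g_2i)}{J(g_1,i)}\bigr)$. Put $$\tilde u(x)=\Bigl(\begin{pmatrix}1&x\\0&1\end{pmatrix},0\Bigr),\quad \tilde a(y)=\Bigl(\begin{pmatrix}\sqrt y&0\\0&1/\sqrt y\end{pmatrix},0\Bigr)\ (y>0),\quad \tilde k(\theta)=\Bigl(\begin{pmatrix}\cos\theta&\sin\theta\\-\sin\theta&\cos\theta\end{pmatrix},\theta\Bigr),\quad \tilde w=\tilde k(-\pi/2).$$ **Principal series.** Let $\mu,\nu\in\mathbb C$. Let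 $I^\infty_{\mu,\nu}$ be the space of smooth $F:\widetilde G\to\mathbb C$ with $F(\tilde u(x)\tilde a(y)\tilde k(m\pi)\tilde g)=e^{\pi i m\mu}y^{\nu+1/2}F(\tilde g)$ for $x\in\mathbb R$, $y>0$, $m\in\mathbb Z$, $\tilde g\in\widetilde G$. Let $\rho$ be right translation, and also its derivative, an action of the universal enveloping algebra of $\mathfrak{sl}(2,\mathbb C)$. Topologize $I^\infty_{\mu,\nu}$ by the seminorms $F\mapsto\sup_{-\pi\le\theta<\pi}|(\rho(X)F)(\tilde k(\theta))|$, $X\in U(\mathfrak{sl}(2,\mathbb C))$. Let $I^{-\infty}_{\mu,\nu}$ be the space of continuous linear functionals ("distributions") on $I^\infty_{\mu,\nu}$. Put $F_\infty=e^{\pi i\mu/2}\rho(\tilde w)F$, and $\lambda_\infty(F)=\lambda(F_\infty)$ for $\lambda:I^\infty_{\mu,\nu}\to\mathbb C$. For $f\in C_0^\infty(\mathbb R)$ let $\iota(f)\in I^\infty_{\mu,\nu}$ be the unique function with $\iota(f)(\tilde w\tilde u(-x))=f(x)$ for all $x\in\mathbb R$, and put $T^\lambda(f)=\lambda(\iota(f))$.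 **Shifted lattices.** A shifted lattice is a set $L=u_1+u_2\mathbb Z$ with $u_1\in\mathbb R$, $u_2\in\mathbb R^\times$. Put $L^\vee=\{t\in\mathbb R:(l_1-l_2)t\in\mathbb Z\text{ for all }l_1,l_2\in L\}$, and $\omega_L(t)=e^{2\pi ilt}$ for $t\in L^\vee$ and any $l\in L$. Let $\mathfrak M(L)$ be the space of $\alpha:L\to\mathbb C$ with $\alpha(l)=O(|l|^r)$ as $|l|\to\infty$ for some $r\in\mathbb R$. Let $\mathfrak N(\mathbb Z_{\ge0})$ be the space of finitely supported $\beta:\mathbb Z_{\ge0}\to\mathbb C$, and for $S\subset\mathbb Z_{\ge0}$ let $\mathfrak N(S)$ be the subspace of those that vanish outside $S$. Let $\mathfrak M(L)^0_{\mu,\nu}$ be the set of $\alpha\in\mathfrak M(L)$ such that $\alpha(0)=0$ if $0\in L$, $-2\nu\in\mathbb Z_{>0}$ and $\mu-2\nu-1\notin2\mathbb Z$. Put $S_\nu(L)=\emptyset$ if $0\notin L$, and $S_\nu(L)=\{0,-2\nu\}\cap\mathbb Z_{\ge0}$ if $0\in L$. **Automorphy.** Let $L_1,L_2$ be shifted lattices.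 A distribution $\lambda\in I^{-\infty}_{\mu,\nu}$ is *automorphic* for $(L_1,L_2)$ if $\lambda(\rho(\tilde u(t))F)=\omega_{L_1}(t)\lambda(F)$ for $t\in L_1^\vee$, and $\lambda_\infty(\rho(\tilde u(t))F)=\omega_{L_2}(t)\lambda_\infty(F)$ for $t\in L_2^\vee$, for all $F\in I^\infty_{\mu,\nu}$. For $f\in C_0^\infty(\mathbb R)$ (or $f$ smooth on $\mathbb R^\times$) put $f_{\mu,\nu,\infty}(x)=e^{-\mathrm{sgn}(x)\pi i\mu/2}|x|^{-2\nu-1}f(-1/x)$ for $x\ne0$. The distribution $\lambda$ is *quasi-automorphic* for $(L_1,L_2)$ if $T_1=T^\lambda$ and $T_2=T^{\lambda_\infty}$ are distributions on $\mathbb R$ with $T_j(f(\cdot+t))=\omega_{L_j}(-t)T_j(f)$ for $j=1,2$, $t\in L_j^\vee$, $f\in C_0^\infty(\mathbb R)$, and $T_1(f)=T_2(f_{\mu,\nu,\infty})$ for $f\in C_0^\infty(\mathbb R^\times)$. **Jacquet integrals.** Put $\mathcal F(f)(y)=\int_{\mathbb R}f(x)e^{2\pi ixy}dx$ and $\delta^{(m)}(f)=(-1)^mf^{(m)}(0)$.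 For $f\in C_0^\infty(\mathbb R)$ the function $s\mapsto\mathcal F(f_{\mu,s,\infty})(y)$, $\mathrm{Re}(s)>0$, continues holomorphically to $\mathbb C$ if $y\ne0$, and meromorphically to $\mathbb C$, with poles at most at $s=-n/2$ $(n\in\mathbb Z_{\ge0})$, if $y=0$. Let $\mathcal F_{\mu,\nu,\infty}(f)(y)$ be the value of the continuation at $s=\nu$, unless $y=0$ and $-2\nu=n\in\mathbb Z_{\ge0}$, in which case $$\mathcal F_{\mu,\nu,\infty}(f)(0)=\lim_{s\to-n/2}\Bigl(\mathcal F(f_{\mu,s,\infty})(0)-i^n\,\frac{2\cos(\pi(n+\mu)/2)}{n!\,(2s+n)}\,\delta^{(n)}(f)\Bigr).$$ For $l\in\mathbb R$ the Jacquet integral is $\mathcal J_l(F)=\int_{\mathbb R}F(\tilde w\tilde u(-x))e^{2\pi ilx}dx$ if $\mathrm{Re}(\nu)>0$; for general $\nu$ it is $\mathcal J_l(F)=\mathcal F(f_1)(l)+\mathcal F_{\mu,\nu,\infty}(f_2)(l)$, where $f_1,f_2\in C_0^\infty(\mathbb R)$ are any functions with $F=\iota(f_1)+\iota(f_2)_\infty$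 (the two definitions agree for $\mathrm{Re}(\nu)>0$). Put $\delta^{(m)}_\infty(F)=(\rho(E_+)^mF_\infty)(\tilde w)$ with $E_+=\begin{pmatrix}0&1\\0&0\end{pmatrix}$. For $\alpha\in\mathfrak M(L)$ and $\beta\in\mathfrak N(\mathbb Z_{\ge0})$ put $$\lambda_{\alpha,\beta}(F)=\sum_{l\in L}\alpha(l)\mathcal J_l(F)+\sum_{m\ge0}\beta(m)\delta^{(m)}_\infty(F)\qquad(F\in I^\infty_{\mu,\nu}).$$ **Theorem.** Let $L_1,L_2$ be shifted lattices and $\mu,\nu\in\mathbb C$. The series defining $\lambda_{\alpha,\beta}$ converge absolutely for all $\alpha\in\mathfrak M(L_i)$ $(i=1,2)$ and $F\in I^\infty_{\mu,\nu}$, and the following holds. (i) Let $\lambda$ be a quasi-automorphic distribution on $I^\infty_{\mu,\nu}$ for $(L_1,L_2)$. There are unique $(\alpha_i,\beta_i)\in\mathfrak M(L_i)\times\mathfrak N(\mathbb Z_{\ge0})$ $(i=1,2)$ such that $\lambda=\lambda_{\alpha_1,\beta_1}$ and $(\lambda_{\alpha_1,\beta_1})_\infty=\lambda_{\alpha_2,\beta_2}$.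 Moreover, if $\lambda$ is automorphic for $(L_1,L_2)$, then for $i=1,2$ we have $(\alpha_i,\beta_i)\in\mathfrak M(L_i)^0_{\mu,\nu}\times\mathfrak N(S_\nu(L_i))$, and $\beta_i(0)=0$ if $-2\nu\in\mathbb Z_{>0}$, $\mu-2\nu-1\in2\mathbb Z$ and ($0\notin L_{3-i}$ or $-2\nu>1$). (ii) Let $(\alpha_i,\beta_i)\in\mathfrak M(L_i)\times\mathfrak N(\mathbb Z_{\ge0})$ $(i=1,2)$ be such that $(\lambda_{\alpha_1,\beta_1})_\infty=\lambda_{\alpha_2,\beta_2}$. Then $\lambda_{\alpha_1,\beta_1}$ is a quasi-automorphic distribution on $I^\infty_{\mu,\nu}$ for $(L_1,L_2)$. Moreover, if $(\alpha_i,\beta_i)\in\mathfrak M(L_i)^0_{\mu,\nu}\times\mathfrak N(S_\nu(L_i))$ for $i=1,2$, then $\lambda_{\alpha_1,\beta_1}$ is automorphic for $(L_1,L_2)$. -/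

import Mathlib

open Complex Filter Topology MeasureTheory
open scoped ContDiff MatrixGroups UpperHalfPlane Distributions

noncomputable section

namespace QAD

/-! ### Shifted lattices -/

/-- A shifted lattice `u₁ + u₂ ℤ` in `ℝ`, with `u₂ ≠ 0`. -/
structure ShiftedLattice where
  carrier : Set ℝ
  exists_eq : ∃ u₁ u₂ : ℝ, u₂ ≠ 0 ∧ carrier = {x | ∃ k : ℤ, x = u₁ + u₂ * k}

/-- The lattice `L^∨ = {t | (l₁ - l₂) t ∈ ℤ for all l₁, l₂ ∈ L}`. -/
def ShiftedLattice.dual (L : ShiftedLattice) : Set ℝ :=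
  {t | ∀ l₁ ∈ L.carrier, ∀ l₂ ∈ L.carrier, ∃ k : ℤ, (l₁ - l₂) * t = k}

theorem ShiftedLattice.nonempty (L : ShiftedLattice) : L.carrier.Nonempty := by
  obtain ⟨u₁, u₂, -, h⟩ := L.exists_eq
  exact ⟨u₁, h ▸ ⟨0, by simp⟩⟩

/-- The character `ω_L(t) = exp (2π i l t)` of `L^∨`, where `l` is any point of `L`. -/
def ShiftedLattice.omega (L : ShiftedLattice) (t : ℝ) : ℂ :=
  cexp (2 * Real.pi * I * L.nonempty.some * t)

/-- The value `ω_L(t)` does not depend on the choice of the point of `L`. -/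
theorem ShiftedLattice.omega_eq (L : ShiftedLattice) {l t : ℝ} (hl : l ∈ L.carrier)
    (ht : t ∈ L.dual) : L.omega t = cexp (2 * Real.pi * I * l * t) := by
  obtain ⟨k, hk⟩ := ht _ L.nonempty.some_mem _ hl
  unfold omega
  rw [Complex.exp_eq_exp_iff_exists_int]
  refine ⟨k, ?_⟩
  have : ((L.nonempty.some - l : ℝ) : ℂ) * t = k := by exact_mod_cast hk
  push_cast at this
  linear_combination (2 * Real.pi * I) * this

/-- `𝔐(L)`: the functions on `L` of at most polynomial growth. -/
def coeffSpace (L : ShiftedLattice) : Set (L.carrier → ℂ) :=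
  {α | ∃ r : ℝ, α =O[comap (fun l : L.carrier => |(l : ℝ)|) atTop]
    fun l : L.carrier => |(l : ℝ)| ^ r}

/-! ### The universal covering group of `SL(2, ℝ)` -/

/-- The automorphy factor `J(g, z) = c z + d`. -/
def J (g : SL(2, ℝ)) (z : ℂ) : ℂ := (g 1 0 : ℂ) * z + (g 1 1 : ℂ)

theorem J_ne_zero (g : SL(2, ℝ)) (z : ℍ) : J g z ≠ 0 := by
  intro h
  have him := congrArg Complex.im h
  have hre := congrArg Complex.re h
  simp [J] at him hre
  have hdet := g.det_coe
  rw [Matrix.det_fin_two] at hdet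
  have hy := z.im_pos.ne'
  rcases him with h0 | h0
  · rw [h0] at hre hdet
    simp at hre
    rw [hre] at hdet
    simp at hdet
  · exact hy h0

theorem coe_smul_eq (g : SL(2, ℝ)) (z : ℍ) :
    ((g • z : ℍ) : ℂ) = ((g 0 0 : ℂ) * z + (g 0 1 : ℂ)) / J g z := by
  rw [UpperHalfPlane.coe_specialLinearGroup_apply]
  simp [J]

theorem J_mul (g h : SL(2, ℝ)) (z : ℍ) : J (g * h) z = J g (h • z : ℍ) * J h z := by
  rw [show J g (h • z : ℍ) = (g 1 0 : ℂ) * ((h • z : ℍ) : ℂ) + (g 1 1 : ℂ) from rfl,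
    coe_smul_eq]
  have := J_ne_zero h z
  field_simp
  simp [J, Matrix.mul_apply, Fin.sum_univ_two]
  ring

theorem J_one (z : ℂ) : J 1 z = 1 := by simp [J]

theorem arg_J_div (g : SL(2, ℝ)) (z w : ℍ) :
    arg (J g z / J g w) = arg (J g z) - arg (J g w) := by
  by_cases hc : g 1 0 = 0
  · have : J g z = J g w := by simp [J, hc]
    rw [this, div_self (J_ne_zero g w)]
    simp
  · have key : ∀ v : ℍ, (J g v).im = g 1 0 * v.im := fun v => by simp [J]
    have hpi : arg (J g w) ≠ Real.pi := by
      intro h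
      rw [arg_eq_pi_iff] at h
      have := h.2
      rw [key] at this
      exact (mul_ne_zero hc w.im_pos.ne') this
    have hinv : arg (J g w)⁻¹ = - arg (J g w) := by rw [arg_inv, if_neg hpi]
    rw [div_eq_mul_inv, arg_mul (J_ne_zero g z) (inv_ne_zero (J_ne_zero g w)), hinv, sub_eq_add_neg]
    rw [hinv]
    rcases lt_or_gt_of_ne hc with h | h
    · have h1 : arg (J g z) < 0 := arg_neg_iff.2 (by
        rw [key]; exact mul_neg_of_neg_of_pos h z.im_pos)
      have h2 : arg (J g w) < 0 := arg_neg_iff.2 (by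
        rw [key]; exact mul_neg_of_neg_of_pos h w.im_pos)
      have h3 := neg_pi_lt_arg (J g z)
      have h4 := neg_pi_lt_arg (J g w)
      constructor <;> linarith
    · have h1 : 0 ≤ arg (J g z) := arg_nonneg_iff.2 (by
        rw [key]; exact (mul_pos h z.im_pos).le)
      have h2 : 0 ≤ arg (J g w) := arg_nonneg_iff.2 (by
        rw [key]; exact (mul_pos h w.im_pos).le)
      have h3 := arg_le_pi (J g z)
      have h4 : arg (J g w) < Real.pi := lt_of_le_of_ne (arg_le_pi _) hpi
      constructor <;> linarith

theorem continuous_arg_J (g : SL(2, ℝ)) : Continuous fun z : ℍ => arg (J g z) := by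
  by_cases hc : g 1 0 = 0
  · simp only [J, hc]
    simp only [ofReal_zero, zero_mul]
    exact continuous_const
  · rw [continuous_iff_continuousAt]
    intro z
    have h1 : J g z ∈ slitPlane := by
      right
      have : (J g z).im = g 1 0 * z.im := by simp [J]
      rw [this]
      exact mul_ne_zero hc z.im_pos.ne'
    have h2 : Continuous fun z : ℍ => J g z := by
      unfold J
      exact (continuous_const.mul UpperHalfPlane.continuous_coe).add continuous_const
    exact ContinuousAt.comp (f := fun z : ℍ => J g z) (g := arg)
      (continuousAt_arg h1) h2.continuousAt

theorem arg_J_cocycle (g h : SL(2, ℝ)) (z w : ℍ) :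
    arg (J (g * h) z) - arg (J g (h • z : ℍ)) - arg (J h z)
      = arg (J (g * h) w) - arg (J g (h • w : ℍ)) - arg (J h w) := by
  set e : ℍ → ℝ := fun z => arg (J (g * h) z) - arg (J g (h • z : ℍ)) - arg (J h z) with he
  have hint : ∀ z, ∃ k : ℤ, e z = 2 * Real.pi * k := by
    intro z
    have h1 : (arg (J (g * h) z) : Real.Angle)
        = ((arg (J g (h • z : ℍ)) + arg (J h z) : ℝ) : Real.Angle) := by
      rw [J_mul, arg_mul_coe_angle (J_ne_zero _ _) (J_ne_zero _ _)]
      simp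
    rw [Real.Angle.angle_eq_iff_two_pi_dvd_sub] at h1
    obtain ⟨k, hk⟩ := h1
    exact ⟨k, by simp only [he]; linarith⟩
  have hsm : Continuous fun z : ℍ => h • z := by fun_prop
  have hcont : Continuous e :=
    ((continuous_arg_J (g * h)).sub ((continuous_arg_J g).comp hsm)).sub (continuous_arg_J h)
  have hpre : (Set.range e).OrdConnected := (isPreconnected_range hcont).ordConnected
  have main : ∀ z w, ¬ e z < e w := by
    intro z w hlt
    obtain ⟨k, hk⟩ := hint z
    obtain ⟨m, hm⟩ := hint w
    have hpi := Real.pi_pos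
    have hkm : k < m := by
      rw [hk, hm] at hlt
      exact_mod_cast lt_of_mul_lt_mul_left hlt (by positivity)
    have hkm' : (k : ℝ) + 1 ≤ m := by exact_mod_cast hkm
    obtain ⟨v, hv⟩ := hpre.out ⟨z, rfl⟩ ⟨w, rfl⟩
      (show e z + Real.pi ∈ Set.Icc (e z) (e w) from ⟨by linarith, by rw [hk, hm]; nlinarith⟩)
    obtain ⟨j, hj⟩ := hint v
    rw [hj, hk] at hv
    have : (2 * j : ℝ) = 2 * k + 1 := by
      apply mul_left_cancel₀ hpi.ne'
      linarith
    have h2 : 2 * j = 2 * k + 1 := by exact_mod_cast this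
    omega
  exact le_antisymm (not_lt.1 (main w z)) (not_lt.1 (main z w))

/-- The universal covering group of `SL(2, ℝ)`: the pairs `(g, θ)` with
`J(g, i) exp (i θ) = |J(g, i)|`. -/
@[ext]
structure Cover where
  g : SL(2, ℝ)
  θ : ℝ
  prop : J g I * cexp (I * θ) = (‖J g I‖ : ℂ)

theorem exp_I_arg (z : ℂ) (hz : z ≠ 0) : cexp (I * arg z) = z / ‖z‖ := by
  have := Complex.norm_mul_exp_arg_mul_I z
  rw [eq_div_iff (by simpa using hz), mul_comm I, mul_comm]
  exact this

theorem Cover.exp_θ (a : Cover) : cexp (I * a.θ) = (‖J a.g I‖ : ℂ) / J a.g I := by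
  have h := J_ne_zero a.g UpperHalfPlane.I
  rw [UpperHalfPlane.coe_I] at h
  rw [eq_div_iff h, mul_comm]
  exact a.prop

instance : Mul Cover where
  mul a b :=
    { g := a.g * b.g
      θ := a.θ + b.θ - arg (J a.g (b.g • UpperHalfPlane.I : ℍ) / J a.g I)
      prop := by
        have h1 := J_ne_zero a.g UpperHalfPlane.I
        have h2 := J_ne_zero b.g UpperHalfPlane.I
        have h3 := J_ne_zero a.g (b.g • UpperHalfPlane.I)
        have h4 := J_mul a.g b.g UpperHalfPlane.I
        rw [UpperHalfPlane.coe_I] at h1 h2 h4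
        have h5 := exp_I_arg _ (div_ne_zero h3 h1)
        have h6 : cexp (I * ((a.θ + b.θ
            - arg (J a.g (b.g • UpperHalfPlane.I : ℍ) / J a.g I) : ℝ) : ℂ))
            = cexp (I * a.θ) * cexp (I * b.θ)
              / cexp (I * arg (J a.g (b.g • UpperHalfPlane.I : ℍ) / J a.g I)) := by
          rw [← Complex.exp_add, ← Complex.exp_sub]
          congr 1
          push_cast
          ring
        rw [h6, h5, a.exp_θ, b.exp_θ, h4, norm_mul, norm_div]
        have n1 : (‖J a.g I‖ : ℂ) ≠ 0 := by simpa using h1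
        have n3 : (‖J a.g (b.g • UpperHalfPlane.I : ℍ)‖ : ℂ) ≠ 0 := by simpa using h3
        push_cast
        field_simp }

instance : One Cover where
  one := { g := 1, θ := 0, prop := by simp [J] }

instance : Inv Cover where
  inv a :=
    { g := a.g⁻¹
      θ := -a.θ + arg (J a.g⁻¹ (a.g • UpperHalfPlane.I : ℍ) / J a.g⁻¹ I)
      prop := by
        have h1 := J_ne_zero a.g⁻¹ UpperHalfPlane.I
        have h2 := J_ne_zero a.g UpperHalfPlane.I
        have h3 := J_ne_zero a.g⁻¹ (a.g • UpperHalfPlane.I)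
        have h4 := J_mul a.g⁻¹ a.g UpperHalfPlane.I
        rw [inv_mul_cancel, J_one] at h4
        rw [UpperHalfPlane.coe_I] at h1 h2 h4
        have h5 := exp_I_arg _ (div_ne_zero h3 h1)
        have h6 : cexp (I * ((-a.θ
            + arg (J a.g⁻¹ (a.g • UpperHalfPlane.I : ℍ) / J a.g⁻¹ I) : ℝ) : ℂ))
            = cexp (I * arg (J a.g⁻¹ (a.g • UpperHalfPlane.I : ℍ) / J a.g⁻¹ I))
              / cexp (I * a.θ) := by
          rw [← Complex.exp_sub]
          congr 1
          push_cast
          ring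
        have h7 : (‖J a.g⁻¹ (a.g • UpperHalfPlane.I : ℍ)‖ : ℂ) * ‖J a.g I‖ = 1 := by
          rw [← ofReal_mul, ← norm_mul, ← h4]
          simp
        have n1 : (‖J a.g⁻¹ I‖ : ℂ) ≠ 0 := by simpa using h1
        have n2 : (‖J a.g I‖ : ℂ) ≠ 0 := by simpa using h2
        have n3 : (‖J a.g⁻¹ (a.g • UpperHalfPlane.I : ℍ)‖ : ℂ) ≠ 0 := by simpa using h3
        rw [h6, h5, a.exp_θ, norm_div]
        push_cast
        field_simp
        rw [mul_comm _ (J a.g I), mul_comm (J a.g I), ← h4, mul_comm _ (‖J a.g I‖ : ℂ)] at *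
        linear_combination -h7 }

theorem Cover.mul_g (a b : Cover) : (a * b).g = a.g * b.g := rfl

theorem Cover.mul_θ (a b : Cover) :
    (a * b).θ = a.θ + b.θ - arg (J a.g (b.g • UpperHalfPlane.I : ℍ) / J a.g I) := rfl

theorem Cover.one_g : (1 : Cover).g = 1 := rfl

theorem Cover.one_θ : (1 : Cover).θ = 0 := rfl

theorem Cover.inv_g (a : Cover) : (a⁻¹).g = a.g⁻¹ := rfl

theorem Cover.inv_θ (a : Cover) :
    (a⁻¹).θ = -a.θ + arg (J a.g⁻¹ (a.g • UpperHalfPlane.I : ℍ) / J a.g⁻¹ I) := rfl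

/-- The group structure of the universal covering group. -/
instance : Group Cover :=
  Group.ofLeftAxioms
    (by
      intro a b c
      refine Cover.ext (mul_assoc _ _ _) ?_
      have e : ∀ g : SL(2, ℝ), ∀ z : ℍ, arg (J g z / J g I)
          = arg (J g z) - arg (J g UpperHalfPlane.I) := by
        intro g z
        rw [← arg_J_div, UpperHalfPlane.coe_I]
      simp only [Cover.mul_θ, Cover.mul_g, e]
      have h := arg_J_cocycle a.g b.g (c.g • UpperHalfPlane.I) UpperHalfPlane.I
      rw [← mul_smul] at h
      linarith)
    (by
      intro a
      refine Cover.ext (one_mul _) ?_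
      simp [Cover.mul_θ, Cover.one_g, Cover.one_θ, J_one])
    (by
      intro a
      refine Cover.ext (inv_mul_cancel _) ?_
      simp only [Cover.mul_θ, Cover.inv_g, Cover.inv_θ, Cover.one_θ]
      ring)

/-- `ũ(x)`: the lift of the upper unipotent matrix `(1, x; 0, 1)`. -/
def tu (x : ℝ) : Cover where
  g := ⟨!![1, x; 0, 1], by simp⟩
  θ := 0
  prop := by simp [J]

/-- `ã(y)`: the lift of the diagonal matrix `(√y, 0; 0, 1/√y)`, for `y > 0`. -/
def ta (y : ℝ) (hy : 0 < y) : Cover where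
  g := ⟨!![Real.sqrt y, 0; 0, 1 / Real.sqrt y], by
    have := (Real.sqrt_pos.2 hy).ne'
    simp [this]⟩
  θ := 0
  prop := by
    have := (Real.sqrt_pos.2 hy)
    simp [J, abs_of_pos this]

theorem J_rot (t : ℝ) : (-Real.sin t : ℂ) * I + Real.cos t = cexp (-(t * I)) := by
  rw [← neg_mul, Complex.exp_mul_I, Complex.cos_neg, Complex.sin_neg]
  push_cast
  ring

/-- `k̃(θ)`: the lift of the rotation matrix `(cos θ, sin θ; -sin θ, cos θ)`. -/
def tk (t : ℝ) : Cover where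
  g := ⟨!![Real.cos t, Real.sin t; -Real.sin t, Real.cos t], by
    rw [Matrix.det_fin_two_of]
    linarith [Real.sin_sq_add_cos_sq t]⟩
  θ := t
  prop := by
    have h : J (⟨!![Real.cos t, Real.sin t; -Real.sin t, Real.cos t], by
        rw [Matrix.det_fin_two_of]
        linarith [Real.sin_sq_add_cos_sq t]⟩ : SL(2, ℝ)) I = cexp (-(t * I)) := by
      rw [← J_rot]
      simp [J]
    rw [h, ← Complex.exp_add, Complex.norm_exp]
    simp [mul_comm]

/-- `w̃ = k̃(-π/2)`, a lift of `(0, -1; 1, 0)`. -/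
def tw : Cover := tk (-(Real.pi / 2))

/-- The lift `w̃ ũ(-x) w̃⁻¹` of the lower unipotent matrix `(1, 0; x, 1)`. -/
def tubar (x : ℝ) : Cover := tw * tu (-x) * tw⁻¹

/-- The Iwasawa coordinates `(x, s, θ) ↦ ũ(x) ã(exp s) k̃(θ)`, a global chart of the
universal covering group, with inverse `(g, θ) ↦ (Re (g i), log (Im (g i)), θ)`. -/
def iwasawa (p : ℝ × ℝ × ℝ) : Cover :=
  tu p.1 * ta (Real.exp p.2.1) (Real.exp_pos _) * tk p.2.2

/-- Smooth functions on the universal covering group. -/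
def IsSmooth (F : Cover → ℂ) : Prop := ContDiff ℝ ∞ fun p => F (iwasawa p)

theorem J_ratio_mem_slitPlane (g : SL(2, ℝ)) (z w : ℍ) : J g z / J g w ∈ slitPlane := by
  rw [mem_slitPlane_iff_arg]
  refine ⟨?_, div_ne_zero (J_ne_zero _ _) (J_ne_zero _ _)⟩
  rw [arg_J_div]
  by_cases hc : g 1 0 = 0
  · have : J g z = J g w := by simp [J, hc]
    rw [this]
    simpa using Real.pi_pos.ne
  · have key : ∀ v : ℍ, (J g v).im = g 1 0 * v.im := fun v => by simp [J]
    have hpi : arg (J g z) ≠ Real.pi := by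
      intro h
      rw [arg_eq_pi_iff] at h
      have := h.2
      rw [key] at this
      exact (mul_ne_zero hc z.im_pos.ne') this
    rcases lt_or_gt_of_ne hc with h | h
    · have h1 : arg (J g z) < 0 := arg_neg_iff.2 (by
        rw [key]; exact mul_neg_of_neg_of_pos h z.im_pos)
      have h4 := neg_pi_lt_arg (J g w)
      intro h5
      linarith
    · have h2 : 0 ≤ arg (J g w) := arg_nonneg_iff.2 (by
        rw [key]; exact (mul_pos h w.im_pos).le)
      have h4 : arg (J g z) < Real.pi := lt_of_le_of_ne (arg_le_pi _) hpi
      intro h5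
      linarith

theorem J_of_lower_zero {g : SL(2, ℝ)} (h : g 1 0 = 0) (z : ℂ) : J g z = g 1 1 := by
  simp [J, h]

/-- If the matrix of `a` is upper triangular then the angles add up in `a * b`. -/
theorem mul_θ_of_lower_zero {a : Cover} (h : a.g 1 0 = 0) (b : Cover) :
    (a * b).θ = a.θ + b.θ := by
  have h1 := J_ne_zero a.g UpperHalfPlane.I
  rw [Cover.mul_θ, J_of_lower_zero h, J_of_lower_zero h]
  rw [J_of_lower_zero h] at h1
  rw [div_self h1]
  simp

theorem mul_entry (a b : Cover) (i j : Fin 2) :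
    (a * b).g i j = a.g i 0 * b.g 0 j + a.g i 1 * b.g 1 j := by
  rw [Cover.mul_g, Matrix.SpecialLinearGroup.coe_mul, Matrix.mul_apply, Fin.sum_univ_two]

theorem iwasawa_θ (p : ℝ × ℝ × ℝ) : (iwasawa p).θ = p.2.2 := by
  unfold iwasawa
  rw [mul_θ_of_lower_zero, mul_θ_of_lower_zero]
  · simp [tu, ta, tk]
  · simp [tu]
  · rw [mul_entry]
    simp [tu, ta]

theorem iwasawa_g10 (p : ℝ × ℝ × ℝ) :
    (iwasawa p).g 1 0 = -Real.sin p.2.2 / Real.sqrt (Real.exp p.2.1) := by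
  simp only [iwasawa, mul_entry]
  simp [tu, ta, tk]
  ring

theorem iwasawa_g11 (p : ℝ × ℝ × ℝ) :
    (iwasawa p).g 1 1 = Real.cos p.2.2 / Real.sqrt (Real.exp p.2.1) := by
  simp only [iwasawa, mul_entry]
  simp [tu, ta, tk]
  ring

theorem tu_mul_tu (x y : ℝ) : tu x * tu y = tu (x + y) := by
  refine Cover.ext ?_ ?_
  · ext i j
    rw [mul_entry]
    fin_cases i <;> fin_cases j <;> simp [tu, add_comm]
  · rw [mul_θ_of_lower_zero] <;> simp [tu]

theorem ta_mul_ta (x y : ℝ) (hx : 0 < x) (hy : 0 < y) :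
    ta x hx * ta y hy = ta (x * y) (mul_pos hx hy) := by
  refine Cover.ext ?_ ?_
  · ext i j
    rw [mul_entry]
    fin_cases i <;> fin_cases j <;> simp [ta, Real.sqrt_mul hx.le, mul_comm]
  · rw [mul_θ_of_lower_zero] <;> simp [ta]

theorem ta_mul_tu (y x : ℝ) (hy : 0 < y) : ta y hy * tu x = tu (y * x) * ta y hy := by
  refine Cover.ext ?_ ?_
  · ext i j
    rw [mul_entry, mul_entry]
    have h1 := (Real.sqrt_pos.2 hy).ne'
    have h2 := Real.mul_self_sqrt hy.le
    fin_cases i <;> fin_cases j <;> simp [tu, ta]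
    field_simp
    linear_combination x * h2
  · rw [mul_θ_of_lower_zero, mul_θ_of_lower_zero] <;> simp [tu, ta]

/-- The Iwasawa decomposition of an element of the universal covering group. -/
theorem iwasawa_decomp (a : Cover) :
    a = tu (a.g • UpperHalfPlane.I : ℍ).re
      * ta (a.g • UpperHalfPlane.I : ℍ).im (UpperHalfPlane.im_pos _) * tk a.θ := by
  set n : ℝ := ‖J a.g I‖ with hn
  have hJ := J_ne_zero a.g UpperHalfPlane.I
  rw [UpperHalfPlane.coe_I] at hJ
  have hn0 : 0 < n := norm_pos_iff.2 hJ
  have hdet : a.g 0 0 * a.g 1 1 - a.g 0 1 * a.g 1 0 = 1 := by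
    have := a.g.det_coe
    rwa [Matrix.det_fin_two] at this
  have hn2 : n ^ 2 = a.g 1 0 ^ 2 + a.g 1 1 ^ 2 := by
    rw [hn, Complex.sq_norm, Complex.normSq_apply]
    simp [J]
    ring
  have hcd : J a.g I = n * cexp (-(a.θ * I)) := by
    have h := a.prop
    rw [← hn] at h
    rw [← h, mul_assoc, ← Complex.exp_add]
    simp [mul_comm]
  rw [← J_rot] at hcd
  have hc : a.g 1 0 = -n * Real.sin a.θ := by
    have := congrArg Complex.im hcd
    simpa [J, -ofReal_sin, -ofReal_cos] using this
  have hd : a.g 1 1 = n * Real.cos a.θ := by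
    have := congrArg Complex.re hcd
    simpa [J, -ofReal_sin, -ofReal_cos] using this
  have hz : ((a.g • UpperHalfPlane.I : ℍ) : ℂ)
      = (((a.g 0 0 * a.g 1 0 + a.g 0 1 * a.g 1 1) / n ^ 2 : ℝ) : ℂ)
        + ((1 / n ^ 2 : ℝ) : ℂ) * I := by
    rw [coe_smul_eq, UpperHalfPlane.coe_I, div_eq_iff hJ]
    have hn2' : (n : ℂ) ^ 2 = (a.g 1 0 : ℂ) ^ 2 + (a.g 1 1 : ℂ) ^ 2 := by exact_mod_cast hn2
    have hdet' : (a.g 0 0 : ℂ) * a.g 1 1 - a.g 0 1 * a.g 1 0 = 1 := by exact_mod_cast hdet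
    have hn0' : (n : ℂ) ≠ 0 := by exact_mod_cast hn0.ne'
    push_cast
    field_simp
    rw [hn2', J]
    linear_combination (I * a.g 1 1 - (a.g 1 0 : ℂ)) * hdet'
      - (a.g 1 0 : ℂ) * I_sq
  have hx : (a.g • UpperHalfPlane.I : ℍ).re
      = (a.g 0 0 * a.g 1 0 + a.g 0 1 * a.g 1 1) / n ^ 2 := by
    rw [← UpperHalfPlane.coe_re, hz]
    simp [-ofReal_div, -ofReal_pow]
  have hy : (a.g • UpperHalfPlane.I : ℍ).im = 1 / n ^ 2 := by
    rw [← UpperHalfPlane.coe_im, hz]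
    simp [-ofReal_div, -ofReal_pow]
  have hsq : Real.sqrt (a.g • UpperHalfPlane.I : ℍ).im = 1 / n := by
    rw [hy, Real.sqrt_div zero_le_one, Real.sqrt_one, Real.sqrt_sq hn0.le]
  refine Cover.ext ?_ ?_
  · have e00 : a.g 0 0 = 1 / n * Real.cos a.θ
        - (a.g 0 0 * a.g 1 0 + a.g 0 1 * a.g 1 1) / n ^ 2 * n * Real.sin a.θ := by
      have h1 : Real.cos a.θ = a.g 1 1 / n := by rw [hd]; field_simp
      have h2 : Real.sin a.θ = -a.g 1 0 / n := by rw [hc]; field_simp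
      rw [h1, h2]
      field_simp
      rw [hn2]
      linear_combination (a.g 1 1) * hdet
    have e01 : a.g 0 1 = 1 / n * Real.sin a.θ
        + (a.g 0 0 * a.g 1 0 + a.g 0 1 * a.g 1 1) / n ^ 2 * n * Real.cos a.θ := by
      have h1 : Real.cos a.θ = a.g 1 1 / n := by rw [hd]; field_simp
      have h2 : Real.sin a.θ = -a.g 1 0 / n := by rw [hc]; field_simp
      rw [h1, h2]
      field_simp
      rw [hn2]
      linear_combination (-a.g 1 0) * hdet
    ext i j
    simp only [mul_entry]
    fin_cases i <;> fin_cases j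
    · simp [tu, ta, tk, hsq, hx]
      rw [← sub_eq_zero] at e00 ⊢
      rw [← e00]
      field_simp
      ring
    · simp [tu, ta, tk, hsq, hx]
      rw [← sub_eq_zero] at e01 ⊢
      rw [← e01]
      field_simp
    · simp [tu, ta, tk, hsq, hc]
    · simp [tu, ta, tk, hsq, hd]
  · rw [mul_θ_of_lower_zero, mul_θ_of_lower_zero]
    · simp [tu, ta, tk]
    · simp [tu]
    · rw [mul_entry]
      simp [tu, ta]

theorem IsSmooth.right_translate {F : Cover → ℂ} (hF : IsSmooth F) (h : Cover) :
    IsSmooth fun a => F (a * h) := by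
  set w : ℍ := h.g • UpperHalfPlane.I with hw
  have hre : ∀ t : ℝ, (((tk t * h).g • UpperHalfPlane.I : ℍ) : ℂ)
      = ((Real.cos t : ℂ) * w + Real.sin t) / (-(Real.sin t : ℂ) * w + Real.cos t) := by
    intro t
    rw [Cover.mul_g, mul_smul, coe_smul_eq, J]
    simp [tk, hw]
  have hden : ∀ t : ℝ, (-(Real.sin t : ℂ) * w + Real.cos t) ≠ 0 := by
    intro t
    have := J_ne_zero (tk t).g w
    simpa [J, tk] using this
  have hcs : ContDiff ℝ ∞ fun t : ℝ => ((Real.cos t : ℝ) : ℂ) :=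
    ofRealCLM.contDiff.comp Real.contDiff_cos
  have hsn : ContDiff ℝ ∞ fun t : ℝ => ((Real.sin t : ℝ) : ℂ) :=
    ofRealCLM.contDiff.comp Real.contDiff_sin
  have hz : ContDiff ℝ ∞ fun t : ℝ => (((tk t * h).g • UpperHalfPlane.I : ℍ) : ℂ) := by
    simp only [hre]
    simp only [div_eq_mul_inv]
    exact ((hcs.mul contDiff_const).add hsn).mul
      (((hsn.neg.mul contDiff_const).add hcs).inv hden)
  have hx : ContDiff ℝ ∞ fun t : ℝ => ((tk t * h).g • UpperHalfPlane.I : ℍ).re :=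
    reCLM.contDiff.comp hz
  have hy : ContDiff ℝ ∞ fun t : ℝ => ((tk t * h).g • UpperHalfPlane.I : ℍ).im :=
    imCLM.contDiff.comp hz
  have hly : ContDiff ℝ ∞ fun t : ℝ =>
      Real.log ((tk t * h).g • UpperHalfPlane.I : ℍ).im :=
    hy.log fun t => (UpperHalfPlane.im_pos _).ne'
  have hθ : ContDiff ℝ ∞ fun t : ℝ => (tk t * h).θ := by
    have hden' : ∀ t : ℝ, (-(Real.sin t : ℂ) * I + Real.cos t) ≠ 0 := by
      intro t
      have := J_ne_zero (tk t).g UpperHalfPlane.I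
      simpa [J, tk] using this
    have hr : ContDiff ℝ ∞ fun t : ℝ => (-(Real.sin t : ℂ) * w + Real.cos t)
        / (-(Real.sin t : ℂ) * I + Real.cos t) := by
      simp only [div_eq_mul_inv]
      exact ((hsn.neg.mul contDiff_const).add hcs).mul
        (((hsn.neg.mul contDiff_const).add hcs).inv hden')
    have hlog : ContDiff ℝ ∞ fun t : ℝ => log ((-(Real.sin t : ℂ) * w + Real.cos t)
        / (-(Real.sin t : ℂ) * I + Real.cos t)) := by
      rw [contDiff_iff_contDiffAt]
      intro t
      have hmem := J_ratio_mem_slitPlane (tk t).g w UpperHalfPlane.I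
      have hmem' : (-(Real.sin t : ℂ) * w + Real.cos t)
        / (-(Real.sin t : ℂ) * I + Real.cos t) ∈ slitPlane := by
        simpa [J, tk] using hmem
      exact ((contDiffAt_log hmem').restrict_scalars ℝ).comp t hr.contDiffAt
    have heq : (fun t : ℝ => (tk t * h).θ) = fun t : ℝ => t + h.θ
        - (log ((-(Real.sin t : ℂ) * w + Real.cos t)
        / (-(Real.sin t : ℂ) * I + Real.cos t))).im := by
      funext t
      rw [Cover.mul_θ, Complex.log_im]
      simp [J, tk, hw]
    rw [heq]
    exact (contDiff_id.add contDiff_const).sub (imCLM.contDiff.comp hlog)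
  have key : ∀ p : ℝ × ℝ × ℝ, iwasawa p * h = iwasawa
      (p.1 + Real.exp p.2.1 * ((tk p.2.2 * h).g • UpperHalfPlane.I : ℍ).re,
        p.2.1 + Real.log ((tk p.2.2 * h).g • UpperHalfPlane.I : ℍ).im, (tk p.2.2 * h).θ) := by
    intro p
    have h1 : ta (Real.exp (p.2.1 + Real.log ((tk p.2.2 * h).g • UpperHalfPlane.I : ℍ).im))
        (Real.exp_pos _) = ta (Real.exp p.2.1) (Real.exp_pos _)
          * ta ((tk p.2.2 * h).g • UpperHalfPlane.I : ℍ).im (UpperHalfPlane.im_pos _) := by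
      rw [ta_mul_ta]
      congr 1
      rw [Real.exp_add, Real.exp_log (UpperHalfPlane.im_pos _)]
    have h2 : iwasawa p * h = tu p.1 * ta (Real.exp p.2.1) (Real.exp_pos _)
        * (tk p.2.2 * h) := by
      simp only [iwasawa, mul_assoc]
    rw [h2]
    conv_lhs => rw [iwasawa_decomp (tk p.2.2 * h)]
    unfold iwasawa
    rw [h1, ← tu_mul_tu]
    simp only [mul_assoc]
    rw [← mul_assoc (ta (Real.exp p.2.1) _) (tu _), ta_mul_tu]
    simp only [mul_assoc]
  unfold IsSmooth
  simp only [key]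
  refine ContDiff.comp (g := fun p => F (iwasawa p)) hF ?_
  have c1 : ContDiff ℝ ∞ fun p : ℝ × ℝ × ℝ => p.2.1 := contDiff_fst.comp contDiff_snd
  have c2 : ContDiff ℝ ∞ fun p : ℝ × ℝ × ℝ => p.2.2 := contDiff_snd.comp contDiff_snd
  exact (contDiff_fst.add (c1.exp.mul (hx.comp c2))).prodMk
    ((c1.add (hly.comp c2)).prodMk (hθ.comp c2))

/-! ### Principal series -/

/-- The space `I_{μ,ν}^∞` of the smooth functions `F` on the universal covering group with
`F(ũ(x) ã(y) k̃(mπ) g) = exp (π i m μ) y ^ (ν + 1/2) F(g)`. -/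
def PS (μ ν : ℂ) : Submodule ℂ (Cover → ℂ) where
  carrier := {F | (∀ (x y : ℝ) (hy : 0 < y) (m : ℤ) (a : Cover),
      F (tu x * ta y hy * tk (m * Real.pi) * a)
        = cexp (Real.pi * m * I * μ) * (y : ℂ) ^ (ν + 1 / 2) * F a) ∧ IsSmooth F}
  add_mem' := by
    rintro F G ⟨hF, hF'⟩ ⟨hG, hG'⟩
    refine ⟨fun x y hy m a => ?_, ?_⟩
    · simp only [Pi.add_apply, hF, hG]
      ring
    · exact ContDiff.add hF' hG'
  zero_mem' := by
    refine ⟨fun x y hy m a => by simp, ?_⟩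
    exact contDiff_const
  smul_mem' := by
    rintro c F ⟨hF, hF'⟩
    refine ⟨fun x y hy m a => ?_, ?_⟩
    · simp only [Pi.smul_apply, hF, smul_eq_mul]
      ring
    · exact ContDiff.const_smul c hF'

/-- Right translation `(ρ(h) F)(g) = F(g h)` on `I_{μ,ν}^∞`. -/
def rho {μ ν : ℂ} (h : Cover) (F : PS μ ν) : PS μ ν :=
  ⟨fun a => F.1 (a * h), fun x y hy m a => by
    have h1 := F.2.1 x y hy m (a * h)
    rw [← mul_assoc] at h1
    exact h1, F.2.2.right_translate h⟩

/-- The involution `F_∞ = exp (π i μ / 2) ρ(w̃) F` of `I_{μ,ν}^∞`. -/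
def flip {μ ν : ℂ} (F : PS μ ν) : PS μ ν := cexp (Real.pi * I * μ / 2) • rho tw F

/-- The standard basis `H`, `E₊`, `E₋` of `𝔰𝔩(2)`. -/
inductive Gen
  | H
  | Ep
  | Em

/-- The one-parameter subgroup `t ↦ exp (t X)` of the universal covering group,
for `X = H, E₊, E₋`. -/
def Gen.expo : Gen → ℝ → Cover
  | .H, t => ta (Real.exp (2 * t)) (Real.exp_pos _)
  | .Ep, t => tu t
  | .Em, t => tubar t

/-- `(ρ(X) F)(g) = d/dt F(g exp (t X))` at `t = 0`. -/
def rhoGen (X : Gen) (F : Cover → ℂ) : Cover → ℂ :=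
  fun a => deriv (fun t : ℝ => F (a * X.expo t)) 0

/-- The action on smooth functions of a complex linear combination of words in `H, E₊, E₋`, where
the word `X₁ ⋯ Xₖ` acts by `ρ(X₁) ∘ ⋯ ∘ ρ(Xₖ)`. As such combinations represent exactly
the elements of the universal enveloping algebra of `𝔰𝔩(2, ℂ)`, the operators `rhoU X` are
exactly the operators by which that algebra acts. -/
def rhoU (X : List Gen →₀ ℂ) (F : Cover → ℂ) : Cover → ℂ :=
  fun a => X.sum fun w c => c * w.foldr rhoGen F a

/-- `|F|_K = sup |F(k̃(θ))|` over `-π ≤ θ < π`. -/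
def normK (F : Cover → ℂ) : ℝ := ⨆ θ : Set.Ico (-Real.pi) Real.pi, ‖F (tk θ)‖

/-- The distributions on `I_{μ,ν}^∞`: the linear functionals that are continuous for the topology
given by the seminorms `F ↦ |ρ(X) F|_K`. -/
def PSDist (μ ν : ℂ) : Set (PS μ ν → ℂ) :=
  {lam | IsLinearMap ℂ lam ∧ ∃ c : ℝ, 0 < c ∧ ∃ S : Finset (List Gen →₀ ℂ),
    ∀ F : PS μ ν, ‖lam F‖ ≤ c * ∑ X ∈ S, normK (rhoU X F)}

/-- `λ_∞(F) = λ(F_∞)`. -/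
def distInv {μ ν : ℂ} (lam : PS μ ν → ℂ) : PS μ ν → ℂ := fun F => lam (flip F)

/-! ### Test functions and distributions on `ℝ` -/

/-- The space `C₀^∞(ℝ)` of complex test functions on `ℝ`. -/
abbrev Test : Type := 𝓓((⊤ : TopologicalSpace.Opens ℝ), ℂ)

/-- The space `𝓓'(ℝ)` of distributions on `ℝ`. -/
def RDist : Set (Test → ℂ) :=
  {T | IsLinearMap ℂ T ∧ ∀ u : ℝ, 0 < u → ∃ (m : ℕ) (c : ℝ), 0 < c ∧
    ∀ f : Test, tsupport f ⊆ Set.Icc (-u) u →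
      ‖T f‖ ≤ c * ∑ i ∈ Finset.range (m + 1), ⨆ x : ℝ, ‖iteratedDeriv i f x‖}

/-- The translate `x ↦ f(x + t)`. -/
def translate (t : ℝ) (f : Test) : Test where
  toFun x := f (x + t)
  contDiff' := f.contDiff.comp (contDiff_id.add contDiff_const)
  hasCompactSupport' := f.hasCompactSupport.comp_homeomorph (Homeomorph.addRight t)
  tsupport_subset' := fun _ _ => trivial

/-- The space `𝓓'(L^∨ \ ℝ; ω_L)`. -/
def PeriodicDist (L : ShiftedLattice) : Set (Test → ℂ) :=
  {T | T ∈ RDist ∧ ∀ t ∈ L.dual, ∀ f : Test, T (translate t f) = L.omega (-t) * T f}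

/-- The factor `J_{μ,ν}(x) = exp (-sgn(x) π i μ / 2) |x| ^ (-2ν - 1)`. -/
def Jfac (μ ν : ℂ) (x : ℝ) : ℂ :=
  cexp (-(Real.sign x : ℂ) * Real.pi * I * μ / 2) * ((|x| : ℝ) : ℂ) ^ (-2 * ν - 1)

/-- The function `f_{μ,ν,∞}(x) = J_{μ,ν}(x) f(-1/x)` on `x ≠ 0` (its value at `0` is irrelevant;
it is `0` if `f` vanishes near `0`). -/
def invFun (μ ν : ℂ) (f : ℝ → ℂ) (x : ℝ) : ℂ := Jfac μ ν x * f (-1 / x)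

theorem exists_bound (f : Test) : ∃ R : ℝ, 0 < R ∧ ∀ x : ℝ, R < |x| → f x = 0 := by
  obtain ⟨R, hR, h⟩ := f.hasCompactSupport.isCompact.isBounded.exists_pos_norm_le
  refine ⟨R, hR, fun x hx => ?_⟩
  by_contra h0
  exact absurd (h x (subset_tsupport _ h0)) (not_le.2 hx)

theorem contDiffAt_Jfac (μ ν : ℂ) {x : ℝ} (hx : x ≠ 0) : ContDiffAt ℝ ∞ (Jfac μ ν) x := by
  have h1 : ContDiffAt ℝ ∞ (fun x : ℝ => ((|x| : ℝ) : ℂ) ^ (-2 * ν - 1)) x := by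
    have h2 : (fun x : ℝ => ((|x| : ℝ) : ℂ) ^ (-2 * ν - 1))
        =ᶠ[𝓝 x] fun x : ℝ => cexp (((Real.log |x| : ℝ) : ℂ) * (-2 * ν - 1)) := by
      filter_upwards [isOpen_ne.mem_nhds hx] with y hy
      have hy' : (y : ℝ) ≠ 0 := hy
      rw [cpow_def_of_ne_zero (by simpa using hy'), ofReal_log (abs_nonneg y)]
    refine ContDiffAt.congr_of_eventuallyEq ?_ h2
    have h3 : ContDiffAt ℝ ∞ (fun x : ℝ => Real.log |x|) x := by
      simp only [Real.log_abs]
      exact Real.contDiffAt_log.2 hx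
    exact ((ofRealCLM.contDiff.contDiffAt.comp x h3).mul contDiffAt_const).cexp
  have h4 : (fun x : ℝ => cexp (-(Real.sign x : ℂ) * Real.pi * I * μ / 2))
      =ᶠ[𝓝 x] fun _ => cexp (-(Real.sign x : ℂ) * Real.pi * I * μ / 2) := by
    rcases lt_or_gt_of_ne hx with h | h
    · filter_upwards [isOpen_Iio.mem_nhds h] with y hy
      rw [Real.sign_of_neg h, Real.sign_of_neg hy]
    · filter_upwards [isOpen_Ioi.mem_nhds h] with y hy
      rw [Real.sign_of_pos h, Real.sign_of_pos hy]
  exact (contDiffAt_const.congr_of_eventuallyEq h4).mul h1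

/-- For `f ∈ C₀^∞(ℝ ∖ {0})`, the function `f_{μ,ν,∞}` as a test function. -/
def testInv (μ ν : ℂ) (f : Test) (hf : (0 : ℝ) ∉ tsupport f) : Test where
  toFun := invFun μ ν f
  contDiff' := by
    rw [contDiff_iff_contDiffAt]
    intro x
    by_cases hx : x = 0
    · obtain ⟨R, hR, h⟩ := exists_bound f
      have h0 : invFun μ ν f =ᶠ[𝓝 x] fun _ => 0 := by
        have : {y : ℝ | |y| < 1 / R} ∈ 𝓝 x := by
          rw [hx]
          exact (isOpen_lt continuous_abs continuous_const).mem_nhds (by simpa using hR)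
        filter_upwards [this] with y hy
        unfold invFun
        by_cases hy0 : y = 0
        · rw [hy0]
          simp [image_eq_zero_of_notMem_tsupport hf]
        · rw [h, mul_zero]
          have hy1 : 0 < |y| := abs_pos.2 hy0
          have hy2 : |y| < 1 / R := hy
          rw [abs_div, abs_neg, abs_one, lt_div_iff₀ hy1]
          rw [lt_div_iff₀ hR] at hy2
          linarith
      exact contDiffAt_const.congr_of_eventuallyEq h0
    · refine (contDiffAt_Jfac μ ν hx).mul ?_
      exact f.contDiff.contDiffAt.comp x (contDiffAt_const.div contDiffAt_id hx)
  hasCompactSupport' := by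
    have h0 : ∀ᶠ y in 𝓝 (0 : ℝ), f y = 0 := by
      filter_upwards [(isClosed_tsupport _).isOpen_compl.mem_nhds hf] with y hy
      exact image_eq_zero_of_notMem_tsupport hy
    obtain ⟨r, hr, h⟩ := Metric.eventually_nhds_iff.1 h0
    refine HasCompactSupport.of_support_subset_isCompact
      (isCompact_Icc (a := -(1 / r)) (b := 1 / r)) ?_
    intro x hx
    by_contra hx'
    apply hx
    have hx1 : 1 / r < |x| := by
      by_contra h1
      exact hx' (abs_le.1 (not_lt.1 h1))
    have hx2 : 0 < |x| := lt_trans (by positivity) hx1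
    unfold invFun
    rw [h, mul_zero]
    rw [Real.dist_eq, sub_zero, abs_div, abs_neg, abs_one, div_lt_iff₀ hx2]
    rw [div_lt_iff₀ hr] at hx1
    linarith
  tsupport_subset' := fun _ _ => trivial

/-- The space `𝒜(L₁, L₂; J_{μ,ν})` of automorphic pairs of distributions on `ℝ`. -/
def AutoPair (L₁ L₂ : ShiftedLattice) (μ ν : ℂ) : Set ((Test → ℂ) × (Test → ℂ)) :=
  {T | T.1 ∈ PeriodicDist L₁ ∧ T.2 ∈ PeriodicDist L₂ ∧
    ∀ (f : Test) (hf : (0 : ℝ) ∉ tsupport f), T.1 f = T.2 (testInv μ ν f hf)}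

/-! ### The embedding of test functions into the principal series -/

/-- The function underlying `ι_{μ,ν}(f)`. -/
def iotaFun (μ ν : ℂ) (f : ℝ → ℂ) (a : Cover) : ℂ :=
  if a.g 1 0 = 0 then 0 else
    cexp (I * μ * ((a.θ + arg (J a.g I / (a.g 1 0 : ℂ)) : ℝ) : ℂ))
      * ((|a.g 1 0| : ℝ) : ℂ) ^ (-2 * ν - 1) * f (-(a.g 1 1) / a.g 1 0)

theorem iotaFun_equivariant (μ ν : ℂ) (f : ℝ → ℂ) (x y : ℝ) (hy : 0 < y) (m : ℤ) (a : Cover) :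
    iotaFun μ ν f (tu x * ta y hy * tk (m * Real.pi) * a)
      = cexp (Real.pi * m * I * μ) * (y : ℂ) ^ (ν + 1 / 2) * iotaFun μ ν f a := by
  have hs : Real.sin (m * Real.pi) = 0 := Real.sin_int_mul_pi m
  set e : ℝ := Real.cos (m * Real.pi) with he
  have he1 : |e| = 1 := by rw [he]; exact Real.abs_cos_int_mul_pi m
  have he0 : e ≠ 0 := by
    intro h
    rw [h] at he1
    simp at he1
  have hq : 0 < Real.sqrt y := Real.sqrt_pos.2 hy
  set b : Cover := tu x * ta y hy * tk (m * Real.pi) with hb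
  have b10 : b.g 1 0 = 0 := by
    simp only [hb, mul_entry]
    simp [tu, ta, tk, hs]
  have b11 : b.g 1 1 = e / Real.sqrt y := by
    simp only [hb, mul_entry]
    simp [tu, ta, tk, he]
    ring
  have bθ : b.θ = m * Real.pi := by
    rw [hb, mul_θ_of_lower_zero, mul_θ_of_lower_zero]
    · simp [tu, ta, tk]
    · simp [tu]
    · rw [mul_entry]
      simp [tu, ta]
  have c10 : (b * a).g 1 0 = e / Real.sqrt y * a.g 1 0 := by
    rw [mul_entry, b10, b11]; ring
  have c11 : (b * a).g 1 1 = e / Real.sqrt y * a.g 1 1 := by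
    rw [mul_entry, b10, b11]; ring
  have hk : e / Real.sqrt y ≠ 0 := div_ne_zero he0 hq.ne'
  unfold iotaFun
  by_cases h0 : a.g 1 0 = 0
  · rw [if_pos (by rw [c10, h0, mul_zero]), if_pos h0, mul_zero]
  · rw [if_neg (by rw [c10]; exact mul_ne_zero hk h0), if_neg h0]
    have hJ : J (b * a).g I / ((b * a).g 1 0 : ℂ) = J a.g I / (a.g 1 0 : ℂ) := by
      have hkc : ((e / Real.sqrt y : ℝ) : ℂ) ≠ 0 := by exact_mod_cast hk
      have h0c : ((a.g 1 0 : ℝ) : ℂ) ≠ 0 := by exact_mod_cast h0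
      rw [J, J, c10, c11, ofReal_mul, ofReal_mul]
      field_simp
    have hf : -((b * a).g 1 1) / (b * a).g 1 0 = -(a.g 1 1) / a.g 1 0 := by
      rw [c10, c11]
      field_simp
    have hpow : ((|(b * a).g 1 0| : ℝ) : ℂ) ^ (-2 * ν - 1)
        = (y : ℂ) ^ (ν + 1 / 2) * ((|a.g 1 0| : ℝ) : ℂ) ^ (-2 * ν - 1) := by
      rw [c10, abs_mul, abs_div, he1, abs_of_pos hq, ofReal_mul,
        mul_cpow_ofReal_nonneg (by positivity) (abs_nonneg _)]
      congr 1
      have hyc : (y : ℂ) ≠ 0 := by exact_mod_cast hy.ne'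
      have hl : Real.log (1 / Real.sqrt y) = -(Real.log y / 2) := by
        rw [one_div, Real.log_inv, Real.log_sqrt hy.le]
      rw [cpow_def_of_ne_zero (by exact_mod_cast (by positivity : (1 / Real.sqrt y) ≠ 0)),
        cpow_def_of_ne_zero hyc, ← ofReal_log (by positivity), hl, ← ofReal_log hy.le]
      congr 1
      push_cast
      ring
    rw [hJ, hf, hpow, mul_θ_of_lower_zero b10, bθ]
    have hexp : cexp (I * μ * ((m * Real.pi + a.θ + arg (J a.g I / (a.g 1 0 : ℂ)) : ℝ) : ℂ))
        = cexp (Real.pi * m * I * μ)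
          * cexp (I * μ * ((a.θ + arg (J a.g I / (a.g 1 0 : ℂ)) : ℝ) : ℂ)) := by
      rw [← Complex.exp_add]
      congr 1
      push_cast
      ring
    rw [hexp]
    ring

theorem isSmooth_iotaFun (μ ν : ℂ) (f : Test) : IsSmooth (iotaFun μ ν f) := by
  unfold IsSmooth
  rw [contDiff_iff_contDiffAt]
  rintro ⟨x, s, t⟩
  have c1 : ContDiff ℝ ∞ fun p : ℝ × ℝ × ℝ => p.2.1 := contDiff_fst.comp contDiff_snd
  have c2 : ContDiff ℝ ∞ fun p : ℝ × ℝ × ℝ => p.2.2 := contDiff_snd.comp contDiff_snd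
  have hq : ∀ r : ℝ, 0 < Real.sqrt (Real.exp r) := fun r => Real.sqrt_pos.2 (Real.exp_pos r)
  by_cases hs : Real.sin t = 0
  · obtain ⟨R, hR, h⟩ := exists_bound f
    have h0 : (fun p => iotaFun μ ν f (iwasawa p)) =ᶠ[𝓝 (x, s, t)] fun _ => 0 := by
      have hct : Real.cos t ≠ 0 := by
        intro hc
        have := Real.sin_sq_add_cos_sq t
        rw [hs, hc] at this
        simp at this
      have : {p : ℝ × ℝ × ℝ | R * |Real.sin p.2.2| < |Real.cos p.2.2|} ∈ 𝓝 (x, s, t) := by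
        refine (isOpen_lt (by fun_prop) (by fun_prop)).mem_nhds ?_
        simpa [hs] using hct
      filter_upwards [this] with p hp
      unfold iotaFun
      by_cases h1 : (iwasawa p).g 1 0 = 0
      · rw [if_pos h1]
      · rw [if_neg h1, h, mul_zero]
        rw [iwasawa_g10] at h1
        rw [iwasawa_g10, iwasawa_g11]
        have hsp : Real.sin p.2.2 ≠ 0 := by
          intro h2
          rw [h2] at h1
          simp at h1
        have hq' := (hq p.2.1).ne'
        have e1 : -(Real.cos p.2.2 / Real.sqrt (Real.exp p.2.1))
            / (-Real.sin p.2.2 / Real.sqrt (Real.exp p.2.1))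
            = Real.cos p.2.2 / Real.sin p.2.2 := by
          field_simp
        rw [e1, abs_div, lt_div_iff₀ (abs_pos.2 hsp)]
        exact hp
    exact contDiffAt_const.congr_of_eventuallyEq h0
  · have h0 : (fun p => iotaFun μ ν f (iwasawa p)) =ᶠ[𝓝 (x, s, t)] fun p =>
        cexp (I * μ * ((p.2.2 + (log (I - ((Real.cos p.2.2 / Real.sin p.2.2 : ℝ) : ℂ))).im
          : ℝ) : ℂ))
        * cexp (((Real.log (Real.sin p.2.2) - p.2.1 / 2 : ℝ) : ℂ) * (-2 * ν - 1))
        * f (Real.cos p.2.2 / Real.sin p.2.2) := by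
      have : {p : ℝ × ℝ × ℝ | Real.sin p.2.2 ≠ 0} ∈ 𝓝 (x, s, t) :=
        (isOpen_ne_fun (by fun_prop) continuous_const).mem_nhds hs
      filter_upwards [this] with p hp
      have hsp : Real.sin p.2.2 ≠ 0 := hp
      have hq' := (hq p.2.1).ne'
      have h1 : (iwasawa p).g 1 0 ≠ 0 := by
        rw [iwasawa_g10]
        exact div_ne_zero (neg_ne_zero.2 hsp) hq'
      unfold iotaFun
      rw [if_neg h1, iwasawa_θ]
      have e1 : -((iwasawa p).g 1 1) / (iwasawa p).g 1 0
          = Real.cos p.2.2 / Real.sin p.2.2 := by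
        rw [iwasawa_g10, iwasawa_g11]
        field_simp
      have e2 : J (iwasawa p).g I / ((iwasawa p).g 1 0 : ℂ)
          = I - ((Real.cos p.2.2 / Real.sin p.2.2 : ℝ) : ℂ) := by
        have h1c : (((iwasawa p).g 1 0 : ℝ) : ℂ) ≠ 0 := by exact_mod_cast h1
        rw [← e1, J, ofReal_div, ofReal_neg]
        field_simp
        ring
      rw [e1, e2, ← Complex.log_im]
      congr 2
      have h1' : |(iwasawa p).g 1 0| ≠ 0 := abs_ne_zero.2 h1
      rw [cpow_def_of_ne_zero (by exact_mod_cast h1'), ← ofReal_log (abs_nonneg _),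
        Real.log_abs, iwasawa_g10, Real.log_div (neg_ne_zero.2 hsp) hq', Real.log_neg_eq_log,
        Real.log_sqrt (Real.exp_pos _).le, Real.log_exp]
    refine ContDiffAt.congr_of_eventuallyEq ?_ h0
    have csin : ContDiff ℝ ∞ fun p : ℝ × ℝ × ℝ => Real.sin p.2.2 := Real.contDiff_sin.comp c2
    have ccos : ContDiff ℝ ∞ fun p : ℝ × ℝ × ℝ => Real.cos p.2.2 := Real.contDiff_cos.comp c2
    have ccot : ContDiffAt ℝ ∞ (fun p : ℝ × ℝ × ℝ => Real.cos p.2.2 / Real.sin p.2.2)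
        (x, s, t) := ccos.contDiffAt.div csin.contDiffAt hs
    have clog : ContDiffAt ℝ ∞ (fun p : ℝ × ℝ × ℝ =>
        log (I - ((Real.cos p.2.2 / Real.sin p.2.2 : ℝ) : ℂ))) (x, s, t) := by
      have hmem : I - ((Real.cos t / Real.sin t : ℝ) : ℂ) ∈ slitPlane := by
        right
        simp [-ofReal_div]
      exact ((contDiffAt_log hmem).restrict_scalars ℝ).comp (x, s, t)
        (contDiffAt_const.sub (ofRealCLM.contDiff.contDiffAt.comp (x, s, t) ccot))
    refine ((ContDiffAt.cexp ?_).mul (ContDiffAt.cexp ?_)).mul ?_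
    · exact contDiffAt_const.mul (ofRealCLM.contDiff.contDiffAt.comp (x, s, t)
        (c2.contDiffAt.add (imCLM.contDiff.contDiffAt.comp (x, s, t) clog)))
    · have c5 : ContDiffAt ℝ ∞ (fun p : ℝ × ℝ × ℝ => Real.log (Real.sin p.2.2)) (x, s, t) :=
        csin.contDiffAt.log hs
      have c6 : ContDiffAt ℝ ∞ (fun p : ℝ × ℝ × ℝ => p.2.1 / 2) (x, s, t) :=
        c1.contDiffAt.div_const 2
      have c7 : ContDiffAt ℝ ∞ (fun p : ℝ × ℝ × ℝ =>
          ((Real.log (Real.sin p.2.2) - p.2.1 / 2 : ℝ) : ℂ)) (x, s, t) :=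
        ofRealCLM.contDiff.contDiffAt.comp (x, s, t) (c5.sub c6)
      exact c7.mul contDiffAt_const
    · have hfc : ContDiff ℝ ∞ (fun r : ℝ => f r) := f.contDiff
      exact hfc.contDiffAt.comp (x, s, t) ccot

/-- The embedding `ι_{μ,ν} : C₀^∞(ℝ) → I_{μ,ν}^∞`. -/
def iota (μ ν : ℂ) (f : Test) : PS μ ν :=
  ⟨iotaFun μ ν f, iotaFun_equivariant μ ν f, isSmooth_iotaFun μ ν f⟩

/-- `T^λ(f) = λ(ι_{μ,ν}(f))`. -/
def toRDist {μ ν : ℂ} (lam : PS μ ν → ℂ) : Test → ℂ := fun f => lam (iota μ ν f)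

/-! ### Automorphic and quasi-automorphic distributions -/

/-- `(I_{μ,ν}^{-∞})_L`. -/
def Equivariant (L : ShiftedLattice) (μ ν : ℂ) : Set (PS μ ν → ℂ) :=
  {lam | lam ∈ PSDist μ ν ∧
    ∀ t ∈ L.dual, ∀ F : PS μ ν, lam (rho (tu t) F) = L.omega t * lam F}

/-- The automorphic distributions on `I_{μ,ν}^∞` for `(L₁, L₂)`. -/
def Automorphic (L₁ L₂ : ShiftedLattice) (μ ν : ℂ) : Set (PS μ ν → ℂ) :=
  {lam | lam ∈ Equivariant L₁ μ ν ∧ distInv lam ∈ Equivariant L₂ μ ν}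

/-- The quasi-automorphic distributions on `I_{μ,ν}^∞` for `(L₁, L₂)`. -/
def QuasiAutomorphic (L₁ L₂ : ShiftedLattice) (μ ν : ℂ) : Set (PS μ ν → ℂ) :=
  {lam | lam ∈ PSDist μ ν ∧ (toRDist lam, toRDist (distInv lam)) ∈ AutoPair L₁ L₂ μ ν}

/-! ### Jacquet integrals and Fourier expansions -/

/-- The Fourier transform `∫ f(x) exp (2π i x y) dx`. -/
def fourier (f : ℝ → ℂ) (y : ℝ) : ℂ := ∫ x : ℝ, f x * cexp (2 * Real.pi * I * x * y)

/-- `δ^{(m)}(f) = (-1)^m f^{(m)}(0)`. -/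
def deltaR (m : ℕ) (f : ℝ → ℂ) : ℂ := (-1) ^ m * iteratedDeriv m f 0

/-- The domain of `s ↦ 𝓕(f_{μ,s,∞})(y)`: the whole plane if `y ≠ 0`, and the plane without the
points `-n/2` (`n = 0, 1, 2, …`) if `y = 0`. -/
def contDomain (y : ℝ) : Set ℂ := {s | y = 0 → ∀ n : ℕ, -2 * s ≠ n}

/-- `Φ` is the analytic continuation of `s ↦ 𝓕(f_{μ,s,∞})(y)` from `Re s > 0` to
`contDomain y`. As this domain is open and connected, `Φ` is unique on it. -/
def IsContinuation (μ : ℂ) (f : Test) (y : ℝ) (Φ : ℂ → ℂ) : Prop :=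
  DifferentiableOn ℂ Φ (contDomain y) ∧ ∀ s : ℂ, 0 < s.re → Φ s = fourier (invFun μ s f) y

open Classical in
/-- The analytic continuation of `s ↦ 𝓕(f_{μ,s,∞})(y)`. -/
def fourierCont (μ : ℂ) (f : Test) (y : ℝ) : ℂ → ℂ :=
  if h : ∃ Φ, IsContinuation μ f y Φ then h.choose else 0

open Classical in
/-- The twisted Fourier transform `𝓕_{μ,ν,∞}(f)(y)`. If `y = 0` and `-2ν = n` is a nonnegative
integer, the polar part at `-n/2` is removed. -/
def twistedFourier (μ ν : ℂ) (f : Test) (y : ℝ) : ℂ :=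
  if h : y = 0 ∧ ∃ n : ℕ, -2 * ν = n then
    limUnder (𝓝[≠] ν) fun s => fourierCont μ f 0 s
      - I ^ h.2.choose * (2 * Complex.cos (Real.pi * (h.2.choose + μ) / 2)
        / ((h.2.choose.factorial : ℂ) * (2 * s + h.2.choose))) * deltaR h.2.choose f
  else fourierCont μ f y ν

/-- `(f₁, f₂)` is a partition of `F`. -/
def IsPartition {μ ν : ℂ} (F : PS μ ν) (f : Test × Test) : Prop :=
  iota μ ν f.1 + flip (iota μ ν f.2) = F

open Classical in
/-- The Jacquet integral `𝒥_l` on `I_{μ,ν}^∞`: for `Re ν > 0` an absolutely convergent integral, and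
in general `𝓕(f₁)(l) + 𝓕_{μ,ν,∞}(f₂)(l)` for any partition `(f₁, f₂)` of `F`. -/
def jacquet {μ ν : ℂ} (l : ℝ) (F : PS μ ν) : ℂ :=
  if 0 < ν.re then ∫ x : ℝ, F.1 (tw * tu (-x)) * cexp (2 * Real.pi * I * l * x)
  else if h : ∃ f, IsPartition F f then
    fourier h.choose.1 l + twistedFourier μ ν h.choose.2 l
  else 0

/-- `δ_∞^{(m)}(F) = (ρ(E₊)^m F_∞)(w̃)`. -/
def deltaInf {μ ν : ℂ} (m : ℕ) (F : PS μ ν) : ℂ := ((rhoGen .Ep)^[m] (flip F).1) tw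

/-- `λ_{α,β}(F) = ∑_{l ∈ L} α(l) 𝒥_l(F) + ∑_m β(m) δ_∞^{(m)}(F)`, with `β` finitely supported. -/
def expansion (L : ShiftedLattice) (μ ν : ℂ) (α : L.carrier → ℂ) (β : ℕ →₀ ℂ) : PS μ ν → ℂ :=
  fun F => ∑' l : L.carrier, α l * jacquet (l : ℝ) F + β.sum fun m b => b * deltaInf m F

/-- The subset `𝔐(L)_{μ,ν}^0` of `𝔐(L)`: `α(0) = 0` if `0 ∈ L`, `-2ν` is a positive integer and
`μ - 2ν - 1` is not an even integer. -/
def coeffSpace0 (L : ShiftedLattice) (μ ν : ℂ) : Set (L.carrier → ℂ) :=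
  {α | α ∈ coeffSpace L ∧ ∀ h : (0 : ℝ) ∈ L.carrier, (∃ n : ℕ, 0 < n ∧ -2 * ν = n) →
    (¬ ∃ k : ℤ, μ - 2 * ν - 1 = 2 * k) → α ⟨0, h⟩ = 0}

/-- `S_ν(L)`: empty if `0 ∉ L`, and the nonnegative integers among `0` and `-2ν` if `0 ∈ L`. -/
def exponentSet (L : ShiftedLattice) (ν : ℂ) : Set ℕ :=
  {m | (0 : ℝ) ∈ L.carrier ∧ (m = 0 ∨ (m : ℂ) = -2 * ν)}

/-- `𝔑(S)`: the finitely supported functions on the nonnegative integers that vanish off `S`. -/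
def deltaCoeffs (S : Set ℕ) : Set (ℕ →₀ ℂ) := {β | ∀ m, m ∉ S → β m = 0}

/-- `-2ν` is a positive integer, `μ - 2ν - 1` is an even integer, and `0 ∉ L` or `-2ν > 1`. -/
def VanishingCondition (L : ShiftedLattice) (μ ν : ℂ) : Prop :=
  ∃ n : ℕ, 0 < n ∧ -2 * ν = n ∧ (∃ k : ℤ, μ - 2 * ν - 1 = 2 * k) ∧
    ((0 : ℝ) ∉ L.carrier ∨ 1 < n)

end QAD
end

/-!
The big cell `x ↦ F(w̃ ũ(-x))` is a chart of the principal series, and `F ↦ F_∞` interchanges it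
with a second chart; between the two a function `f` is transformed into
`f_{μ,ν,∞}(x) = e^{-sgn(x) π i μ/2} |x|^{-2ν-1} f(-1/x)`. A cutoff function writes every `F` as
`ι(f₁) + ι(f₂)_∞` with test functions `f₁`, `f₂` (`isPartition_part`). So a linear functional `λ` is
determined by `T^λ` and `T^{λ_∞}` (`ext_of_toRDist`), and it is continuous as soon as both are
distributions on the real line (`mem_PSDist`): derivatives in the two charts are the actions of the
powers of `E₊` and of `E₋`.

*Jacquet integrals.* The derivative of `f_{μ,s,∞}` is a function of the same kind with `s` replaced
by `s + 1/2`, so it decays faster. Integration by parts therefore continues `𝓕(f_{μ,s,∞})(y)`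
analytically in `s`, and for `y ≠ 0` it also gives rapid decay in `y`
(`exists_twistedFourier_bound`). At `y = 0` there is a pole at each `-n/2`, whose polar part is a
multiple of `δ^{(n)}` (`polarPiece_self`). The multiple is `polarCoeff μ n`, which vanishes exactly
when `μ + n - 1` is an even integer. As test functions supported off the origin need no
continuation, the Jacquet integral does not depend on the partition
(`fourier_add_twistedFourier_congr`), and the series converge absolutely (`summable_jacquet`).

*Existence and uniqueness.* A quasi-periodic distribution on the line is the sum of its Fourier
series (`PeriodicDist.map_eq`): a partition of unity by the translates of a test function reduces
this to Poisson summation. This gives `α` from `T^λ`. The difference of `T^{λ_∞}` and the series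
`∑ α(l) 𝓕_{μ,ν,∞}(f)(l)` vanishes off the origin, where the two charts overlap, so it is a finite
combination of derivatives of the delta distribution (`exists_eq_sum_deltaR`), which gives `β`
(`exists_eq_expansion`). Both are unique (`expansion_injective`). Applied to `λ` and to `λ_∞`
this yields the two expansions; the converse holds since each expansion is visibly quasi-periodic
in the first chart (`toRDist_expansion_mem_PeriodicDist`).

*Automorphy.* The identity `ρ(ũ(t)) F = F + ρ(E₊) ∫₀ᵗ ρ(ũ(τ)) F dτ` turns the defect of the
equivariance under `ũ(t)` into values at `ρ(E₊) G`. There `δ_∞^{(m)}` becomes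
`m (2ν + m) δ_∞^{(m-1)}(G)`, the Jacquet integrals of nonzero frequency are equivariant, and
`𝒥_0(ρ(E₊) G)` is zero, except at a pole, where it is a multiple of
`polarCoeff μ n * δ_∞^{(n-1)}(G)`. The stated conditions on `(α, β)` make the defect vanish
(`equivariant_of_mem`), and they are necessary because sections equal to `x ^ k` near the origin of
the second chart yield a triangular system (`mem_of_equivariant`).

*Vanishing of `β(0)`.* If `-2ν = n` is a positive integer and `μ - 2ν - 1` is even, then
`f ↦ f_{μ,ν,∞}` preserves the polynomials of degree less than `n`. The section with chart `1` and
the section with chart a multiple of `x ^ (n - 1)` are interchanged by `F ↦ F_∞`, and all Jacquet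
integrals vanish on both. Evaluating `λ` and `λ_∞` on them shows that `β₁(0)` equals a multiple of
`β₂(n - 1)`, and the latter is zero under the stated condition
(`coeff_zero_of_vanishingCondition`).
-/
noncomputable section

namespace QAD

/-! ### The big cell of the covering group -/

/-- The left transformation law of the functions in `I_{μ,ν}^∞`, without smoothness. -/
def LeftEquivariant (μ ν : ℂ) (F : Cover → ℂ) : Prop :=
  ∀ (x y : ℝ) (hy : 0 < y) (m : ℤ) (a : Cover),
    F (tu x * ta y hy * tk (m * Real.pi) * a)
      = cexp (Real.pi * m * I * μ) * (y : ℂ) ^ (ν + 1 / 2) * F a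

/-- The restriction of a function on the covering group to the coordinate line
`x ↦ w̃ ũ(-x)` of the big cell. -/
def chart (F : Cover → ℂ) (x : ℝ) : ℂ := F (tw * tu (-x))

theorem tw_g : (tw.g : Matrix (Fin 2) (Fin 2) ℝ) = !![0, -1; 1, 0] := by
  simp [tw, tk]

theorem tw_θ : tw.θ = -(Real.pi / 2) := rfl

theorem twtu_g (x : ℝ) :
    ((tw * tu (-x)).g : Matrix (Fin 2) (Fin 2) ℝ) = !![0, -1; 1, -x] := by
  ext i j
  rw [mul_entry, tw_g]
  fin_cases i <;> fin_cases j <;> simp [tu]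

theorem arg_div_I (z : ℍ) : arg ((z : ℂ) / I) = arg (z : ℂ) - Real.pi / 2 := by
  have h := arg_J_div tw.g z UpperHalfPlane.I
  have h1 : ∀ v : ℂ, J tw.g v = v := fun v => by simp [J, tw_g]
  rw [h1, h1, UpperHalfPlane.coe_I, arg_I] at h
  exact h

theorem twtu_θ (x : ℝ) : (tw * tu (-x)).θ = -arg (I - x) := by
  have h1 : ∀ v : ℂ, J tw.g v = v := fun v => by simp [J, tw_g]
  rw [Cover.mul_θ, h1, h1, arg_div_I, tw_θ]
  have : (((tu (-x)).g • UpperHalfPlane.I : ℍ) : ℂ) = I - x := by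
    rw [coe_smul_eq]
    simp [J, tu]
    ring
  rw [this]
  simp [tu]
  ring

/-- The Bruhat decomposition of an element whose matrix has lower left entry `c ≠ 0`. The integer `m`
comes from the angle: `θ + arg(J/c)` is a multiple of `π`. -/
theorem cell_decomp {a : Cover} (hc : a.g 1 0 ≠ 0) :
    ∃ (m : ℤ) (hy : 0 < 1 / (a.g 1 0) ^ 2),
      a.θ + arg (J a.g I / (a.g 1 0 : ℂ)) = m * Real.pi ∧
      a = tu (a.g 0 0 / a.g 1 0) * ta (1 / (a.g 1 0) ^ 2) hy * tk (m * Real.pi)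
        * (tw * tu (-(-(a.g 1 1) / a.g 1 0))) := by
  set c := a.g 1 0 with hcdef
  set d := a.g 1 1 with hd
  have hcc : (c : ℂ) ≠ 0 := by exact_mod_cast hc
  have hJ := J_ne_zero a.g UpperHalfPlane.I
  rw [UpperHalfPlane.coe_I] at hJ
  have hdet : a.g 0 0 * d - a.g 0 1 * c = 1 := by
    have := a.g.det_coe
    rwa [Matrix.det_fin_two] at this
  have hnJ : (‖J a.g I‖ : ℂ) ≠ 0 := by simpa using hJ
  have hnc : (‖(c : ℂ)‖ : ℂ) ≠ 0 := by simpa using hc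
  -- the angle `θ + arg(J/c)` has exponential `±1`
  have h1 : cexp (I * ((a.θ + arg (J a.g I / (c : ℂ)) : ℝ) : ℂ)) = ((|c| / c : ℝ) : ℂ) := by
    push_cast
    rw [mul_add, Complex.exp_add, exp_I_arg _ (div_ne_zero hJ hcc), a.exp_θ, norm_div]
    push_cast
    rw [norm_real, Real.norm_eq_abs] at *
    field_simp
  have habs : |c| / c = 1 ∨ |c| / c = -1 := by
    rcases lt_or_gt_of_ne hc with h | h
    · right; rw [abs_of_neg h]; field_simp
    · left; rw [abs_of_pos h]; field_simp
  have hcos : Real.cos (a.θ + arg (J a.g I / (c : ℂ))) = |c| / c := by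
    have := congrArg Complex.re h1
    rw [mul_comm, exp_ofReal_mul_I_re, ofReal_re] at this
    exact this
  have hsin : Real.sin (a.θ + arg (J a.g I / (c : ℂ))) = 0 := by
    have := congrArg Complex.im h1
    rw [mul_comm, exp_ofReal_mul_I_im, ofReal_im] at this
    exact this
  obtain ⟨m, hm⟩ := Real.sin_eq_zero_iff.1 hsin
  have hy : 0 < 1 / c ^ 2 := by positivity
  refine ⟨m, hy, hm.symm, ?_⟩
  rw [← hm] at hcos hsin
  have hac : |c| ≠ 0 := abs_ne_zero.2 hc
  refine Cover.ext ?_ ?_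
  · ext i j
    simp only [mul_entry _ (tw * _), twtu_g]
    simp only [mul_entry]
    fin_cases i <;> fin_cases j <;> simp [tu, ta, tk, Real.sqrt_sq_eq_abs, hcos, hsin, ← hcdef,
      ← hd]
    · field_simp
      rw [← sq_abs c]
    · field_simp
      rw [sq_abs]
      linear_combination (-c ^ 2) * hdet
    · field_simp
      rw [← sq_abs c]
    · field_simp
      rw [← sq_abs c]
  · rw [mul_θ_of_lower_zero, mul_θ_of_lower_zero, mul_θ_of_lower_zero, twtu_θ]
    · have : I - ((-d / c : ℝ) : ℂ) = J a.g I / (c : ℂ) := by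
        rw [J, ← hcdef, ← hd]
        push_cast
        field_simp
        ring
      rw [this]
      simp [tu, ta, tk]
      linarith
    · simp [tu]
    · rw [mul_entry]
      simp [tu, ta]
    · rw [mul_entry, mul_entry, mul_entry]
      simp [tu, ta, tk, hsin]

/-- A function with the left transformation law is given on the big cell by its chart. -/
theorem LeftEquivariant.apply_eq {μ ν : ℂ} {F : Cover → ℂ} (hF : LeftEquivariant μ ν F)
    {a : Cover} (hc : a.g 1 0 ≠ 0) :
    F a = cexp (I * μ * ((a.θ + arg (J a.g I / (a.g 1 0 : ℂ)) : ℝ) : ℂ))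
      * ((|a.g 1 0| : ℝ) : ℂ) ^ (-2 * ν - 1) * chart F (-(a.g 1 1) / a.g 1 0) := by
  obtain ⟨m, hy, hm, ha⟩ := cell_decomp hc
  rw [hm]
  conv_lhs => rw [ha, hF]
  rw [chart]
  have h0 : 0 < |a.g 1 0| := abs_pos.2 hc
  have e1 : ((1 / (a.g 1 0) ^ 2 : ℝ) : ℂ) ^ (ν + 1 / 2)
      = ((|a.g 1 0| : ℝ) : ℂ) ^ (-2 * ν - 1) := by
    rw [cpow_def_of_ne_zero (by exact_mod_cast hy.ne'),
      cpow_def_of_ne_zero (by exact_mod_cast h0.ne'), ← ofReal_log hy.le,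
      ← ofReal_log h0.le, Real.log_div one_ne_zero (by positivity), Real.log_pow, Real.log_abs]
    congr 1
    push_cast
    simp
    ring
  rw [e1]
  congr 3
  push_cast
  ring

theorem iotaFun_eq_of_ne {μ ν : ℂ} {F : Cover → ℂ} (hF : LeftEquivariant μ ν F)
    {a : Cover} (hc : a.g 1 0 ≠ 0) : F a = iotaFun μ ν (chart F) a := by
  rw [hF.apply_eq hc, iotaFun, if_neg hc]

theorem chart_iota {μ ν : ℂ} (f : Test) : chart (iota μ ν f).1 = f := by
  funext x
  have h10 : (tw * tu (-x)).g 1 0 = 1 := by rw [twtu_g]; simp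
  have h11 : (tw * tu (-x)).g 1 1 = -x := by rw [twtu_g]; simp
  change iotaFun μ ν f _ = _
  rw [iotaFun, if_neg (by rw [h10]; exact one_ne_zero), twtu_θ, h10, h11, J, h10, h11]
  simp [← sub_eq_add_neg]

theorem arg_I_add_inv (x : ℝ) (hx : x ≠ 0) :
    -arg (I - x) - Real.pi / 2 + arg (I + ((1 / x : ℝ) : ℂ))
      = -(Real.sign x + 1) / 2 * Real.pi := by
  have h1 := arg_div_I ⟨I - x, by simp⟩
  have h2 : (I - x) / I = 1 + I * x := by
    field_simp
    linear_combination (-(x : ℂ)) * I_sq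
  have h3 : I + ((1 / x : ℝ) : ℂ) = ((1 / x : ℝ) : ℂ) * (1 + I * x) := by
    have : (x : ℂ) ≠ 0 := by exact_mod_cast hx
    push_cast
    field_simp
    ring
  change arg ((I - x) / I) = arg (I - x) - Real.pi / 2 at h1
  rw [h2] at h1
  rw [h3]
  rcases lt_or_gt_of_ne hx with h | h
  · rw [Real.sign_of_neg h]
    have e : ((1 / x : ℝ) : ℂ) * (1 + I * x) = ((-(1 / x) : ℝ) : ℂ) * (-(1 + I * x)) := by
      push_cast; ring
    have hneg : 0 < -(1 / x) := by rw [neg_pos]; exact one_div_neg.2 h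
    rw [e, arg_real_mul _ hneg, arg_neg_eq_arg_add_pi_of_im_neg]
    · linarith
    · simpa using h
  · rw [Real.sign_of_pos h, arg_real_mul _ (one_div_pos.2 h)]
    linarith

/-- In the chart, `F ↦ F_∞` is the twisted inversion. -/
theorem LeftEquivariant.chart_flip {μ ν : ℂ} {F : Cover → ℂ} (hF : LeftEquivariant μ ν F)
    {x : ℝ} (hx : x ≠ 0) :
    cexp (Real.pi * I * μ / 2) * F (tw * tu (-x) * tw) = invFun μ ν (chart F) x := by
  have h10 : (tw * tu (-x) * tw).g 1 0 = -x := by rw [mul_entry, twtu_g, tw_g]; simp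
  have h11 : (tw * tu (-x) * tw).g 1 1 = -1 := by rw [mul_entry, twtu_g, tw_g]; simp
  have hθ : (tw * tu (-x) * tw).θ = -arg (I - x) - Real.pi / 2 := by
    rw [Cover.mul_θ, twtu_θ, tw_θ]
    have : (tw.g • UpperHalfPlane.I : ℍ) = (I : ℂ) := by
      rw [coe_smul_eq]; simp [J, tw_g, neg_div]
    rw [this, div_self]
    · simp; ring
    · have := J_ne_zero (tw * tu (-x)).g UpperHalfPlane.I
      rwa [UpperHalfPlane.coe_I] at this
  rw [hF.apply_eq (by rw [h10]; simpa using hx), h10, h11, hθ, J, h10, h11]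
  have hxc : (x : ℂ) ≠ 0 := by exact_mod_cast hx
  have e : (((-x : ℝ) : ℂ) * I + ((-1 : ℝ) : ℂ)) / ((-x : ℝ) : ℂ) = I + ((1 / x : ℝ) : ℂ) := by
    push_cast
    field_simp
    ring
  rw [e, arg_I_add_inv x hx, invFun, Jfac, abs_neg, ← mul_assoc, ← mul_assoc,
    ← Complex.exp_add, neg_neg, div_neg, ← neg_div]
  congr 3
  push_cast
  ring

theorem flip_apply {μ ν : ℂ} (F : PS μ ν) (a : Cover) :
    (flip F).1 a = cexp (Real.pi * I * μ / 2) * F.1 (a * tw) := rfl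

theorem chart_flip {μ ν : ℂ} (F : PS μ ν) {x : ℝ} (hx : x ≠ 0) :
    chart (flip F).1 x = invFun μ ν (chart F.1) x :=
  LeftEquivariant.chart_flip F.2.1 hx

theorem tw_mul_tw_comm (a : Cover) : a * (tw * tw) = tw * tw * a := by
  have hJ : ∀ z : ℂ, J (tw * tw).g z = -1 := fun z => by
    simp [J, mul_entry, tw_g]
  have hsm : ((tw * tw).g • UpperHalfPlane.I : ℍ) = (I : ℂ) := by
    rw [coe_smul_eq, hJ]
    simp [mul_entry, tw_g]
  have hJ0 := J_ne_zero a.g UpperHalfPlane.I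
  rw [UpperHalfPlane.coe_I] at hJ0
  refine Cover.ext ?_ ?_
  · ext i j
    simp only [mul_entry, tw_g]
    fin_cases i <;> fin_cases j <;> simp
  · rw [Cover.mul_θ a, Cover.mul_θ (tw * tw) a, hJ, hJ, hsm, div_self hJ0, div_self (by simp)]
    simp [add_comm]

theorem tw_mul_tw : tw * tw = tu 0 * ta 1 one_pos * tk ((-1 : ℤ) * Real.pi) := by
  refine Cover.ext ?_ ?_
  · ext i j
    simp only [mul_entry, tw_g]
    fin_cases i <;> fin_cases j <;> simp [tu, ta, tk]
  · rw [Cover.mul_θ, mul_θ_of_lower_zero, mul_θ_of_lower_zero]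
    · have : (tw.g • UpperHalfPlane.I : ℍ) = (I : ℂ) := by
        rw [coe_smul_eq]; simp [J, tw_g, neg_div]
      rw [this]
      simp [J, tw_g, tu, ta, tk, tw_θ]
      ring
    · simp [tu]
    · simp [mul_entry, tu, ta]

theorem apply_mul_tw_tw {μ ν : ℂ} (F : PS μ ν) (a : Cover) :
    F.1 (a * tw * tw) = cexp (-(Real.pi * I * μ)) * F.1 a := by
  rw [mul_assoc, tw_mul_tw_comm, tw_mul_tw, F.2.1]
  simp

theorem flip_flip {μ ν : ℂ} (F : PS μ ν) : flip (flip F) = F := by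
  apply Subtype.ext
  funext a
  rw [flip_apply, flip_apply, apply_mul_tw_tw, ← mul_assoc, ← mul_assoc, ← Complex.exp_add,
    ← Complex.exp_add]
  ring_nf
  simp

theorem flip_add {μ ν : ℂ} (F G : PS μ ν) : flip (F + G) = flip F + flip G := by
  apply Subtype.ext
  funext a
  simp [flip_apply, mul_add]

theorem flip_smul {μ ν : ℂ} (c : ℂ) (F : PS μ ν) : flip (c • F) = c • flip F := by
  apply Subtype.ext
  funext a
  simp [flip_apply]
  ring

/-- The whole covering group is covered by the big cell and its translate by `w̃`, so an element
of `I_{μ,ν}^∞` is determined by its chart and the value of its flip at the origin. -/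
theorem PS.ext_chart {μ ν : ℂ} {F G : PS μ ν} (h : ∀ x, chart F.1 x = chart G.1 x)
    (h0 : chart (flip F).1 0 = chart (flip G).1 0) : F = G := by
  have hch : ∀ x, chart (flip F).1 x = chart (flip G).1 x := by
    intro x
    by_cases hx : x = 0
    · rw [hx, h0]
    · rw [chart_flip F hx, chart_flip G hx, invFun, invFun, h]
  apply Subtype.ext
  funext a
  by_cases hc : a.g 1 0 = 0
  · have hd : a.g 1 1 ≠ 0 := by
      intro hd
      have := a.g.det_coe
      rw [Matrix.det_fin_two, hc, hd] at this
      simp at this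
    have h10 : (a * tw⁻¹).g 1 0 ≠ 0 := by
      have e : a.g 1 1 = (a * tw⁻¹ * tw).g 1 1 := by rw [inv_mul_cancel_right]
      rw [mul_entry, tw_g] at e
      simp at e
      rw [e] at hd
      simpa using hd
    have e := iotaFun_eq_of_ne (flip F).2.1 h10
    have e' := iotaFun_eq_of_ne (flip G).2.1 h10
    rw [show chart (flip F).1 = chart (flip G).1 from funext hch, ← e'] at e
    rw [flip_apply, flip_apply, inv_mul_cancel_right] at e
    exact mul_left_cancel₀ (Complex.exp_ne_zero _) e
  · rw [iotaFun_eq_of_ne F.2.1 hc, iotaFun_eq_of_ne G.2.1 hc,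
      show chart F.1 = chart G.1 from funext h]

theorem chart_add {μ ν : ℂ} (F G : PS μ ν) (x : ℝ) :
    chart (F + G).1 x = chart F.1 x + chart G.1 x := rfl

theorem chart_smul {μ ν : ℂ} (c : ℂ) (F : PS μ ν) (x : ℝ) :
    chart (c • F).1 x = c * chart F.1 x := rfl

theorem chart_flip_iota_zero {μ ν : ℂ} (f : Test) : chart (flip (iota μ ν f)).1 0 = 0 := by
  have h10 : (tw * tu (-0) * tw).g 1 0 = 0 := by rw [mul_entry, twtu_g, tw_g]; simp
  rw [chart, flip_apply]
  change _ * iotaFun μ ν f _ = 0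
  rw [iotaFun, if_pos h10, mul_zero]

theorem iota_add {μ ν : ℂ} (f g : Test) : iota μ ν (f + g) = iota μ ν f + iota μ ν g := by
  refine PS.ext_chart (fun x => ?_) ?_
  · rw [chart_add, chart_iota, chart_iota, chart_iota]; rfl
  · rw [flip_add, chart_add]; simp only [chart_flip_iota_zero, add_zero]

theorem iota_smul {μ ν : ℂ} (c : ℂ) (f : Test) : iota μ ν (c • f) = c • iota μ ν f := by
  refine PS.ext_chart (fun x => ?_) ?_
  · rw [chart_smul, chart_iota, chart_iota]; rfl
  · rw [flip_smul, chart_smul]; simp only [chart_flip_iota_zero, mul_zero]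

/-! ### Smoothness along the unipotent flow -/

theorem tu_zero : tu 0 = 1 := by
  refine Cover.ext ?_ rfl
  ext i j
  fin_cases i <;> fin_cases j <;> simp [tu, Cover.one_g]

theorem iwasawa_weyl : iwasawa (0, 0, -(Real.pi / 2)) = tw := by
  have h1 : ta (Real.exp 0) (Real.exp_pos _) = 1 := by
    refine Cover.ext ?_ rfl
    ext i j
    fin_cases i <;> fin_cases j <;> simp [ta, Cover.one_g]
  simp only [iwasawa, h1, tu_zero, one_mul]
  rfl

theorem iwasawa_mul (p : ℝ × ℝ × ℝ) (h : Cover) : iwasawa p * h = iwasawa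
    (p.1 + Real.exp p.2.1 * ((tk p.2.2 * h).g • UpperHalfPlane.I : ℍ).re,
      p.2.1 + Real.log ((tk p.2.2 * h).g • UpperHalfPlane.I : ℍ).im, (tk p.2.2 * h).θ) := by
  have h1 : ta (Real.exp (p.2.1 + Real.log ((tk p.2.2 * h).g • UpperHalfPlane.I : ℍ).im))
      (Real.exp_pos _) = ta (Real.exp p.2.1) (Real.exp_pos _)
        * ta ((tk p.2.2 * h).g • UpperHalfPlane.I : ℍ).im (UpperHalfPlane.im_pos _) := by
    rw [ta_mul_ta]
    congr 1
    rw [Real.exp_add, Real.exp_log (UpperHalfPlane.im_pos _)]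
  have h2 : iwasawa p * h = tu p.1 * ta (Real.exp p.2.1) (Real.exp_pos _)
      * (tk p.2.2 * h) := by
    simp only [iwasawa, mul_assoc]
  rw [h2]
  conv_lhs => rw [iwasawa_decomp (tk p.2.2 * h)]
  unfold iwasawa
  rw [h1, ← tu_mul_tu]
  simp only [mul_assoc]
  rw [← mul_assoc (ta (Real.exp p.2.1) _) (tu _), ta_mul_tu]
  simp only [mul_assoc]

/-- The Iwasawa coordinates of `k̃(θ) ũ(τ)` depend smoothly on `(θ, τ)`. The angle is smooth since the
quotient of automorphy factors stays off the branch cut of the logarithm. -/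
theorem contDiff_iwasawa_coords : ContDiff ℝ ∞ fun q : ℝ × ℝ =>
    (((tk q.1 * tu q.2).g • UpperHalfPlane.I : ℍ).re,
      Real.log ((tk q.1 * tu q.2).g • UpperHalfPlane.I : ℍ).im, (tk q.1 * tu q.2).θ) := by
  have hw : ∀ τ : ℝ, (((tu τ).g • UpperHalfPlane.I : ℍ) : ℂ) = I + τ := by
    intro τ
    rw [coe_smul_eq]
    simp [J, tu]
  have hre : ∀ q : ℝ × ℝ, (((tk q.1 * tu q.2).g • UpperHalfPlane.I : ℍ) : ℂ)
      = ((Real.cos q.1 : ℂ) * (I + q.2) + Real.sin q.1)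
        / (-(Real.sin q.1 : ℂ) * (I + q.2) + Real.cos q.1) := by
    intro q
    rw [Cover.mul_g, mul_smul, coe_smul_eq, J, hw]
    simp [tk]
  have hden : ∀ q : ℝ × ℝ, (-(Real.sin q.1 : ℂ) * (I + q.2) + Real.cos q.1) ≠ 0 := by
    intro q
    have := J_ne_zero (tk q.1).g ((tu q.2).g • UpperHalfPlane.I)
    rw [hw] at this
    simpa [J, tk] using this
  have hden' : ∀ q : ℝ × ℝ, (-(Real.sin q.1 : ℂ) * I + Real.cos q.1) ≠ 0 := by
    intro q
    have := J_ne_zero (tk q.1).g UpperHalfPlane.I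
    simpa [J, tk] using this
  have hcs : ContDiff ℝ ∞ fun q : ℝ × ℝ => ((Real.cos q.1 : ℝ) : ℂ) :=
    ofRealCLM.contDiff.comp (Real.contDiff_cos.comp contDiff_fst)
  have hsn : ContDiff ℝ ∞ fun q : ℝ × ℝ => ((Real.sin q.1 : ℝ) : ℂ) :=
    ofRealCLM.contDiff.comp (Real.contDiff_sin.comp contDiff_fst)
  have hτ : ContDiff ℝ ∞ fun q : ℝ × ℝ => (I + (q.2 : ℂ)) :=
    contDiff_const.add (ofRealCLM.contDiff.comp contDiff_snd)
  have hz : ContDiff ℝ ∞ fun q : ℝ × ℝ =>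
      (((tk q.1 * tu q.2).g • UpperHalfPlane.I : ℍ) : ℂ) := by
    simp only [hre, div_eq_mul_inv]
    exact ((hcs.mul hτ).add hsn).mul (((hsn.neg.mul hτ).add hcs).inv hden)
  have hx : ContDiff ℝ ∞ fun q : ℝ × ℝ =>
      ((tk q.1 * tu q.2).g • UpperHalfPlane.I : ℍ).re := reCLM.contDiff.comp hz
  have hy : ContDiff ℝ ∞ fun q : ℝ × ℝ =>
      ((tk q.1 * tu q.2).g • UpperHalfPlane.I : ℍ).im := imCLM.contDiff.comp hz
  have hly : ContDiff ℝ ∞ fun q : ℝ × ℝ =>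
      Real.log ((tk q.1 * tu q.2).g • UpperHalfPlane.I : ℍ).im :=
    hy.log fun q => (UpperHalfPlane.im_pos _).ne'
  have hθ : ContDiff ℝ ∞ fun q : ℝ × ℝ => (tk q.1 * tu q.2).θ := by
    have hr : ContDiff ℝ ∞ fun q : ℝ × ℝ => (-(Real.sin q.1 : ℂ) * (I + q.2) + Real.cos q.1)
        / (-(Real.sin q.1 : ℂ) * I + Real.cos q.1) := by
      simp only [div_eq_mul_inv]
      exact ((hsn.neg.mul hτ).add hcs).mul
        (((hsn.neg.mul contDiff_const).add hcs).inv hden')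
    have hlog : ContDiff ℝ ∞ fun q : ℝ × ℝ =>
        log ((-(Real.sin q.1 : ℂ) * (I + q.2) + Real.cos q.1)
        / (-(Real.sin q.1 : ℂ) * I + Real.cos q.1)) := by
      rw [contDiff_iff_contDiffAt]
      intro q
      have hmem := J_ratio_mem_slitPlane (tk q.1).g ((tu q.2).g • UpperHalfPlane.I)
        UpperHalfPlane.I
      rw [hw] at hmem
      have hmem' : (-(Real.sin q.1 : ℂ) * (I + q.2) + Real.cos q.1)
        / (-(Real.sin q.1 : ℂ) * I + Real.cos q.1) ∈ slitPlane := by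
        simpa [J, tk] using hmem
      exact ((contDiffAt_log hmem').restrict_scalars ℝ).comp q hr.contDiffAt
    have heq : (fun q : ℝ × ℝ => (tk q.1 * tu q.2).θ) = fun q : ℝ × ℝ => q.1
        - (log ((-(Real.sin q.1 : ℂ) * (I + q.2) + Real.cos q.1)
        / (-(Real.sin q.1 : ℂ) * I + Real.cos q.1))).im := by
      funext q
      rw [Cover.mul_θ, Complex.log_im, hw]
      simp [J, tk, tu]
    rw [heq]
    exact contDiff_fst.sub (imCLM.contDiff.comp hlog)
  exact hx.prodMk (hly.prodMk hθ)

/-- The right translate by `ũ(τ)` depends smoothly on all variables. -/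
theorem IsSmooth.joint {F : Cover → ℂ} (hF : IsSmooth F) :
    ContDiff ℝ ∞ fun q : (ℝ × ℝ × ℝ) × ℝ => F (iwasawa q.1 * tu q.2) := by
  have c2 : ContDiff ℝ ∞ fun q : (ℝ × ℝ × ℝ) × ℝ => (q.1.2.2, q.2) :=
    (contDiff_snd.comp (contDiff_snd.comp contDiff_fst)).prodMk contDiff_snd
  have h := contDiff_iwasawa_coords.comp c2
  have c0 : ContDiff ℝ ∞ fun q : (ℝ × ℝ × ℝ) × ℝ => q.1.1 := contDiff_fst.comp contDiff_fst
  have c1 : ContDiff ℝ ∞ fun q : (ℝ × ℝ × ℝ) × ℝ => q.1.2.1 :=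
    contDiff_fst.comp (contDiff_snd.comp contDiff_fst)
  have h3 := ContDiff.comp hF ((c0.add (c1.exp.mul (contDiff_fst.comp h))).prodMk
    ((c1.add ((contDiff_fst.comp contDiff_snd).comp h)).prodMk
      ((contDiff_snd.comp contDiff_snd).comp h)))
  have e : (fun q : (ℝ × ℝ × ℝ) × ℝ => F (iwasawa q.1 * tu q.2)) = fun q => F (iwasawa
      (q.1.1 + Real.exp q.1.2.1 * ((tk q.1.2.2 * tu q.2).g • UpperHalfPlane.I : ℍ).re,
      q.1.2.1 + Real.log ((tk q.1.2.2 * tu q.2).g • UpperHalfPlane.I : ℍ).im,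
      (tk q.1.2.2 * tu q.2).θ)) := by
    funext q
    rw [iwasawa_mul]
  rw [e]
  exact h3

theorem IsSmooth.rhoGen_Ep {F : Cover → ℂ} (hF : IsSmooth F) : IsSmooth (rhoGen .Ep F) := by
  have h := hF.joint
  change ContDiff ℝ ∞ fun p => deriv (fun t : ℝ => F (iwasawa p * tu t)) 0
  simp only [← fderiv_apply_one_eq_deriv]
  exact (ContDiff.fderiv (n := ∞) (m := ∞) (f := fun p t => F (iwasawa p * tu t)) h
    contDiff_const (by simp)).clm_apply contDiff_const

theorem LeftEquivariant.rhoGen {μ ν : ℂ} {F : Cover → ℂ} (hF : LeftEquivariant μ ν F)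
    (X : Gen) : LeftEquivariant μ ν (rhoGen X F) := by
  intro x y hy m a
  simp only [QAD.rhoGen, mul_assoc (tu x * ta y hy * tk (m * Real.pi)), hF x y hy m]
  rw [deriv_const_mul_field]

/-- The action of `E₊` on `I_{μ,ν}^∞`. -/
def rhoEp {μ ν : ℂ} (F : PS μ ν) : PS μ ν :=
  ⟨rhoGen .Ep F.1, LeftEquivariant.rhoGen F.2.1 .Ep, F.2.2.rhoGen_Ep⟩

theorem rhoGen_Ep_iterate (m : ℕ) (F : Cover → ℂ) (a : Cover) (s : ℝ) :
    (rhoGen .Ep)^[m] F (a * tu s) = iteratedDeriv m (fun τ => F (a * tu τ)) s := by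
  induction m generalizing s with
  | zero => simp
  | succ m ih =>
    rw [Function.iterate_succ_apply', iteratedDeriv_succ]
    change deriv (fun t : ℝ => (rhoGen .Ep)^[m] F (a * tu s * tu t)) 0 = _
    simp only [mul_assoc, tu_mul_tu, ih]
    have := deriv_comp_const_add (f := iteratedDeriv m fun τ => F (a * tu τ)) s 0
    rw [add_zero] at this
    exact this

theorem chart_rhoGen_Ep_iterate (m : ℕ) (F : Cover → ℂ) (x : ℝ) :
    chart ((rhoGen .Ep)^[m] F) x = (-1) ^ m * iteratedDeriv m (chart F) x := by
  rw [chart, rhoGen_Ep_iterate]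
  have h := iteratedDeriv_comp_neg m (fun τ => F (tw * tu τ)) x
  rw [show chart F = fun x => F (tw * tu (-x)) from rfl, h, Complex.real_smul, ← mul_assoc]
  push_cast
  rw [← mul_pow]
  simp

theorem deltaInf_eq {μ ν : ℂ} (m : ℕ) (F : PS μ ν) :
    deltaInf m F = deltaR m (chart (flip F).1) := by
  rw [deltaR, ← chart_rhoGen_Ep_iterate, chart, deltaInf]
  rw [neg_zero]
  rw [tu_zero, mul_one]

theorem contDiff_chart {F : Cover → ℂ} (hF : IsSmooth F) : ContDiff ℝ ∞ (chart F) := by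
  have h := hF.joint.comp (g := fun q : (ℝ × ℝ × ℝ) × ℝ => F (iwasawa q.1 * tu q.2))
    (f := fun x : ℝ => (((0, 0, -(Real.pi / 2)) : ℝ × ℝ × ℝ), -x))
    (contDiff_const.prodMk contDiff_neg)
  have e : chart F = (fun q : (ℝ × ℝ × ℝ) × ℝ => F (iwasawa q.1 * tu q.2)) ∘
      fun x : ℝ => (((0, 0, -(Real.pi / 2)) : ℝ × ℝ × ℝ), -x) := by
    funext x
    simp [iwasawa_weyl, chart]
  rw [e]
  exact h

theorem chart_rhoEp {μ ν : ℂ} (F : PS μ ν) (x : ℝ) :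
    chart (rhoEp F).1 x = -deriv (chart F.1) x := by
  have := chart_rhoGen_Ep_iterate 1 F.1 x
  rw [iteratedDeriv_one, pow_one, neg_one_mul] at this
  exact this

theorem chart_rho_tu {μ ν : ℂ} (t : ℝ) (F : PS μ ν) (x : ℝ) :
    chart (rho (tu t) F).1 x = chart F.1 (x - t) := by
  change F.1 (tw * tu (-x) * tu t) = F.1 (tw * tu (-(x - t)))
  rw [mul_assoc, tu_mul_tu, neg_sub, neg_add_eq_sub]

/-- Differentiation under the integral sign over a bounded interval. The integral is a convolution
with the indicator function of the interval. -/
theorem contDiff_setIntegral_Ioc {P : Type*} [NormedAddCommGroup P] [NormedSpace ℝ P]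
    {H : P × ℝ → ℂ} (hH : ContDiff ℝ ∞ H) (a b : ℝ) :
    ContDiff ℝ ∞ fun p => ∫ τ in Set.Ioc a b, H (p, τ) := by
  set R : ℝ := |a| + |b| + 1 with hR
  have hR0 : 0 < R := by positivity
  -- a cutoff makes the integrand compactly supported in the integration variable
  let ψ : ContDiffBump (0 : ℝ) := ⟨R, R + 1, hR0, by linarith⟩
  have hψ : ContDiff ℝ ∞ (ψ : ℝ → ℝ) := ψ.contDiff
  let g : P → ℝ → ℂ := fun p x => ψ x • H (p, -x)
  have hg : ContDiff ℝ ∞ (Function.uncurry g) :=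
    (hψ.comp contDiff_snd).smul (hH.comp (contDiff_fst.prodMk contDiff_snd.neg))
  have key := contDiffOn_convolution_right_with_param (n := ⊤) (μ := volume)
    (f := (Set.Ioc a b).indicator fun _ => (1 : ℝ)) (ContinuousLinearMap.lsmul ℝ ℝ)
    (g := g) isOpen_univ (isCompact_closedBall (0 : ℝ) (R + 1))
    (by
      intro p x _ hx
      have : ψ x = 0 := by
        apply ψ.zero_of_le_dist
        rw [Metric.mem_closedBall, not_le] at hx
        exact hx.le
      simp [g, this])
    ((locallyIntegrable_const 1).indicator measurableSet_Ioc) hg.contDiffOn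
  rw [Set.univ_prod_univ, contDiffOn_univ] at key
  have h2 := key.comp (contDiff_id.prodMk (contDiff_const (c := (0 : ℝ))))
  have e : (fun p => ∫ τ in Set.Ioc a b, H (p, τ)) = fun p =>
      convolution ((Set.Ioc a b).indicator fun _ => (1 : ℝ)) (g p)
        (ContinuousLinearMap.lsmul ℝ ℝ) volume 0 := by
    funext p
    rw [convolution_def, ← integral_indicator measurableSet_Ioc]
    congr 1
    funext τ
    by_cases hτ : τ ∈ Set.Ioc a b
    · have : ψ (-τ) = 1 := by
        apply ψ.one_of_mem_closedBall
        rw [Metric.mem_closedBall, Real.dist_eq, sub_zero, abs_neg]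
        change |τ| ≤ R
        rw [abs_le]
        have := neg_abs_le a
        have := le_abs_self b
        have := abs_nonneg a
        have := abs_nonneg b
        constructor <;> linarith [hτ.1, hτ.2]
      simp [hτ, g, this]
    · simp [hτ]
  rw [e]
  exact h2

theorem contDiff_intervalIntegral {P : Type*} [NormedAddCommGroup P] [NormedSpace ℝ P]
    {H : P × ℝ → ℂ} (hH : ContDiff ℝ ∞ H) (a b : ℝ) :
    ContDiff ℝ ∞ fun p => ∫ τ in a..b, H (p, τ) :=
  (contDiff_setIntegral_Ioc hH a b).sub (contDiff_setIntegral_Ioc hH b a)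

/-- The average `∫₀ᵗ ρ(ũ(τ)) F dτ`. -/
def average {μ ν : ℂ} (t : ℝ) (F : PS μ ν) : PS μ ν :=
  ⟨fun a => ∫ τ in (0 : ℝ)..t, F.1 (a * tu τ), fun x y hy m a => by
    simp only [mul_assoc (tu x * ta y hy * tk (m * Real.pi)), F.2.1 x y hy m]
    rw [intervalIntegral.integral_const_mul], contDiff_intervalIntegral F.2.2.joint 0 t⟩

theorem continuous_along {F : Cover → ℂ} (hF : IsSmooth F) (a : Cover) :
    Continuous fun τ => F (a * tu τ) := by
  have h := (hF.joint.comp (g := fun q : (ℝ × ℝ × ℝ) × ℝ => F (iwasawa q.1 * tu q.2))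
    (f := fun τ : ℝ => ((((a.g • UpperHalfPlane.I : ℍ).re,
      Real.log (a.g • UpperHalfPlane.I : ℍ).im, a.θ) : ℝ × ℝ × ℝ), τ))
    (contDiff_const.prodMk contDiff_id)).continuous
  have ha : iwasawa ((a.g • UpperHalfPlane.I : ℍ).re,
      Real.log (a.g • UpperHalfPlane.I : ℍ).im, a.θ) = a := by
    conv_rhs => rw [iwasawa_decomp a]
    unfold iwasawa
    congr 3
    exact Real.exp_log (UpperHalfPlane.im_pos _)
  simp only [Function.comp_def, ha] at h
  exact h

/-- Differentiating the average of the translates gives `ρ(E₊) ∫₀ᵗ ρ(ũ(τ)) F dτ = ρ(ũ(t)) F - F`. -/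
theorem rhoEp_average {μ ν : ℂ} (t : ℝ) (F : PS μ ν) :
    rhoEp (average t F) = rho (tu t) F - F := by
  apply Subtype.ext
  funext a
  have hc := continuous_along F.2.2 a
  have e : ∀ s : ℝ, (∫ τ in (0 : ℝ)..t, F.1 (a * tu s * tu τ))
      = (∫ τ in (0 : ℝ)..(s + t), F.1 (a * tu τ)) - ∫ τ in (0 : ℝ)..s, F.1 (a * tu τ) := by
    intro s
    simp only [mul_assoc, tu_mul_tu]
    rw [intervalIntegral.integral_comp_add_left (fun τ => F.1 (a * tu τ)) s, add_zero,
      intervalIntegral.integral_interval_sub_left (hc.intervalIntegrable _ _)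
      (hc.intervalIntegrable _ _)]
  change deriv (fun s : ℝ => ∫ τ in (0 : ℝ)..t, F.1 (a * tu s * tu τ)) 0
    = F.1 (a * tu t) - F.1 a
  simp only [e]
  have h1 : HasDerivAt (fun s : ℝ => ∫ τ in (0 : ℝ)..(s + t), F.1 (a * tu τ))
      (F.1 (a * tu t)) 0 := by
    have := (hc.integral_hasStrictDerivAt 0 (0 + t)).hasDerivAt.comp_add_const 0 t
    simpa using this
  have h2 := (hc.integral_hasStrictDerivAt 0 0).hasDerivAt
  refine (h1.sub h2).deriv.trans ?_
  rw [tu_zero, mul_one]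

theorem chart_average {μ ν : ℂ} (t : ℝ) (F : PS μ ν) (x : ℝ) :
    chart (average t F).1 x = ∫ τ in (0 : ℝ)..t, chart F.1 (x - τ) := by
  refine intervalIntegral.integral_congr fun τ _ => ?_
  exact chart_rho_tu τ F x

/-! ### Operations on test functions -/

/-- A smooth function with compact support, as a test function. -/
def mkTest (f : ℝ → ℂ) (h : ContDiff ℝ ∞ f) (h' : HasCompactSupport f) : Test where
  toFun := f
  contDiff' := h
  hasCompactSupport' := h'
  tsupport_subset' := fun _ _ => trivial

@[simp] theorem mkTest_apply (f : ℝ → ℂ) (h : ContDiff ℝ ∞ f) (h' : HasCompactSupport f)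
    (x : ℝ) : mkTest f h h' x = f x := rfl

theorem Test.smooth (f : Test) : ContDiff ℝ ∞ f := f.contDiff

theorem Test.differentiable (f : Test) : Differentiable ℝ f := f.smooth.differentiable (by simp)

/-- The product of a smooth function and a test function. -/
def smoothMul (ψ : ℝ → ℂ) (h : ContDiff ℝ ∞ ψ) (f : Test) : Test :=
  mkTest (fun x => ψ x * f x) (h.mul f.smooth) f.hasCompactSupport.mul_left

/-- The derivative of a test function. -/
def derivT (f : Test) : Test :=
  mkTest (deriv f) (contDiff_infty_iff_deriv.1 f.smooth).2 f.hasCompactSupport.deriv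

/-- The product `x f(x)`. -/
def mulX (f : Test) : Test := smoothMul (fun x => (x : ℂ)) ofRealCLM.contDiff f

@[simp] theorem smoothMul_apply (ψ : ℝ → ℂ) (h : ContDiff ℝ ∞ ψ) (f : Test) (x : ℝ) :
    smoothMul ψ h f x = ψ x * f x := rfl

@[simp] theorem derivT_apply (f : Test) (x : ℝ) : derivT f x = deriv f x := rfl

@[simp] theorem mulX_apply (f : Test) (x : ℝ) : mulX f x = x * f x := rfl

theorem derivT_iterate (n : ℕ) (f : Test) : ⇑(derivT^[n] f) = iteratedDeriv n f := by
  induction n with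
  | zero => simp
  | succ n ih =>
    rw [Function.iterate_succ_apply', iteratedDeriv_succ, ← ih]
    rfl

/-- The sum of the supremum norms of the derivatives up to order `m`. -/
def cNorm (m : ℕ) (f : ℝ → ℂ) : ℝ := ∑ i ∈ Finset.range (m + 1), ⨆ x : ℝ, ‖iteratedDeriv i f x‖

theorem Test.iteratedDeriv_bdd (f : Test) (i : ℕ) :
    BddAbove (Set.range fun x : ℝ => ‖iteratedDeriv i f x‖) := by
  rw [← derivT_iterate]
  exact (derivT^[i] f).smooth.continuous.norm.bddAbove_range_of_hasCompactSupport
    (derivT^[i] f).hasCompactSupport.norm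

theorem cNorm_nonneg (m : ℕ) (f : ℝ → ℂ) : 0 ≤ cNorm m f :=
  Finset.sum_nonneg fun _ _ => Real.iSup_nonneg fun _ => norm_nonneg _

theorem norm_iteratedDeriv_le_cNorm (f : Test) {i m : ℕ} (h : i ≤ m) (x : ℝ) :
    ‖iteratedDeriv i f x‖ ≤ cNorm m f :=
  (le_ciSup (f.iteratedDeriv_bdd i) x).trans
    (Finset.single_le_sum (f := fun i => ⨆ x : ℝ, ‖iteratedDeriv i f x‖)
      (fun _ _ => Real.iSup_nonneg fun _ => norm_nonneg _)
      (Finset.mem_range.2 (Nat.lt_succ_of_le h)))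

theorem cNorm_le {m : ℕ} {f : ℝ → ℂ} {C : ℝ} (h : ∀ i ≤ m, ∀ x, ‖iteratedDeriv i f x‖ ≤ C) :
    cNorm m f ≤ (m + 1) * C := by
  refine (Finset.sum_le_card_nsmul _ _ C fun i hi => ciSup_le fun x => h i ?_ x).trans ?_
  · exact Nat.lt_succ_iff.1 (Finset.mem_range.1 hi)
  · simp

theorem cNorm_mono (f : ℝ → ℂ) {m n : ℕ} (h : m ≤ n) : cNorm m f ≤ cNorm n f :=
  Finset.sum_le_sum_of_subset_of_nonneg (by simpa using h)
    fun _ _ _ => Real.iSup_nonneg fun _ => norm_nonneg _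

theorem tsupport_iteratedDeriv_subset (f : ℝ → ℂ) (i : ℕ) :
    tsupport (iteratedDeriv i f) ⊆ tsupport f := by
  induction i with
  | zero => simp
  | succ i ih =>
    rw [iteratedDeriv_succ]
    exact (tsupport_deriv_subset (𝕜 := ℝ)).trans ih

theorem norm_iteratedDeriv_mul_le {f g : ℝ → ℂ} (hf : ContDiff ℝ ∞ f) (hg : ContDiff ℝ ∞ g)
    (n : ℕ) (x : ℝ) : ‖iteratedDeriv n (fun y => f y * g y) x‖
      ≤ ∑ i ∈ Finset.range (n + 1),
        (n.choose i : ℝ) * ‖iteratedDeriv i f x‖ * ‖iteratedDeriv (n - i) g x‖ := by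
  have := norm_iteratedFDeriv_mul_le (𝕜 := ℝ) (N := ∞) hf hg x (n := n) (by exact_mod_cast le_top)
  simpa only [norm_iteratedFDeriv_eq_norm_iteratedDeriv] using this

/-- Multiplication by a smooth function is continuous on test functions with support in a given
compact set. -/
theorem exists_smoothMul_bound (ψ : ℝ → ℂ) (h : ContDiff ℝ ∞ ψ) (u : ℝ) (m : ℕ) :
    ∃ C : ℝ, 0 ≤ C ∧ ∀ f : Test, tsupport f ⊆ Set.Icc (-u) u →
      cNorm m (smoothMul ψ h f) ≤ C * cNorm m f := by
  have hb : ∀ i : ℕ, ∃ B : ℝ, 0 ≤ B ∧ ∀ x ∈ Set.Icc (-u) u, ‖iteratedDeriv i ψ x‖ ≤ B := by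
    intro i
    obtain ⟨B, hB⟩ := isCompact_Icc.exists_bound_of_continuousOn
      (s := Set.Icc (-u) u) (f := iteratedDeriv i ψ)
      (h.continuous_iteratedDeriv i (by exact_mod_cast le_top)).continuousOn
    exact ⟨max B 0, le_max_right _ _, fun x hx => (hB x hx).trans (le_max_left _ _)⟩
  choose B hB0 hB using hb
  have hS : ∀ n, 0 ≤ ∑ i ∈ Finset.range (n + 1), (n.choose i : ℝ) * B i := fun n =>
    Finset.sum_nonneg fun i _ => mul_nonneg (Nat.cast_nonneg _) (hB0 i)
  set K : ℝ := ∑ n ∈ Finset.range (m + 1), ∑ i ∈ Finset.range (n + 1), (n.choose i : ℝ) * B i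
    with hK
  have hK0 : 0 ≤ K := Finset.sum_nonneg fun n _ => hS n
  refine ⟨(m + 1) * K, by positivity, fun f hf => ?_⟩
  rw [mul_assoc]
  refine cNorm_le fun n hn x => ?_
  by_cases hx : x ∈ Set.Icc (-u) u
  · refine (norm_iteratedDeriv_mul_le h f.smooth n x).trans ?_
    have h1 : ∑ i ∈ Finset.range (n + 1),
        (n.choose i : ℝ) * ‖iteratedDeriv i ψ x‖ * ‖iteratedDeriv (n - i) f x‖
        ≤ ∑ i ∈ Finset.range (n + 1), (n.choose i : ℝ) * B i * cNorm m f := by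
      refine Finset.sum_le_sum fun i _ => ?_
      gcongr
      · exact mul_nonneg (Nat.cast_nonneg _) (hB0 i)
      · exact hB i x hx
      · exact norm_iteratedDeriv_le_cNorm f ((Nat.sub_le n i).trans hn) x
    refine h1.trans ?_
    rw [← Finset.sum_mul]
    refine mul_le_mul_of_nonneg_right ?_ (cNorm_nonneg _ _)
    exact Finset.single_le_sum (f := fun n => ∑ i ∈ Finset.range (n + 1), (n.choose i : ℝ) * B i)
      (fun n _ => hS n) (Finset.mem_range.2 (Nat.lt_succ_of_le hn))
  · have h0 : iteratedDeriv n (smoothMul ψ h f) x = 0 := by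
      refine image_eq_zero_of_notMem_tsupport fun hx' => hx (hf ?_)
      exact (tsupport_mul_subset_right (f := ψ) (g := f)) (tsupport_iteratedDeriv_subset _ n hx')
    rw [h0, norm_zero]
    exact mul_nonneg hK0 (cNorm_nonneg _ _)

theorem cNorm_derivT_le (m : ℕ) (f : Test) : cNorm m (derivT f) ≤ (m + 1) * cNorm (m + 1) f := by
  refine cNorm_le fun i hi x => ?_
  change ‖iteratedDeriv i (deriv f) x‖ ≤ _
  rw [← iteratedDeriv_succ']
  exact norm_iteratedDeriv_le_cNorm f (by omega) x

/-! ### The twisted inversion on test functions -/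

theorem hasDerivAt_Jfac (μ s : ℂ) {x : ℝ} (hx : x ≠ 0) :
    HasDerivAt (Jfac μ s) ((-2 * s - 1) / x * Jfac μ s x) x := by
  have h1 : HasDerivAt (fun y : ℝ => cexp (((Real.log y : ℝ) : ℂ) * (-2 * s - 1)))
      (cexp (((Real.log x : ℝ) : ℂ) * (-2 * s - 1)) * (((x⁻¹ : ℝ) : ℂ) * (-2 * s - 1))) x :=
    (((Real.hasDerivAt_log hx).ofReal_comp).mul_const _).cexp
  have h2 : ∀ y : ℝ, y ≠ 0 → ((|y| : ℝ) : ℂ) ^ (-2 * s - 1)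
      = cexp (((Real.log y : ℝ) : ℂ) * (-2 * s - 1)) := by
    intro y hy
    rw [cpow_def_of_ne_zero (by simpa using hy), ← ofReal_log (abs_nonneg y), Real.log_abs]
  have h3 := h1.const_mul (cexp (-(Real.sign x : ℂ) * Real.pi * I * μ / 2))
  have h4 : Jfac μ s =ᶠ[𝓝 x] fun y => cexp (-(Real.sign x : ℂ) * Real.pi * I * μ / 2)
      * cexp (((Real.log y : ℝ) : ℂ) * (-2 * s - 1)) := by
    rcases lt_or_gt_of_ne hx with h | h
    · filter_upwards [isOpen_Iio.mem_nhds h] with y hy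
      rw [Jfac, h2 y (ne_of_lt hy), Real.sign_of_neg h, Real.sign_of_neg hy]
    · filter_upwards [isOpen_Ioi.mem_nhds h] with y hy
      rw [Jfac, h2 y (ne_of_gt hy), Real.sign_of_pos h, Real.sign_of_pos hy]
  refine (h3.congr_of_eventuallyEq h4).congr_deriv ?_
  rw [Jfac, h2 x hx]
  push_cast
  ring

theorem Jfac_shift (μ s : ℂ) {x : ℝ} (hx : x ≠ 0) :
    Jfac (μ + 1) (s + 1 / 2) x = -I / x * Jfac μ s x := by
  have h0 : ((|x| : ℝ) : ℂ) ≠ 0 := by simpa using hx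
  have h1 : ((|x| : ℝ) : ℂ) ^ (-2 * (s + 1 / 2) - 1)
      = ((|x| : ℝ) : ℂ) ^ (-2 * s - 1) * ((|x| : ℝ) : ℂ)⁻¹ := by
    rw [show -2 * (s + 1 / 2) - 1 = (-2 * s - 1) + (-1) by ring, cpow_add _ _ h0, cpow_neg_one]
  have h2 : cexp (-(Real.sign x : ℂ) * Real.pi * I * (μ + 1) / 2)
      = cexp (-(Real.sign x : ℂ) * Real.pi * I * μ / 2) * (-I * Real.sign x) := by
    rw [show -(Real.sign x : ℂ) * Real.pi * I * (μ + 1) / 2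
      = -(Real.sign x : ℂ) * Real.pi * I * μ / 2 + -(Real.sign x : ℂ) * (Real.pi / 2 * I) by ring,
      Complex.exp_add]
    congr 1
    rcases lt_or_gt_of_ne hx with h | h
    · rw [Real.sign_of_neg h]
      simp [Complex.exp_pi_div_two_mul_I]
    · rw [Real.sign_of_pos h]
      simp [Complex.exp_neg, Complex.exp_pi_div_two_mul_I]
  have h3 : (Real.sign x : ℂ) * ((|x| : ℝ) : ℂ)⁻¹ = (x : ℂ)⁻¹ := by
    rcases lt_or_gt_of_ne hx with h | h
    · rw [Real.sign_of_neg h, abs_of_neg h]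
      push_cast
      rw [inv_neg]; ring
    · rw [Real.sign_of_pos h, abs_of_pos h]
      simp
  rw [Jfac, Jfac, h1, h2, div_eq_mul_inv (-I), ← h3]
  ring

theorem Jfac_mul_Jfac_neg_inv (μ s : ℂ) {x : ℝ} (hx : x ≠ 0) :
    Jfac μ s x * Jfac μ s (-1 / x) = 1 := by
  have h0 : ((|x| : ℝ) : ℂ) ≠ 0 := by simpa using hx
  have h1 : |(-1 / x)| = |x|⁻¹ := by rw [abs_div, abs_neg, abs_one, one_div]
  have h2 : Real.sign (-1 / x) = -Real.sign x := by
    rcases lt_or_gt_of_ne hx with h | h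
    · rw [Real.sign_of_neg h, Real.sign_of_pos (div_pos_of_neg_of_neg (by norm_num) h), neg_neg]
    · rw [Real.sign_of_pos h, Real.sign_of_neg (div_neg_of_neg_of_pos (by norm_num) h)]
  rw [Jfac, Jfac, h1, h2, ofReal_inv, inv_cpow_eq_ite, if_neg]
  · rw [mul_mul_mul_comm, mul_inv_cancel₀ (by simp [cpow_eq_zero_iff, hx]), ← Complex.exp_add]
    push_cast
    ring_nf
    simp
  · rw [arg_ofReal_of_nonneg (abs_nonneg x)]
    exact Real.pi_pos.ne

theorem invFun_invFun (μ s : ℂ) (f : ℝ → ℂ) {x : ℝ} (hx : x ≠ 0) :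
    invFun μ s (invFun μ s f) x = f x := by
  rw [invFun, invFun, ← mul_assoc, Jfac_mul_Jfac_neg_inv μ s hx, one_mul]
  congr 1
  field_simp

theorem invFun_mulX (μ s : ℂ) (g : ℝ → ℂ) {x : ℝ} (hx : x ≠ 0) :
    invFun μ s (fun u => u * g u) x = -I * invFun (μ + 1) (s + 1 / 2) g x := by
  have hxc : (x : ℂ) ≠ 0 := by exact_mod_cast hx
  rw [invFun, invFun, Jfac_shift μ s hx]
  generalize g (-1 / x) = A
  push_cast
  field_simp
  linear_combination (-(Jfac μ s x * A)) * I_sq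

/-- Differentiation after twisted inversion: up to the shift `(μ, s) ↦ (μ + 1, s + 1/2)` it is the
twisted inversion of `-(2 s + 1) g - u g'`. -/
theorem hasDerivAt_invFun (μ s : ℂ) {g : ℝ → ℂ} (hg : Differentiable ℝ g) {x : ℝ} (hx : x ≠ 0) :
    HasDerivAt (invFun μ s g)
      (I * invFun (μ + 1) (s + 1 / 2) (fun u => -(2 * s + 1) * g u - u * deriv g u) x) x := by
  have hxc : (x : ℂ) ≠ 0 := by exact_mod_cast hx
  have h1 : HasDerivAt (fun y : ℝ => -1 / y) (1 / x ^ 2) x := by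
    have := (hasDerivAt_inv hx).neg
    refine (this.congr_of_eventuallyEq ?_).congr_deriv ?_
    · filter_upwards with y
      simp [neg_div]
    · simp
  have h2 := HasDerivAt.scomp x (hg (-1 / x)).hasDerivAt h1
  have h3 := (hasDerivAt_Jfac μ s hx).mul h2
  refine h3.congr_deriv ?_
  rw [invFun, Jfac_shift μ s hx]
  simp only [Function.comp_apply, Complex.real_smul]
  generalize g (-1 / x) = A
  generalize deriv g (-1 / x) = B
  push_cast
  field_simp
  linear_combination ((Jfac μ s x * (-(x * (2 * s + 1) * A) + B))) * I_sq

/-- The twisted inversion of a test function, with value `0` at the origin. -/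
def extInv (μ s : ℂ) (f : ℝ → ℂ) (x : ℝ) : ℂ := if x = 0 then 0 else invFun μ s f x

theorem extInv_zero (μ s : ℂ) (f : ℝ → ℂ) : extInv μ s f 0 = 0 := if_pos rfl

theorem extInv_of_ne (μ s : ℂ) (f : ℝ → ℂ) {x : ℝ} (hx : x ≠ 0) :
    extInv μ s f x = invFun μ s f x := if_neg hx

theorem fourier_extInv (μ s : ℂ) (f : ℝ → ℂ) (y : ℝ) :
    fourier (extInv μ s f) y = fourier (invFun μ s f) y := by
  refine integral_congr_ae ?_
  filter_upwards [Measure.ae_ne volume (0 : ℝ)] with x hx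
  rw [extInv_of_ne μ s f hx]

theorem extInv_eventually_zero (μ s : ℂ) (f : Test) : extInv μ s f =ᶠ[𝓝 0] fun _ => 0 := by
  obtain ⟨R, hR, h⟩ := exists_bound f
  have : {y : ℝ | |y| < 1 / R} ∈ 𝓝 (0 : ℝ) :=
    (isOpen_lt continuous_abs continuous_const).mem_nhds (by simpa using hR)
  filter_upwards [this] with y hy
  by_cases hy0 : y = 0
  · rw [hy0, extInv_zero]
  · rw [extInv_of_ne μ s f hy0, invFun, h, mul_zero]
    have hy1 : 0 < |y| := abs_pos.2 hy0
    have hy2 : |y| < 1 / R := hy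
    rw [abs_div, abs_neg, abs_one, lt_div_iff₀ hy1]
    rw [lt_div_iff₀ hR] at hy2
    linarith

theorem extInv_eventuallyEq (μ s : ℂ) (f : ℝ → ℂ) {x : ℝ} (hx : x ≠ 0) :
    extInv μ s f =ᶠ[𝓝 x] invFun μ s f := by
  filter_upwards [isOpen_ne.mem_nhds hx] with y hy using extInv_of_ne μ s f hy

/-- The twisted inversion of a test function vanishes near the origin, so it is smooth. It need not
have compact support. -/
theorem contDiff_extInv (μ s : ℂ) (f : Test) : ContDiff ℝ ∞ (extInv μ s f) := by
  rw [contDiff_iff_contDiffAt]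
  intro x
  by_cases hx : x = 0
  · rw [hx]
    exact contDiffAt_const.congr_of_eventuallyEq (extInv_eventually_zero μ s f)
  · refine ContDiffAt.congr_of_eventuallyEq ?_ (extInv_eventuallyEq μ s f hx)
    refine (contDiffAt_Jfac μ s hx).mul ?_
    exact f.contDiff.contDiffAt.comp x (contDiffAt_const.div contDiffAt_id hx)

theorem extInv_add (μ s : ℂ) (f g : Test) :
    extInv μ s (f + g : Test) = fun x => extInv μ s f x + extInv μ s g x := by
  funext x
  by_cases hx : x = 0
  · simp [hx, extInv_zero]
  · simp [extInv_of_ne, hx, invFun, mul_add]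

theorem extInv_smul (μ s c : ℂ) (f : Test) :
    extInv μ s (c • f : Test) = fun x => c * extInv μ s f x := by
  funext x
  by_cases hx : x = 0
  · simp [hx, extInv_zero]
  · simp [extInv_of_ne, hx, invFun]
    ring

theorem extInv_mulX (μ s : ℂ) (f : Test) :
    extInv μ s (mulX f) = fun x => -I * extInv (μ + 1) (s + 1 / 2) f x := by
  funext x
  by_cases hx : x = 0
  · simp [hx, extInv_zero]
  · rw [extInv_of_ne _ _ _ hx, extInv_of_ne _ _ _ hx, ← invFun_mulX μ s f hx]
    rfl

/-- The operator `D_s f = -(2 s + 1) f - u f'`. The derivative of the twisted inversion of `f` is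
`i` times the twisted inversion of `D_s f` with parameters `(μ + 1, s + 1/2)`. -/
def eulerT (s : ℂ) (f : Test) : Test := -(2 * s + 1) • f + (-1 : ℂ) • mulX (derivT f)

theorem deriv_extInv (μ s : ℂ) (f : Test) :
    deriv (extInv μ s f) = fun x => I * extInv (μ + 1) (s + 1 / 2) (eulerT s f) x := by
  funext x
  by_cases hx : x = 0
  · rw [hx, (extInv_eventually_zero μ s f).deriv_eq, extInv_zero]
    simp
  · rw [(extInv_eventuallyEq μ s f hx).deriv_eq,
      (hasDerivAt_invFun μ s f.differentiable hx).deriv, extInv_of_ne _ _ _ hx]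
    congr 2
    funext u
    simp [eulerT]
    ring

/-- Each derivative raises `s` by `1/2`, which improves the decay at infinity. -/
theorem iteratedDeriv_extInv_succ (N : ℕ) (μ s : ℂ) (f : Test) :
    iteratedDeriv (N + 1) (extInv μ s f) = fun x =>
      -I * (2 * s + 1) * iteratedDeriv N (extInv (μ + 1) (s + 1 / 2) f) x
      + -I * iteratedDeriv N (extInv (μ + 1) (s + 1 / 2) (mulX (derivT f))) x := by
  funext x
  have c1 : ∀ g : Test, ContDiffAt ℝ N (extInv (μ + 1) (s + 1 / 2) g) x := fun g =>
    (contDiff_extInv _ _ g).contDiffAt.of_le (by exact_mod_cast le_top)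
  rw [iteratedDeriv_succ', deriv_extInv, eulerT, extInv_add, extInv_smul, extInv_smul]
  have e : (fun x => I * (-(2 * s + 1) * extInv (μ + 1) (s + 1 / 2) f x
      + -1 * extInv (μ + 1) (s + 1 / 2) (mulX (derivT f)) x))
      = (fun x => (-I * (2 * s + 1)) * extInv (μ + 1) (s + 1 / 2) f x)
        + fun x => -I * extInv (μ + 1) (s + 1 / 2) (mulX (derivT f)) x := by
    funext x
    simp only [Pi.add_apply]
    ring
  rw [e, iteratedDeriv_add (contDiffAt_const.mul (c1 _)) (contDiffAt_const.mul (c1 _)),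
    iteratedDeriv_const_mul_field, iteratedDeriv_const_mul_field]

/-! ### Integrability and holomorphy of the twisted inversion -/

theorem norm_Jfac_le (μ s : ℂ) {x : ℝ} (hx : x ≠ 0) :
    ‖Jfac μ s x‖ ≤ Real.exp (Real.pi * |μ.im| / 2) * |x| ^ (-(2 * s.re + 1)) := by
  rw [Jfac, norm_mul, Complex.norm_exp, norm_cpow_eq_rpow_re_of_pos (abs_pos.2 hx)]
  refine mul_le_mul ?_ ?_ (by positivity) (by positivity)
  · rw [Real.exp_le_exp]
    have e : (-(Real.sign x : ℂ) * Real.pi * I * μ / 2).re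
        = Real.pi * (Real.sign x * μ.im) / 2 := by
      rw [show -(Real.sign x : ℂ) * Real.pi * I * μ / 2
        = ((-(Real.sign x * Real.pi / 2) : ℝ) : ℂ) * (I * μ) by push_cast; ring, re_ofReal_mul]
      simp
      ring
    rw [e]
    have : Real.sign x * μ.im ≤ |μ.im| := by
      rcases lt_or_gt_of_ne hx with h | h
      · rw [Real.sign_of_neg h]; linarith [neg_abs_le μ.im]
      · rw [Real.sign_of_pos h]; linarith [le_abs_self μ.im]
    have := Real.pi_pos
    gcongr
  · apply le_of_eq
    congr 1
    simp
    ring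

theorem Test.eq_zero_of_lt {f : Test} {u : ℝ} (hf : tsupport f ⊆ Set.Icc (-u) u) {x : ℝ}
    (hx : u < |x|) : f x = 0 :=
  image_eq_zero_of_notMem_tsupport fun h => absurd (abs_le.2 (hf h)) (not_le.2 hx)

theorem Test.exists_tsupport_subset (f : Test) :
    ∃ u : ℝ, 0 < u ∧ tsupport f ⊆ Set.Icc (-u) u := by
  obtain ⟨R, hR, h⟩ := f.hasCompactSupport.isCompact.isBounded.exists_pos_norm_le
  exact ⟨R, hR, fun x hx => abs_le.1 (h x hx)⟩

theorem norm_extInv_le (μ : ℂ) {s : ℂ} {u M : ℝ} (hu : 0 < u) (hs : 0 ≤ 2 * s.re + 1) {f : Test}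
    (hf : tsupport f ⊆ Set.Icc (-u) u) (hM : ∀ x, ‖f x‖ ≤ M) (x : ℝ) :
    ‖extInv μ s f x‖ ≤ Real.exp (Real.pi * |μ.im| / 2) * (1 + u) ^ (2 * s.re + 1) * M
      * (1 + ‖x‖) ^ (-(2 * s.re + 1)) := by
  have hM0 : 0 ≤ M := (norm_nonneg _).trans (hM 0)
  by_cases hx : x = 0
  · rw [hx, extInv_zero, norm_zero]
    positivity
  rw [extInv_of_ne _ _ _ hx]
  have hx0 : 0 < |x| := abs_pos.2 hx
  by_cases h1 : u < |(-1 / x)|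
  · rw [invFun, Test.eq_zero_of_lt hf h1, mul_zero, norm_zero]
    positivity
  · rw [invFun, norm_mul]
    rw [not_lt, abs_div, abs_neg, abs_one, div_le_iff₀ hx0] at h1
    have h2 : (1 + ‖x‖) / (1 + u) ≤ |x| := by
      rw [div_le_iff₀ (by positivity), Real.norm_eq_abs]
      linarith
    have h3 : |x| ^ (-(2 * s.re + 1))
        ≤ (1 + u) ^ (2 * s.re + 1) * (1 + ‖x‖) ^ (-(2 * s.re + 1)) := by
      refine (Real.rpow_le_rpow_of_nonpos (by positivity) h2 (by linarith)).trans ?_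
      rw [Real.div_rpow (by positivity) (by positivity), Real.rpow_neg (by positivity : 0 ≤ 1 + u)]
      apply le_of_eq
      field_simp
    calc ‖Jfac μ s x‖ * ‖f (-1 / x)‖
        ≤ (Real.exp (Real.pi * |μ.im| / 2) * ((1 + u) ^ (2 * s.re + 1)
          * (1 + ‖x‖) ^ (-(2 * s.re + 1)))) * M := by
          refine mul_le_mul ((norm_Jfac_le μ s hx).trans ?_) (hM _) (norm_nonneg _) (by positivity)
          gcongr
      _ = _ := by ring

theorem integrable_one_add_norm_rpow {r : ℝ} (hr : 1 < r) :
    Integrable fun x : ℝ => (1 + ‖x‖) ^ (-r) :=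
  integrable_one_add_norm (by simpa using hr)

theorem Test.norm_le_cNorm (f : Test) (x : ℝ) : ‖f x‖ ≤ cNorm 0 f := by
  simpa using norm_iteratedDeriv_le_cNorm f (le_refl 0) x

theorem integrable_extInv (μ : ℂ) {s : ℂ} (hs : 0 < s.re) (f : Test) :
    Integrable (extInv μ s f) := by
  obtain ⟨u, hu, hf⟩ := f.exists_tsupport_subset
  refine ((integrable_one_add_norm_rpow (r := 2 * s.re + 1) (by linarith)).const_mul _).mono'
    (contDiff_extInv μ s f).continuous.aestronglyMeasurable
    (Eventually.of_forall (norm_extInv_le μ hu (by linarith) hf f.norm_le_cNorm))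

theorem exists_integral_extInv_le (μ : ℂ) {σ τ u : ℝ} (hσ : 0 < σ) (hu : 0 < u) :
    ∃ C : ℝ, 0 ≤ C ∧ ∀ s : ℂ, σ ≤ s.re → s.re ≤ τ → ∀ f : Test, tsupport f ⊆ Set.Icc (-u) u →
      ∫ x, ‖extInv μ s f x‖ ≤ C * cNorm 0 f := by
  have hint := integrable_one_add_norm_rpow (r := 2 * σ + 1) (by linarith)
  refine ⟨Real.exp (Real.pi * |μ.im| / 2) * (1 + u) ^ (2 * τ + 1)
    * ∫ x : ℝ, (1 + ‖x‖) ^ (-(2 * σ + 1)), ?_, fun s h1 h2 f hf => ?_⟩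
  · have : 0 ≤ ∫ x : ℝ, (1 + ‖x‖) ^ (-(2 * σ + 1)) :=
      integral_nonneg fun x => by positivity
    positivity
  · calc ∫ x, ‖extInv μ s f x‖
        ≤ ∫ x : ℝ, (Real.exp (Real.pi * |μ.im| / 2) * (1 + u) ^ (2 * τ + 1) * cNorm 0 f)
          * (1 + ‖x‖) ^ (-(2 * σ + 1)) := by
          refine integral_mono (integrable_extInv μ (by linarith) f).norm
            (hint.const_mul _) fun x => ?_
          refine (norm_extInv_le μ hu (by linarith) hf f.norm_le_cNorm x).trans ?_
          have := cNorm_nonneg 0 f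
          have h3 : (1 + u) ^ (2 * s.re + 1) ≤ (1 + u) ^ (2 * τ + 1) :=
            Real.rpow_le_rpow_of_exponent_le (by linarith) (by linarith)
          have h4 : (1 + ‖x‖) ^ (-(2 * s.re + 1)) ≤ (1 + ‖x‖) ^ (-(2 * σ + 1)) :=
            Real.rpow_le_rpow_of_exponent_le (by linarith [norm_nonneg x]) (by linarith)
          gcongr
      _ = _ := by rw [integral_const_mul]; ring

theorem extInv_eq_testInv (μ s : ℂ) (f : Test) (hf : (0 : ℝ) ∉ tsupport f) :
    extInv μ s f = testInv μ s f hf := by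
  funext x
  by_cases hx : x = 0
  · rw [hx, extInv_zero]
    change 0 = invFun μ s f 0
    simp [invFun, image_eq_zero_of_notMem_tsupport hf]
  · rw [extInv_of_ne _ _ _ hx]
    rfl

theorem integrable_extInv_of_notMem (μ s : ℂ) (f : Test) (hf : (0 : ℝ) ∉ tsupport f) :
    Integrable (extInv μ s f) := by
  rw [extInv_eq_testInv μ s f hf]
  exact (testInv μ s f hf).smooth.continuous.integrable_of_hasCompactSupport
    (testInv μ s f hf).hasCompactSupport

theorem norm_exp_I_mul (x y : ℝ) : ‖cexp (2 * Real.pi * I * x * y)‖ = 1 := by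
  rw [show (2 * Real.pi * I * x * y : ℂ) = ((2 * Real.pi * x * y : ℝ) : ℂ) * I by push_cast; ring,
    Complex.norm_exp_ofReal_mul_I]

theorem integrable_mul_exp {g : ℝ → ℂ} (hg : Integrable g) (y : ℝ) :
    Integrable fun x : ℝ => g x * cexp (2 * Real.pi * I * x * y) := by
  refine hg.mul_bdd (c := 1) (Continuous.aestronglyMeasurable (by fun_prop)) ?_
  filter_upwards with x
  rw [norm_exp_I_mul]

theorem norm_fourier_le (g : ℝ → ℂ) (y : ℝ) : ‖fourier g y‖ ≤ ∫ x, ‖g x‖ := by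
  refine (norm_integral_le_integral_norm _).trans (le_of_eq ?_)
  congr 1
  funext x
  rw [norm_mul, norm_exp_I_mul, mul_one]

theorem fourier_add {g h : ℝ → ℂ} (hg : Integrable g) (hh : Integrable h) (y : ℝ) :
    fourier (fun x => g x + h x) y = fourier g y + fourier h y := by
  rw [fourier, fourier, fourier, ← integral_add (integrable_mul_exp hg y) (integrable_mul_exp hh y)]
  simp only [add_mul]

theorem fourier_smul (c : ℂ) (g : ℝ → ℂ) (y : ℝ) :
    fourier (fun x => c * g x) y = c * fourier g y := by
  rw [fourier, fourier, ← integral_const_mul]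
  simp only [mul_assoc]

/-- The two halves of the Fourier integral of the twisted inversion are Mellin transforms. -/
theorem fourier_extInv_eq_mellin (μ s : ℂ) (f : Test) (y : ℝ) (h : Integrable (extInv μ s f)) :
    fourier (extInv μ s f) y
      = cexp (-(Real.pi * I * μ / 2))
        * mellin (fun x : ℝ => f (-1 / x) * cexp (2 * Real.pi * I * x * y)) (-2 * s)
      + cexp (Real.pi * I * μ / 2)
        * mellin (fun x : ℝ => f (1 / x) * cexp (2 * Real.pi * I * x * (-y : ℝ))) (-2 * s) := by
  have hi := integrable_mul_exp h y
  have h1 := intervalIntegral.integral_Iic_add_Ioi (hi.integrableOn (s := Set.Iic 0))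
    (hi.integrableOn (s := Set.Ioi 0))
  have h2 := integral_comp_neg_Ioi (0 : ℝ)
    (fun x => extInv μ s f x * cexp (2 * Real.pi * I * x * y))
  rw [neg_zero] at h2
  rw [fourier, ← h1, ← h2, add_comm, mellin, mellin, ← integral_const_mul, ← integral_const_mul]
  congr 1
  · refine setIntegral_congr_fun measurableSet_Ioi fun x hx => ?_
    have hx0 : (0 : ℝ) < x := hx
    rw [extInv_of_ne _ _ _ hx0.ne', invFun, Jfac, Real.sign_of_pos hx0, abs_of_pos hx0, smul_eq_mul]
    push_cast
    rw [show -1 * (Real.pi : ℂ) * I * μ / 2 = -(Real.pi * I * μ / 2) by ring]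
    ring
  · refine setIntegral_congr_fun measurableSet_Ioi fun x hx => ?_
    have hx0 : (0 : ℝ) < x := hx
    rw [extInv_of_ne _ _ _ (neg_ne_zero.2 hx0.ne'), invFun, Jfac,
      Real.sign_of_neg (neg_lt_zero.2 hx0), abs_neg, abs_of_pos hx0, smul_eq_mul, neg_div_neg_eq]
    push_cast
    rw [show -(-1) * (Real.pi : ℂ) * I * μ / 2 = Real.pi * I * μ / 2 by ring,
      show (2 : ℂ) * Real.pi * I * -x * y = 2 * Real.pi * I * x * -y by ring]
    ring

/-- The Mellin transforms of `fourier_extInv_eq_mellin` are holomorphic: the integrand vanishes near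
`0`, and at infinity it is bounded, or zero if `f` vanishes near the origin. -/
theorem differentiableAt_mellin_test (f : Test) (ε : ℝ) (hε : |ε| = 1) (y : ℝ) {s : ℂ}
    (hs : s.re < 0 ∨ (0 : ℝ) ∉ tsupport f) :
    DifferentiableAt ℂ
      (mellin (fun x : ℝ => f (ε / x) * cexp (2 * Real.pi * I * x * y))) s := by
  have hε0 : ε ≠ 0 := by
    intro h
    rw [h] at hε
    simp at hε
  have hloc : LocallyIntegrableOn (fun x : ℝ => f (ε / x) * cexp (2 * Real.pi * I * x * y))
      (Set.Ioi 0) volume := by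
    refine ContinuousOn.locallyIntegrableOn (fun x hx => ?_) measurableSet_Ioi
    refine ContinuousAt.continuousWithinAt ?_
    refine ContinuousAt.mul ?_ (by fun_prop)
    exact ContinuousAt.comp (f := fun x : ℝ => ε / x) f.smooth.continuous.continuousAt
      (continuousAt_const.div continuousAt_id (ne_of_gt hx))
  have hzero : ∀ b : ℝ, (fun x : ℝ => f (ε / x) * cexp (2 * Real.pi * I * x * y))
      =O[𝓝[>] 0] fun x => x ^ (-b) := by
    intro b
    obtain ⟨R, hR, h⟩ := exists_bound f
    refine Asymptotics.IsBigO.of_bound 1 ?_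
    have : Set.Ioo 0 (1 / R) ∈ 𝓝[>] (0 : ℝ) := Ioo_mem_nhdsGT (by positivity)
    filter_upwards [this] with x hx
    rw [h, zero_mul, norm_zero]
    · positivity
    · rw [abs_div, hε, abs_of_pos hx.1, lt_div_iff₀ hx.1]
      have := hx.2
      rw [lt_div_iff₀ hR] at this
      linarith
  rcases hs with hs | hs
  · refine mellin_differentiableAt_of_isBigO_rpow (a := 0) (b := s.re - 1) hloc ?_ hs
      (hzero _) (by linarith)
    refine Asymptotics.IsBigO.of_bound (cNorm 0 f) ?_
    filter_upwards with x
    rw [norm_mul, norm_exp_I_mul]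
    simpa using f.norm_le_cNorm _
  · refine mellin_differentiableAt_of_isBigO_rpow (a := s.re + 1) (b := s.re - 1) hloc ?_
      (by linarith) (hzero _) (by linarith)
    have h0 : ∀ᶠ v in 𝓝 (0 : ℝ), f v = 0 := by
      filter_upwards [(isClosed_tsupport _).isOpen_compl.mem_nhds hs] with v hv
      exact image_eq_zero_of_notMem_tsupport hv
    have ht : Tendsto (fun x : ℝ => ε / x) atTop (𝓝 0) := tendsto_const_nhds.div_atTop tendsto_id
    refine Asymptotics.IsBigO.of_bound 1 ?_
    filter_upwards [ht.eventually h0, eventually_ge_atTop 0] with x hx hx0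
    rw [hx, zero_mul, norm_zero]
    positivity

theorem differentiableAt_fourier_extInv (μ : ℂ) (f : Test) (y : ℝ) {s : ℂ}
    (hs : 0 < s.re ∨ (0 : ℝ) ∉ tsupport f) :
    DifferentiableAt ℂ (fun s => fourier (extInv μ s f) y) s := by
  have hlin : DifferentiableAt ℂ (fun s : ℂ => -2 * s) s := by fun_prop
  have hre : ∀ s : ℂ, (-2 * s).re = -2 * s.re := fun s => by simp
  have hs' : (-2 * s).re < 0 ∨ (0 : ℝ) ∉ tsupport f := by
    rw [hre]
    exact hs.imp_left fun h => by linarith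
  have h1 := (differentiableAt_mellin_test f (-1) (by simp) y hs').comp s hlin
  have h2 := (differentiableAt_mellin_test f 1 (by simp) (-y) hs').comp s hlin
  refine DifferentiableAt.congr_of_eventuallyEq
    ((h1.const_mul (cexp (-(Real.pi * I * μ / 2)))).add
      (h2.const_mul (cexp (Real.pi * I * μ / 2)))) ?_
  have hev : ∀ᶠ z : ℂ in 𝓝 s, Integrable (extInv μ z f) := by
    rcases hs with hs | hs
    · filter_upwards [(isOpen_lt continuous_const continuous_re).mem_nhds hs] with z hz
      exact integrable_extInv μ hz f
    · exact Eventually.of_forall fun z => integrable_extInv_of_notMem μ z f hs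
  filter_upwards [hev] with z hz
  exact fourier_extInv_eq_mellin μ z f y hz

theorem tsupport_derivT_subset (f : Test) : tsupport (derivT f) ⊆ tsupport f :=
  tsupport_deriv_subset (𝕜 := ℝ)

theorem tsupport_smoothMul_subset (ψ : ℝ → ℂ) (h : ContDiff ℝ ∞ ψ) (f : Test) :
    tsupport (smoothMul ψ h f) ⊆ tsupport f := tsupport_mul_subset_right (f := ψ) (g := f)

/-- The `N`-th derivative of the twisted inversion is integrable as soon as `0 < 2 Re s + N`, with a
bound that is uniform on the test functions with support in a given interval. -/
theorem exists_iteratedDeriv_extInv_bound (N : ℕ) (μ s : ℂ) {u : ℝ} (hu : 0 < u)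
    (hs : 0 < 2 * s.re + N) :
    ∃ C : ℝ, 0 ≤ C ∧ ∀ f : Test, tsupport f ⊆ Set.Icc (-u) u →
      Integrable (iteratedDeriv N (extInv μ s f)) ∧
      ∫ x, ‖iteratedDeriv N (extInv μ s f) x‖ ≤ C * cNorm N f := by
  induction N generalizing μ s with
  | zero =>
    have hs' : 0 < s.re := by simpa using hs
    obtain ⟨C, hC, h⟩ := exists_integral_extInv_le μ (τ := s.re) hs' hu
    refine ⟨C, hC, fun f hf => ?_⟩
    simp only [iteratedDeriv_zero]
    exact ⟨integrable_extInv μ hs' f, h s le_rfl le_rfl f hf⟩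
  | succ N ih =>
    obtain ⟨C, hC, h⟩ := ih (μ + 1) (s + 1 / 2) (by
      push_cast at hs
      simp
      linarith)
    obtain ⟨C', hC', h'⟩ := exists_smoothMul_bound (fun x : ℝ => (x : ℂ)) ofRealCLM.contDiff u N
    refine ⟨‖-I * (2 * s + 1)‖ * C + C * (C' * (N + 1)), by positivity, fun f hf => ?_⟩
    obtain ⟨i1, b1⟩ := h f hf
    obtain ⟨i2, b2⟩ := h (mulX (derivT f)) ((tsupport_smoothMul_subset _ _ _).trans
      ((tsupport_derivT_subset f).trans hf))
    have b3 := h' (derivT f) ((tsupport_derivT_subset f).trans hf)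
    rw [iteratedDeriv_extInv_succ]
    have j1 := i1.const_mul (-I * (2 * s + 1))
    have j2 := i2.const_mul (-I)
    refine ⟨j1.add j2, ?_⟩
    calc ∫ x, ‖-I * (2 * s + 1) * iteratedDeriv N (extInv (μ + 1) (s + 1 / 2) f) x
          + -I * iteratedDeriv N (extInv (μ + 1) (s + 1 / 2) (mulX (derivT f))) x‖
        ≤ ∫ x, (‖-I * (2 * s + 1)‖ * ‖iteratedDeriv N (extInv (μ + 1) (s + 1 / 2) f) x‖
          + ‖iteratedDeriv N (extInv (μ + 1) (s + 1 / 2) (mulX (derivT f))) x‖) := by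
          refine integral_mono (j1.add j2).norm ((i1.norm.const_mul _).add i2.norm) fun x => ?_
          refine (norm_add_le _ _).trans ?_
          rw [norm_mul, norm_mul (-I)]
          simp
      _ = ‖-I * (2 * s + 1)‖ * (∫ x, ‖iteratedDeriv N (extInv (μ + 1) (s + 1 / 2) f) x‖)
          + ∫ x, ‖iteratedDeriv N (extInv (μ + 1) (s + 1 / 2) (mulX (derivT f))) x‖ := by
          rw [integral_add (i1.norm.const_mul _) i2.norm, integral_const_mul]
      _ ≤ ‖-I * (2 * s + 1)‖ * (C * cNorm (N + 1) f)
          + C * (C' * ((N + 1) * cNorm (N + 1) f)) := by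
          have a1 := cNorm_mono f (Nat.le_succ N)
          have a2 := cNorm_derivT_le N f
          gcongr
          · exact b1.trans (by gcongr)
          · exact b2.trans (by
              refine mul_le_mul_of_nonneg_left (b3.trans ?_) hC
              gcongr)
      _ = _ := by ring

theorem integrable_iteratedDeriv_extInv (N : ℕ) (μ s : ℂ) (hs : 0 < 2 * s.re + N) (f : Test) :
    Integrable (iteratedDeriv N (extInv μ s f)) := by
  obtain ⟨u, hu, hf⟩ := f.exists_tsupport_subset
  obtain ⟨C, -, h⟩ := exists_iteratedDeriv_extInv_bound N μ s hu hs
  exact (h f hf).1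

theorem differentiableAt_fourier_iteratedDeriv_extInv (N : ℕ) (μ : ℂ) (f : Test) (y : ℝ) {s : ℂ}
    (hs : 0 < 2 * s.re + N) :
    DifferentiableAt ℂ (fun s => fourier (iteratedDeriv N (extInv μ s f)) y) s := by
  induction N generalizing μ s f with
  | zero =>
    simp only [iteratedDeriv_zero]
    exact differentiableAt_fourier_extInv μ f y (Or.inl (by simpa using hs))
  | succ N ih =>
    have hre : 0 < 2 * (s + 1 / 2).re + N := by
      push_cast at hs
      simp
      linarith
    have hlin : DifferentiableAt ℂ (fun s : ℂ => s + 1 / 2) s := by fun_prop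
    have h1 := (ih (μ + 1) f hre).comp s hlin
    have h2 := (ih (μ + 1) (mulX (derivT f)) hre).comp s hlin
    have h3 : DifferentiableAt ℂ (fun s : ℂ => -I * (2 * s + 1)) s := by fun_prop
    refine DifferentiableAt.congr_of_eventuallyEq ((h3.mul h1).add (h2.const_mul (-I))) ?_
    have hopen : IsOpen {z : ℂ | 0 < 2 * (z + 1 / 2).re + N} :=
      isOpen_lt continuous_const (by fun_prop)
    filter_upwards [hopen.mem_nhds hre] with z hz
    rw [iteratedDeriv_extInv_succ, fourier_add, fourier_smul, fourier_smul]
    · rfl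
    · exact (integrable_iteratedDeriv_extInv N _ _ hz f).const_mul _
    · exact (integrable_iteratedDeriv_extInv N _ _ hz _).const_mul _

theorem fourier_deriv {g : ℝ → ℂ} (hg : Differentiable ℝ g) (h1 : Integrable g)
    (h2 : Integrable (deriv g)) (y : ℝ) :
    fourier (deriv g) y = -(2 * Real.pi * I * y) * fourier g y := by
  have e : ∀ (h : ℝ → ℂ), fourier h y = FourierTransform.fourier h (-y) := by
    intro h
    rw [Real.fourier_real_eq_integral_exp_smul, fourier]
    congr 1
    funext x
    rw [smul_eq_mul, mul_comm]
    congr 2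
    push_cast
    ring
  rw [e, e, Real.fourier_deriv h1 hg h2]
  simp only [smul_eq_mul]
  push_cast
  ring

theorem fourier_iteratedDeriv_extInv_succ (N : ℕ) (μ s : ℂ) (hs : 0 < 2 * s.re + N) (f : Test)
    (y : ℝ) : fourier (iteratedDeriv (N + 1) (extInv μ s f)) y
      = -(2 * Real.pi * I * y) * fourier (iteratedDeriv N (extInv μ s f)) y := by
  have h2 := integrable_iteratedDeriv_extInv (N + 1) μ s (by push_cast; linarith) f
  rw [iteratedDeriv_succ] at h2 ⊢
  exact fourier_deriv ((contDiff_extInv μ s f).differentiable_iteratedDeriv N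
    (by exact_mod_cast WithTop.coe_lt_top _))
    (integrable_iteratedDeriv_extInv N μ s hs f) h2 y

/-! ### Analytic continuation -/

theorem fourier_zero (g : ℝ → ℂ) : fourier g 0 = ∫ x, g x := by simp [fourier]

theorem tendsto_extInv_of_decay (μ : ℂ) {s : ℂ} (hs : 0 < 2 * s.re + 1) (f : Test) {l : Filter ℝ}
    (hl : Tendsto (fun x : ℝ => ‖x‖) l atTop) : Tendsto (extInv μ s f) l (𝓝 0) := by
  obtain ⟨u, hu, hf⟩ := f.exists_tsupport_subset
  have h1 : Tendsto (fun x : ℝ => Real.exp (Real.pi * |μ.im| / 2) * (1 + u) ^ (2 * s.re + 1)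
      * cNorm 0 f * (1 + ‖x‖) ^ (-(2 * s.re + 1))) l (𝓝 0) := by
    have := ((tendsto_rpow_neg_atTop hs).comp (tendsto_atTop_add_const_left l 1 hl)).const_mul
      (Real.exp (Real.pi * |μ.im| / 2) * (1 + u) ^ (2 * s.re + 1) * cNorm 0 f)
    simpa using this
  exact squeeze_zero_norm (norm_extInv_le μ hu hs.le hf f.norm_le_cNorm) h1

/-- One integration by parts at frequency zero. -/
theorem two_mul_fourier_extInv_zero (μ : ℂ) {s : ℂ} (hs : 0 < s.re) (f : Test) :
    2 * s * fourier (extInv μ s f) 0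
      = I * fourier (extInv (μ + 1) (s + 1 / 2) (derivT f)) 0 := by
  have hre : 0 < 2 * (s - 1 / 2).re + 1 := by simp; linarith
  have hs' : 0 < (s + 1 / 2).re := by simp; linarith
  have hd := deriv_extInv (μ - 1) (s - 1 / 2) f
  have e : (fun x => I * extInv (μ - 1 + 1) (s - 1 / 2 + 1 / 2) (eulerT (s - 1 / 2) f) x)
      = fun x => (-(2 * s) * I) * extInv μ s f x
        + -1 * extInv (μ + 1) (s + 1 / 2) (derivT f) x := by
    funext x
    rw [sub_add_cancel, sub_add_cancel, eulerT, extInv_add, extInv_smul, extInv_smul, extInv_mulX]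
    linear_combination (extInv (μ + 1) (s + 1 / 2) (derivT f) x) * I_sq
  have i1 := integrable_extInv μ hs f
  have i2 := integrable_extInv (μ + 1) hs' (derivT f)
  have i3 := (i1.const_mul (-(2 * s) * I)).add (i2.const_mul (-1))
  have key := integral_of_hasDerivAt_of_tendsto
    (fun x => ((contDiff_extInv (μ - 1) (s - 1 / 2) f).differentiable (by simp) x).hasDerivAt)
    (by rw [hd, e]; exact i3)
    (tendsto_extInv_of_decay (μ - 1) hre f (by simpa using tendsto_abs_atBot_atTop))
    (tendsto_extInv_of_decay (μ - 1) hre f (by simpa using tendsto_abs_atTop_atTop))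
  rw [hd, e, integral_add (i1.const_mul _) (i2.const_mul _), integral_const_mul,
    integral_const_mul] at key
  rw [fourier_zero, fourier_zero]
  linear_combination I * key + (2 * s * ∫ x, extInv μ s f x) * I_sq

theorem isOpen_contDomain (y : ℝ) : IsOpen (contDomain y) := by
  by_cases hy : y = 0
  · have e : contDomain y = (fun s : ℂ => -2 * s) ⁻¹' (Set.range ((↑) : ℕ → ℂ))ᶜ := by
      ext s
      simp only [contDomain, Set.mem_ofPred_eq, hy, forall_const, Set.mem_preimage,
        Set.mem_compl_iff, Set.mem_range, not_exists]
      exact ⟨fun h n hn => h n hn.symm, fun h n hn => h n hn.symm⟩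
    rw [e]
    have hcl : IsClosed (Set.range ((↑) : ℕ → ℂ)) :=
      (Complex.isometry_ofReal.isClosedEmbedding.comp Nat.isClosedEmbedding_coe_real).isClosed_range
    exact hcl.isOpen_compl.preimage (by fun_prop)
  · have e : contDomain y = Set.univ := by
      ext s
      simp [contDomain, hy]
    rw [e]
    exact isOpen_univ

theorem isPreconnected_contDomain (y : ℝ) : IsPreconnected (contDomain y) := by
  by_cases hy : y = 0
  · have e : contDomain y = (Set.range fun n : ℕ => -(n : ℂ) / 2)ᶜ := by
      ext s
      simp only [contDomain, Set.mem_ofPred_eq, hy, forall_const, Set.mem_compl_iff,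
        Set.mem_range, not_exists]
      refine forall_congr' fun n => not_congr ⟨fun h => ?_, fun h => ?_⟩
      · rw [← h]; ring
      · rw [← h]; ring
    rw [e]
    exact ((Set.countable_range _).isPathConnected_compl_of_one_lt_rank
      (by rw [Complex.rank_real_complex]; norm_num)).isConnected.isPreconnected
  · have e : contDomain y = Set.univ := by
      ext s
      simp [contDomain, hy]
    rw [e]
    exact isPreconnected_univ

theorem mem_contDomain_of_pos (y : ℝ) {s : ℂ} (hs : 0 < s.re) : s ∈ contDomain y := by
  intro _ n hn
  have := congrArg Complex.re hn
  simp at this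
  have h2 : (0 : ℝ) ≤ n := Nat.cast_nonneg n
  linarith

theorem eqOn_contDomain {y : ℝ} {Φ Ψ : ℂ → ℂ} (hΦ : DifferentiableOn ℂ Φ (contDomain y))
    (hΨ : DifferentiableOn ℂ Ψ (contDomain y)) (h : ∀ s : ℂ, 0 < s.re → Φ s = Ψ s) :
    Set.EqOn Φ Ψ (contDomain y) := by
  have h1 : (0 : ℝ) < (1 : ℂ).re := by simp
  refine (hΦ.analyticOnNhd (isOpen_contDomain y)).eqOn_of_preconnected_of_eventuallyEq
    (hΨ.analyticOnNhd (isOpen_contDomain y)) (isPreconnected_contDomain y)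
    (mem_contDomain_of_pos y h1) ?_
  filter_upwards [(isOpen_lt continuous_const continuous_re).mem_nhds h1] with s hs using h s hs

/-- Functions that are holomorphic on an exhausting sequence of half planes and agree on the
overlaps can be glued. -/
theorem exists_glue {Ω : Set ℂ} (hΩ : IsOpen Ω) (Φ : ℕ → ℂ → ℂ)
    (hd : ∀ N : ℕ, ∀ s ∈ Ω, 0 < 2 * s.re + N → DifferentiableAt ℂ (Φ N) s)
    (hs : ∀ N : ℕ, ∀ s ∈ Ω, 0 < 2 * s.re + N → Φ (N + 1) s = Φ N s) :
    ∃ Ψ : ℂ → ℂ, DifferentiableOn ℂ Ψ Ω ∧ ∀ N : ℕ, ∀ s ∈ Ω, 0 < 2 * s.re + N → Ψ s = Φ N s := by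
  have hmono : ∀ N k, ∀ s ∈ Ω, 0 < 2 * s.re + (N : ℕ) → Φ (N + k) s = Φ N s := by
    intro N k s hsΩ hN
    induction k with
    | zero => rfl
    | succ k ih =>
      rw [← add_assoc, hs (N + k) s hsΩ (by
        push_cast
        linarith [(Nat.cast_nonneg k : (0 : ℝ) ≤ k)]),
        ih]
  set m : ℂ → ℕ := fun s => ⌊-2 * s.re⌋₊ + 1 with hm
  have hm' : ∀ s : ℂ, 0 < 2 * s.re + m s := by
    intro s
    have := Nat.lt_floor_add_one (-2 * s.re)
    simp only [hm]
    push_cast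
    linarith
  have key : ∀ N : ℕ, ∀ s ∈ Ω, 0 < 2 * s.re + (N : ℕ) → Φ (m s) s = Φ N s := by
    intro N s hsΩ hN
    rcases le_total N (m s) with h | h
    · obtain ⟨k, hk⟩ := Nat.exists_eq_add_of_le h
      rw [hk]
      exact hmono N k s hsΩ hN
    · obtain ⟨k, hk⟩ := Nat.exists_eq_add_of_le h
      rw [hk]
      exact (hmono (m s) k s hsΩ (hm' s)).symm
  refine ⟨fun s => Φ (m s) s, fun s hsΩ => ?_, key⟩
  refine DifferentiableAt.differentiableWithinAt ?_
  refine (hd (m s) s hsΩ (hm' s)).congr_of_eventuallyEq ?_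
  have ho : IsOpen {z : ℂ | 0 < 2 * z.re + m s} := isOpen_lt continuous_const (by fun_prop)
  filter_upwards [hΩ.mem_nhds hsΩ, ho.mem_nhds (hm' s)] with z h1 h2 using key (m s) z h1 h2

/-- The continuation at a nonzero frequency, on the half plane `0 < 2 Re s + N`. -/
def freqPiece (N : ℕ) (μ : ℂ) (f : Test) (y : ℝ) (s : ℂ) : ℂ :=
  ((-(2 * Real.pi * I * y))⁻¹) ^ N * fourier (iteratedDeriv N (extInv μ s f)) y

/-- The continuation at frequency zero, on the half plane `0 < 2 Re s + N`, after `N` integrations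
by parts. Each of them contributes a factor `2 s + j` to the denominator. -/
def zeroPiece (N : ℕ) (μ : ℂ) (f : Test) (s : ℂ) : ℂ :=
  I ^ N * fourier (extInv (μ + N) (s + N / 2) (derivT^[N] f)) 0
    / ∏ j ∈ Finset.range N, (2 * s + j)

theorem prod_ne_zero_of_mem {s : ℂ} (hs : s ∈ contDomain 0) (N : ℕ) :
    ∏ j ∈ Finset.range N, (2 * s + j) ≠ 0 := by
  refine Finset.prod_ne_zero_iff.2 fun j _ h => hs rfl j ?_
  linear_combination -h

theorem isContinuation_freq (μ : ℂ) (f : Test) {y : ℝ} (hy : y ≠ 0) :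
    ∃ Φ, IsContinuation μ f y Φ ∧
      ∀ N : ℕ, ∀ s : ℂ, 0 < 2 * s.re + N → Φ s = freqPiece N μ f y s := by
  have hy' : -(2 * Real.pi * I * y : ℂ) ≠ 0 := by
    simp [hy, Real.pi_ne_zero]
  have hm : ∀ s, s ∈ contDomain y := fun s h => absurd h hy
  obtain ⟨Ψ, h1, h2⟩ := exists_glue (isOpen_contDomain y) (fun N => freqPiece N μ f y)
    (fun N s _ h => (differentiableAt_fourier_iteratedDeriv_extInv N μ f y h).const_mul _)
    (fun N s _ h => by
      rw [freqPiece, freqPiece, fourier_iteratedDeriv_extInv_succ N μ s h f y, pow_succ,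
        mul_assoc, inv_mul_cancel_left₀ hy'])
  refine ⟨Ψ, ⟨h1, fun s hs => ?_⟩, fun N s hs => h2 N s (hm s) hs⟩
  rw [h2 0 s (hm s) (by simpa using hs), freqPiece, ← fourier_extInv]
  simp

theorem isContinuation_zero (μ : ℂ) (f : Test) :
    ∃ Φ, IsContinuation μ f 0 Φ ∧
      ∀ N : ℕ, ∀ s ∈ contDomain 0, 0 < 2 * s.re + N → Φ s = zeroPiece N μ f s := by
  obtain ⟨Ψ, h1, h2⟩ := exists_glue (isOpen_contDomain 0) (fun N => zeroPiece N μ f)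
    (fun N s hs h => by
      refine DifferentiableAt.div (DifferentiableAt.const_mul ?_ _) ?_ (prod_ne_zero_of_mem hs N)
      · have hN : 0 < (s + N / 2).re := by
          simp
          linarith
        exact DifferentiableAt.comp s
          (g := fun z => fourier (extInv (μ + N) z (derivT^[N] f)) 0) (f := fun s : ℂ => s + N / 2)
          (differentiableAt_fourier_extInv (μ + N) (derivT^[N] f) 0 (Or.inl hN)) (by fun_prop)
      · exact DifferentiableAt.fun_finsetProd fun j _ => by fun_prop)
    (fun N s hs h => by
      have h0 := prod_ne_zero_of_mem hs (N + 1)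
      have h3 := two_mul_fourier_extInv_zero (μ + N) (s := s + N / 2) (by simp; linarith)
        (derivT^[N] f)
      rw [Finset.prod_range_succ] at h0
      obtain ⟨h4, h5⟩ := mul_ne_zero_iff.1 h0
      rw [zeroPiece, zeroPiece, Finset.prod_range_succ, Function.iterate_succ_apply',
        div_eq_div_iff h0 h4, pow_succ]
      push_cast
      rw [show μ + ((N : ℂ) + 1) = μ + N + 1 by ring,
        show s + ((N : ℂ) + 1) / 2 = s + N / 2 + 1 / 2 by ring]
      linear_combination (-(I ^ N * ∏ j ∈ Finset.range N, (2 * s + (j : ℂ)))) * h3)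
  refine ⟨Ψ, ⟨h1, fun s hs => ?_⟩, h2⟩
  rw [h2 0 s (mem_contDomain_of_pos 0 hs) (by simpa using hs), zeroPiece, ← fourier_extInv]
  simp

theorem exists_isContinuation (μ : ℂ) (f : Test) (y : ℝ) : ∃ Φ, IsContinuation μ f y Φ := by
  by_cases hy : y = 0
  · subst hy
    exact (isContinuation_zero μ f).imp fun _ h => h.1
  · exact (isContinuation_freq μ f hy).imp fun _ h => h.1

theorem isContinuation_fourierCont (μ : ℂ) (f : Test) (y : ℝ) :
    IsContinuation μ f y (fourierCont μ f y) := by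
  have h := exists_isContinuation μ f y
  rw [fourierCont, dif_pos h]
  exact h.choose_spec

theorem fourierCont_eq {μ : ℂ} {f : Test} {y : ℝ} {Φ : ℂ → ℂ}
    (h : DifferentiableOn ℂ Φ (contDomain y))
    (h' : ∀ s : ℂ, 0 < s.re → Φ s = fourier (extInv μ s f) y) {s : ℂ} (hs : s ∈ contDomain y) :
    fourierCont μ f y s = Φ s := by
  have hc := isContinuation_fourierCont μ f y
  refine eqOn_contDomain hc.1 h (fun s hs => ?_) hs
  rw [hc.2 s hs, h' s hs, fourier_extInv]

theorem fourierCont_freq (N : ℕ) (μ : ℂ) (f : Test) {y : ℝ} (hy : y ≠ 0) {s : ℂ}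
    (hs : 0 < 2 * s.re + N) : fourierCont μ f y s = freqPiece N μ f y s := by
  obtain ⟨Φ, h1, h2⟩ := isContinuation_freq μ f hy
  rw [← h2 N s hs]
  exact fourierCont_eq h1.1 (fun s hs => by rw [h1.2 s hs, fourier_extInv])
    (fun h => absurd h hy)

theorem fourierCont_zeroPiece (N : ℕ) (μ : ℂ) (f : Test) {s : ℂ} (hm : s ∈ contDomain 0)
    (hs : 0 < 2 * s.re + N) : fourierCont μ f 0 s = zeroPiece N μ f s := by
  obtain ⟨Φ, h1, h2⟩ := isContinuation_zero μ f
  rw [← h2 N s hm hs]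
  exact fourierCont_eq h1.1 (fun s hs => by rw [h1.2 s hs, fourier_extInv]) hm

theorem fourierCont_of_pos (μ : ℂ) (f : Test) (y : ℝ) {s : ℂ} (hs : 0 < s.re) :
    fourierCont μ f y s = fourier (extInv μ s f) y := by
  rw [(isContinuation_fourierCont μ f y).2 s hs, fourier_extInv]

theorem fourierCont_of_notMem (μ : ℂ) (f : Test) (hf : (0 : ℝ) ∉ tsupport f) (y : ℝ) {s : ℂ}
    (hs : s ∈ contDomain y) : fourierCont μ f y s = fourier (extInv μ s f) y :=
  fourierCont_eq (Φ := fun s => fourier (extInv μ s f) y)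
    (fun _ _ => (differentiableAt_fourier_extInv μ f y (Or.inr hf)).differentiableWithinAt)
    (fun _ _ => rfl) hs

theorem fourier_extInv_add (μ : ℂ) {s : ℂ} (hs : 0 < s.re) (f g : Test) (y : ℝ) :
    fourier (extInv μ s (f + g : Test)) y
      = fourier (extInv μ s f) y + fourier (extInv μ s g) y := by
  rw [extInv_add, fourier_add (integrable_extInv μ hs f) (integrable_extInv μ hs g)]

theorem fourier_extInv_smul (μ s c : ℂ) (f : Test) (y : ℝ) :
    fourier (extInv μ s (c • f : Test)) y = c * fourier (extInv μ s f) y := by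
  rw [extInv_smul, fourier_smul]

theorem fourierCont_add (μ : ℂ) (f g : Test) (y : ℝ) {s : ℂ} (hs : s ∈ contDomain y) :
    fourierCont μ (f + g) y s = fourierCont μ f y s + fourierCont μ g y s := by
  refine fourierCont_eq (Φ := fun s => fourierCont μ f y s + fourierCont μ g y s)
    ((isContinuation_fourierCont μ f y).1.add (isContinuation_fourierCont μ g y).1)
    (fun s hs => ?_) hs
  rw [fourierCont_of_pos μ f y hs, fourierCont_of_pos μ g y hs, fourier_extInv_add μ hs]

theorem fourierCont_smul (μ c : ℂ) (f : Test) (y : ℝ) {s : ℂ} (hs : s ∈ contDomain y) :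
    fourierCont μ (c • f) y s = c * fourierCont μ f y s := by
  refine fourierCont_eq (Φ := fun s => c * fourierCont μ f y s)
    ((isContinuation_fourierCont μ f y).1.const_mul c) (fun s hs => ?_) hs
  rw [fourierCont_of_pos μ f y hs, fourier_extInv_smul]

/-- The continuation at frequency zero kills `u D_s f`, as the twisted inversion of this function is
minus the derivative of the twisted inversion of `f`. -/
theorem fourierCont_mulX_eulerT (μ : ℂ) (f : Test) {s : ℂ} (hs : s ∈ contDomain 0) :
    -(2 * s + 1) * fourierCont μ (mulX f) 0 s
      - fourierCont μ (mulX (mulX (derivT f))) 0 s = 0 := by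
  have d1 := (isContinuation_fourierCont μ (mulX f) 0).1
  have d2 := (isContinuation_fourierCont μ (mulX (mulX (derivT f))) 0).1
  have d3 : DifferentiableOn ℂ (fun s : ℂ => -(2 * s + 1)) (contDomain 0) := by fun_prop
  refine eqOn_contDomain (y := 0) (Φ := fun s => -(2 * s + 1) * fourierCont μ (mulX f) 0 s
      - fourierCont μ (mulX (mulX (derivT f))) 0 s) (Ψ := fun _ => 0)
    ((d3.mul d1).sub d2) (differentiableOn_const 0) (fun z hz => ?_) hs
  have hz1 : 0 < 2 * z.re + (0 : ℕ) := by simpa using hz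
  have hz' : 0 < (z + 1 / 2).re := by simp; linarith
  have h := fourier_iteratedDeriv_extInv_succ 0 μ z hz1 f 0
  rw [iteratedDeriv_extInv_succ, fourier_add, fourier_smul, fourier_smul] at h
  · simp only [iteratedDeriv_zero] at h
    rw [fourierCont_of_pos _ _ _ hz, fourierCont_of_pos _ _ _ hz, extInv_mulX, extInv_mulX,
      fourier_smul, fourier_smul]
    simp only [ofReal_zero, mul_zero, neg_zero, zero_mul] at h
    linear_combination -h
  · simp only [iteratedDeriv_zero]
    exact (integrable_extInv _ hz' _).const_mul _
  · simp only [iteratedDeriv_zero]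
    exact (integrable_extInv _ hz' _).const_mul _

/-- Homogeneity of the continuation at frequency zero. -/
theorem fourierCont_mulX_derivT (μ : ℂ) (f : Test) {s : ℂ} (hs : s ∈ contDomain 0) :
    fourierCont μ (mulX (derivT f)) 0 s = -(2 * s) * fourierCont μ f 0 s := by
  have d1 := (isContinuation_fourierCont μ f 0).1
  have d3 : DifferentiableOn ℂ (fun s : ℂ => -(2 * s)) (contDomain 0) := by fun_prop
  refine fourierCont_eq (Φ := fun s => -(2 * s) * fourierCont μ f 0 s) (d3.mul d1)
    (fun z hz => ?_) hs
  rw [fourierCont_of_pos _ _ _ hz, extInv_mulX, fourier_smul]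
  linear_combination -(two_mul_fourier_extInv_zero μ hz f)

/-! ### The twisted Fourier transform -/

/-- The coefficient of `δ^{(n)}` in the polar part at `-n/2` of the continuation at frequency
zero. -/
def polarCoeff (μ : ℂ) (n : ℕ) : ℂ := I ^ n
  * (2 * Complex.cos (Real.pi * (n + μ) / 2) / n.factorial)

theorem tendsto_extInv_neg_half (μ : ℂ) (f : Test) (ε : ℝ) (hε : ε = 1 ∨ ε = -1) :
    Tendsto (extInv μ (-1 / 2) f) (if ε = 1 then atTop else atBot)
      (𝓝 (cexp (-ε * Real.pi * I * μ / 2) * f 0)) := by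
  have hinv : ∀ l : Filter ℝ, Tendsto (fun x : ℝ => x⁻¹) l (𝓝 0) →
      Tendsto (fun x : ℝ => cexp (-ε * Real.pi * I * μ / 2) * f (-1 / x)) l
        (𝓝 (cexp (-ε * Real.pi * I * μ / 2) * f 0)) := by
    intro l h
    refine Tendsto.const_mul _ ?_
    have h1 : Tendsto (fun x : ℝ => -1 / x) l (𝓝 0) := by
      simpa [div_eq_mul_inv] using h.neg
    exact (f.smooth.continuous.tendsto 0).comp h1
  have hx : ∀ x : ℝ, Real.sign x = ε → x ≠ 0 →
      extInv μ (-1 / 2) f x = cexp (-ε * Real.pi * I * μ / 2) * f (-1 / x) := by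
    intro x h1 h2
    rw [extInv_of_ne _ _ _ h2, invFun, Jfac, h1]
    norm_num
  rcases hε with rfl | rfl
  · rw [if_pos rfl]
    refine (hinv _ tendsto_inv_atTop_zero).congr' ?_
    filter_upwards [eventually_gt_atTop 0] with x h
    rw [hx x (Real.sign_of_pos h) h.ne']
  · rw [if_neg (by norm_num)]
    refine (hinv _ tendsto_inv_atBot_zero).congr' ?_
    filter_upwards [eventually_lt_atBot 0] with x h
    rw [hx x (Real.sign_of_neg h) h.ne]

/-- At `s = 1/2` the twisted inversion of a derivative is a total derivative, so its integral is
given by boundary values at infinity, which are multiples of `f 0`. -/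
theorem fourier_extInv_half (μ : ℂ) (f : Test) :
    fourier (extInv μ (1 / 2) (derivT f)) 0
      = (cexp (-(Real.pi * I * μ / 2)) - cexp (Real.pi * I * μ / 2)) * f 0 := by
  have hd : deriv (extInv (μ - 2) (-1 / 2) f) = fun x => -extInv μ (1 / 2) (derivT f) x := by
    rw [deriv_extInv]
    funext x
    have : eulerT (-1 / 2) f = (-1 : ℂ) • mulX (derivT f) := by
      rw [eulerT]
      norm_num
    rw [this, extInv_smul, extInv_mulX]
    norm_num
    rw [show μ - 2 + 1 + 1 = μ by ring]
    linear_combination (extInv μ (1 / 2) (derivT f) x) * I_sq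
  have hi := integrable_extInv μ (s := 1 / 2) (by norm_num) (derivT f)
  have h1 := tendsto_extInv_neg_half (μ - 2) f 1 (Or.inl rfl)
  have h2 := tendsto_extInv_neg_half (μ - 2) f (-1) (Or.inr rfl)
  rw [if_pos rfl] at h1
  rw [if_neg (by norm_num)] at h2
  have key := integral_of_hasDerivAt_of_tendsto
    (fun x => ((contDiff_extInv (μ - 2) (-1 / 2) f).differentiable (by simp) x).hasDerivAt)
    (by rw [hd]; exact hi.neg) h2 h1
  rw [hd, integral_neg] at key
  rw [fourier_zero]
  have e1 : cexp (-(1 : ℝ) * Real.pi * I * (μ - 2) / 2) = -cexp (-(Real.pi * I * μ / 2)) := by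
    rw [show -((1 : ℝ) : ℂ) * Real.pi * I * (μ - 2) / 2
      = -(Real.pi * I * μ / 2) + Real.pi * I by push_cast; ring, Complex.exp_add,
      Complex.exp_pi_mul_I]
    ring
  have e2 : cexp (-((-1 : ℝ) : ℂ) * Real.pi * I * (μ - 2) / 2) = -cexp (Real.pi * I * μ / 2) := by
    rw [show -((-1 : ℝ) : ℂ) * Real.pi * I * (μ - 2) / 2
      = Real.pi * I * μ / 2 - Real.pi * I by push_cast; ring, Complex.exp_sub,
      Complex.exp_pi_mul_I]
    ring
  rw [e1, e2] at key
  linear_combination -key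

/-- The product `(2 s + n)` times the continuation at frequency zero, near `-n/2`. -/
def polarPiece (n : ℕ) (μ : ℂ) (f : Test) (s : ℂ) : ℂ :=
  I ^ (n + 1) * fourier (extInv (μ + (n + 1 : ℕ)) (s + (n + 1 : ℕ) / 2) (derivT^[n + 1] f)) 0
    / ∏ j ∈ Finset.range n, (2 * s + j)

theorem near_pole {n : ℕ} {ν s : ℂ} (hν : -2 * ν = n) (hs : ‖s - ν‖ < 1 / 2) :
    0 < 2 * s.re + (n + 1 : ℕ) ∧ ∏ j ∈ Finset.range n, (2 * s + j) ≠ 0 ∧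
      (s ≠ ν → s ∈ contDomain 0) := by
  have hj : ∀ j : ℕ, -2 * s = j → j = n ∧ s = ν := by
    intro j h
    have h1 : s - ν = ((n : ℂ) - j) / 2 := by linear_combination (-1 / 2) * h + (1 / 2) * hν
    have h2 : ‖((n : ℂ) - j)‖ < 1 := by
      rw [h1, norm_div] at hs
      simp at hs
      linarith
    have h3 : |(n : ℤ) - j| < 1 := by
      rw [show (n : ℂ) - j = (((n : ℤ) - j : ℤ) : ℂ) by push_cast; ring, Complex.norm_intCast] at h2
      exact_mod_cast h2
    have h4 : j = n := by rw [Int.abs_lt_one_iff] at h3; omega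
    refine ⟨h4, ?_⟩
    rw [h4, sub_self, zero_div] at h1
    exact sub_eq_zero.1 h1
  refine ⟨?_, ?_, fun hne _ j h => hne (hj j h).2⟩
  · have h1 := (abs_re_le_norm (s - ν)).trans_lt hs
    rw [sub_re, abs_lt] at h1
    have h2 := congrArg Complex.re hν
    simp at h2
    push_cast
    linarith [h1.1]
  · refine Finset.prod_ne_zero_iff.2 fun j hjn h => ?_
    have := (hj j (by linear_combination -h)).1
    rw [Finset.mem_range] at hjn
    omega

theorem polarPiece_eq {n : ℕ} {μ ν s : ℂ} (f : Test) (hν : -2 * ν = n) (hs : ‖s - ν‖ < 1 / 2)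
    (hne : s ≠ ν) : fourierCont μ f 0 s = polarPiece n μ f s / (2 * s + n) := by
  obtain ⟨h1, h2, h3⟩ := near_pole hν hs
  rw [fourierCont_zeroPiece (n + 1) μ f (h3 hne) h1, zeroPiece, polarPiece,
    Finset.prod_range_succ, div_div]

theorem differentiableAt_polarPiece {n : ℕ} {μ ν s : ℂ} (f : Test) (hν : -2 * ν = n)
    (hs : ‖s - ν‖ < 1 / 2) : DifferentiableAt ℂ (polarPiece n μ f) s := by
  obtain ⟨h1, h2, -⟩ := near_pole hν hs
  refine DifferentiableAt.div (DifferentiableAt.const_mul ?_ _) ?_ h2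
  · have hN : 0 < (s + (n + 1 : ℕ) / 2).re := by
      push_cast at h1
      simp
      linarith
    exact DifferentiableAt.comp s
      (g := fun z => fourier (extInv (μ + (n + 1 : ℕ)) z (derivT^[n + 1] f)) 0)
      (f := fun s : ℂ => s + (n + 1 : ℕ) / 2)
      (differentiableAt_fourier_extInv _ (derivT^[n + 1] f) 0 (Or.inl hN)) (by fun_prop)
  · exact DifferentiableAt.fun_finsetProd fun j _ => by fun_prop

theorem prod_range_sub (n : ℕ) :
    ∏ j ∈ Finset.range n, (-(n : ℂ) + j) = (-1) ^ n * n.factorial := by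
  have h : ∀ j ∈ Finset.range n, (-(n : ℂ) + j) = -1 * ((n - j : ℕ) : ℂ) := by
    intro j hj
    rw [Nat.cast_sub (Finset.mem_range.1 hj).le]
    ring
  rw [Finset.prod_congr rfl h, Finset.prod_mul_distrib, Finset.prod_const, Finset.card_range]
  congr 1
  have h2 := Finset.prod_range_reflect (fun j => ((j + 1 : ℕ) : ℂ)) n
  rw [← Finset.prod_range_add_one_eq_factorial, Nat.cast_prod, ← h2]
  refine Finset.prod_congr rfl fun j hj => ?_
  congr 1
  have := Finset.mem_range.1 hj
  omega

/-- The coefficient of `1 / (2 s + n)` in the continuation at frequency zero. At `-n/2` the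
integral in `polarPiece` is the one evaluated in `fourier_extInv_half`. -/
theorem polarPiece_self {n : ℕ} {μ ν : ℂ} (f : Test) (hν : -2 * ν = n) :
    polarPiece n μ f ν = polarCoeff μ n * deltaR n f := by
  have e1 : ν + (n + 1 : ℕ) / 2 = 1 / 2 := by
    push_cast
    linear_combination (-1 / 2) * hν
  have e2 : ∀ j ∈ Finset.range n, (2 * ν + (j : ℂ)) = -n + j := fun j _ => by
    linear_combination -hν
  have e3 : (derivT^[n] f) 0 = iteratedDeriv n f 0 := by rw [derivT_iterate]
  rw [polarPiece, e1, Finset.prod_congr rfl e2, prod_range_sub, Function.iterate_succ_apply',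
    fourier_extInv_half, e3, polarCoeff, deltaR, Complex.cos]
  have hf : (n.factorial : ℂ) ≠ 0 := by exact_mod_cast n.factorial_ne_zero
  have e4 : cexp (-(Real.pi * I * (μ + (n + 1 : ℕ)) / 2))
      = -I * cexp (-(Real.pi * (n + μ) / 2) * I) := by
    rw [show -(Real.pi * I * (μ + (n + 1 : ℕ)) / 2)
      = -(Real.pi / 2 * I) + -(Real.pi * (n + μ) / 2) * I by push_cast; ring, Complex.exp_add,
      Complex.exp_neg, Complex.exp_pi_div_two_mul_I, inv_I]
  have e5 : cexp (Real.pi * I * (μ + (n + 1 : ℕ)) / 2)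
      = I * cexp (Real.pi * (n + μ) / 2 * I) := by
    rw [show Real.pi * I * (μ + (n + 1 : ℕ)) / 2
      = Real.pi / 2 * I + Real.pi * (n + μ) / 2 * I by push_cast; ring, Complex.exp_add,
      Complex.exp_pi_div_two_mul_I]
  have e6 : ((-1 : ℂ) ^ n) * (-1) ^ n = 1 := by rw [← mul_pow]; simp
  have e7 : ((-1 : ℂ) ^ n) ≠ 0 := by simp
  rw [e4, e5, pow_succ]
  generalize cexp (Real.pi * (n + μ) / 2 * I) = A
  generalize cexp (-(Real.pi * (n + μ) / 2) * I) = B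
  generalize iteratedDeriv n f 0 = D
  generalize (-1 : ℂ) ^ n = E at *
  field_simp
  linear_combination (-(D * (A + B))) * I_sq - D * (A + B) * e6

/-- At a pole the twisted Fourier transform at frequency zero is the finite part of the
continuation. -/
theorem twistedFourier_polar {n : ℕ} {μ ν : ℂ} (f : Test) (hν : -2 * ν = n) :
    twistedFourier μ ν f 0 = deriv (polarPiece n μ f) ν / 2 ∧
    Tendsto (fun s => fourierCont μ f 0 s - polarCoeff μ n * deltaR n f / (2 * s + n))
      (𝓝[≠] ν) (𝓝 (twistedFourier μ ν f 0)) := by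
  have hd : HasDerivAt (polarPiece n μ f) (deriv (polarPiece n μ f) ν) ν :=
    (differentiableAt_polarPiece f hν (by simp)).hasDerivAt
  have hball : ∀ᶠ s in 𝓝[≠] ν, ‖s - ν‖ < 1 / 2 ∧ s ≠ ν := by
    refine (eventually_nhdsWithin_of_eventually_nhds ?_).and self_mem_nhdsWithin
    have := Metric.ball_mem_nhds ν (show (0 : ℝ) < 1 / 2 by norm_num)
    filter_upwards [this] with s hs
    rwa [← dist_eq_norm]
  have hlim : Tendsto (fun s => fourierCont μ f 0 s - polarCoeff μ n * deltaR n f / (2 * s + n))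
      (𝓝[≠] ν) (𝓝 (deriv (polarPiece n μ f) ν / 2)) := by
    refine (hd.tendsto_slope.div_const 2).congr' ?_
    filter_upwards [hball] with s hs
    rw [polarPiece_eq f hν hs.1 hs.2, ← polarPiece_self f hν, slope_def_field]
    have h1 : s - ν ≠ 0 := sub_ne_zero.2 hs.2
    have h2 : 2 * s + n = 2 * (s - ν) := by linear_combination -hν
    rw [h2]
    field_simp
  have e : twistedFourier μ ν f 0 = deriv (polarPiece n μ f) ν / 2 := by
    have h : (0 : ℝ) = 0 ∧ ∃ n : ℕ, -2 * ν = n := ⟨rfl, n, hν⟩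
    have hn : h.2.choose = n := by
      have h2 : (n : ℂ) = (h.2.choose : ℂ) := hν.symm.trans h.2.choose_spec
      exact_mod_cast h2.symm
    rw [twistedFourier, dif_pos h, hn]
    refine Tendsto.limUnder_eq (hlim.congr fun s => ?_)
    rw [polarCoeff]
    congr 1
    rw [← div_div]
    ring
  exact ⟨e, e ▸ hlim⟩

theorem twistedFourier_of_mem {μ ν : ℂ} (f : Test) {y : ℝ} (h : ν ∈ contDomain y) :
    twistedFourier μ ν f y = fourierCont μ f y ν := by
  rw [twistedFourier, dif_neg]
  rintro ⟨hy, n, hn⟩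
  exact h hy n hn

theorem mem_contDomain_or (ν : ℂ) (y : ℝ) :
    ν ∈ contDomain y ∨ (y = 0 ∧ ∃ n : ℕ, -2 * ν = n) := by
  by_cases hy : y = 0
  · by_cases hn : ∃ n : ℕ, -2 * ν = n
    · exact Or.inr ⟨hy, hn⟩
    · exact Or.inl fun _ n h => hn ⟨n, h⟩
  · exact Or.inl fun h => absurd h hy

theorem eventually_mem_contDomain (ν : ℂ) (y : ℝ) : ∀ᶠ s in 𝓝[≠] ν, s ∈ contDomain y := by
  rcases mem_contDomain_or ν y with h | ⟨rfl, n, hn⟩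
  · exact eventually_nhdsWithin_of_eventually_nhds ((isOpen_contDomain y).mem_nhds h)
  · have := Metric.ball_mem_nhds ν (show (0 : ℝ) < 1 / 2 by norm_num)
    filter_upwards [eventually_nhdsWithin_of_eventually_nhds this,
      self_mem_nhdsWithin] with s hs hs'
    exact (near_pole hn (by rwa [← dist_eq_norm])).2.2 hs'

theorem iteratedDeriv_test_add (n : ℕ) (f g : Test) (x : ℝ) :
    iteratedDeriv n (f + g : Test) x = iteratedDeriv n f x + iteratedDeriv n g x :=
  iteratedDeriv_fun_add (f.smooth.contDiffAt.of_le (by exact_mod_cast le_top))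
    (g.smooth.contDiffAt.of_le (by exact_mod_cast le_top))

theorem iteratedDeriv_test_smul (n : ℕ) (c : ℂ) (f : Test) (x : ℝ) :
    iteratedDeriv n (c • f : Test) x = c * iteratedDeriv n f x :=
  iteratedDeriv_const_mul_field c f

theorem deltaR_add (n : ℕ) (f g : Test) : deltaR n (f + g : Test) = deltaR n f + deltaR n g := by
  rw [deltaR, deltaR, deltaR, iteratedDeriv_test_add, mul_add]

theorem deltaR_smul (n : ℕ) (c : ℂ) (f : Test) : deltaR n (c • f : Test) = c * deltaR n f := by
  rw [deltaR, deltaR, iteratedDeriv_test_smul]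
  ring

theorem twistedFourier_add (μ ν : ℂ) (f g : Test) (y : ℝ) :
    twistedFourier μ ν (f + g) y = twistedFourier μ ν f y + twistedFourier μ ν g y := by
  rcases mem_contDomain_or ν y with h | ⟨rfl, n, hn⟩
  · rw [twistedFourier_of_mem _ h, twistedFourier_of_mem _ h, twistedFourier_of_mem _ h,
      fourierCont_add μ f g y h]
  · refine tendsto_nhds_unique (twistedFourier_polar (f + g) hn).2
      (((twistedFourier_polar f hn).2.add (twistedFourier_polar g hn).2).congr' ?_)
    filter_upwards [eventually_mem_contDomain ν 0] with s hs
    rw [fourierCont_add μ f g 0 hs, deltaR_add]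
    ring

theorem twistedFourier_smul (μ ν c : ℂ) (f : Test) (y : ℝ) :
    twistedFourier μ ν (c • f) y = c * twistedFourier μ ν f y := by
  rcases mem_contDomain_or ν y with h | ⟨rfl, n, hn⟩
  · rw [twistedFourier_of_mem _ h, twistedFourier_of_mem _ h, fourierCont_smul μ c f y h]
  · refine tendsto_nhds_unique (twistedFourier_polar (c • f) hn).2
      (((twistedFourier_polar f hn).2.const_mul c).congr' ?_)
    filter_upwards [eventually_mem_contDomain ν 0] with s hs
    rw [fourierCont_smul μ c f 0 hs, deltaR_smul]
    ring

theorem deltaR_of_notMem (n : ℕ) (f : Test) (hf : (0 : ℝ) ∉ tsupport f) : deltaR n f = 0 := by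
  rw [deltaR, image_eq_zero_of_notMem_tsupport fun h => hf (tsupport_iteratedDeriv_subset _ n h),
    mul_zero]

/-- Away from the origin no regularization is needed. -/
theorem twistedFourier_of_notMem (μ ν : ℂ) (f : Test) (hf : (0 : ℝ) ∉ tsupport f) (y : ℝ) :
    twistedFourier μ ν f y = fourier (testInv μ ν f hf) y := by
  rw [← extInv_eq_testInv]
  rcases mem_contDomain_or ν y with h | ⟨rfl, n, hn⟩
  · rw [twistedFourier_of_mem _ h, fourierCont_of_notMem μ f hf y h]
  · refine tendsto_nhds_unique (twistedFourier_polar f hn).2 ?_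
    have h1 : Tendsto (fun s => fourier (extInv μ s f) 0) (𝓝[≠] ν)
        (𝓝 (fourier (extInv μ ν f) 0)) :=
      (differentiableAt_fourier_extInv μ f 0 (Or.inr hf)).continuousAt.tendsto.mono_left
        nhdsWithin_le_nhds
    refine h1.congr' ?_
    filter_upwards [eventually_mem_contDomain ν 0] with s hs
    rw [fourierCont_of_notMem μ f hf 0 hs, deltaR_of_notMem n f hf]
    simp

theorem deltaR_mulX (n : ℕ) (f : Test) : deltaR n (mulX f) = -n * deltaR (n - 1) f := by
  have h : ∀ (n : ℕ) (x : ℝ), iteratedDeriv n (mulX f) x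
      = x * iteratedDeriv n f x + n * iteratedDeriv (n - 1) f x := by
    intro n
    induction n with
    | zero => intro x; simp
    | succ n ih =>
      intro x
      rw [iteratedDeriv_succ, show iteratedDeriv n (mulX f) = fun x : ℝ =>
        x * iteratedDeriv n f x + n * iteratedDeriv (n - 1) f x from funext ih]
      have d : ∀ m : ℕ, HasDerivAt (iteratedDeriv m f) (iteratedDeriv (m + 1) f x) x := by
        intro m
        rw [iteratedDeriv_succ]
        exact (f.smooth.differentiable_iteratedDeriv m
          (by exact_mod_cast WithTop.coe_lt_top _) x).hasDerivAt
      have h1 := ((hasDerivAt_id x).ofReal_comp.mul (d n)).add ((d (n - 1)).const_mul (n : ℂ))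
      refine h1.deriv.trans ?_
      rcases n with _ | n
      · simp
        ring
      · simp
        ring
  rw [deltaR, deltaR, h]
  rcases n with _ | n
  · simp
  · simp [pow_succ]
    ring

theorem two_mul_add_ne {n : ℕ} {ν s : ℂ} (hν : -2 * ν = n) (h : s ≠ ν) : 2 * s + n ≠ 0 := by
  intro h0
  apply h
  linear_combination (1 / 2) * h0 + (1 / 2) * hν

theorem tendsto_two_mul_add {n : ℕ} {ν : ℂ} (hν : -2 * ν = n) :
    Tendsto (fun s : ℂ => 2 * s + n) (𝓝[≠] ν) (𝓝 0) := by
  have : Continuous fun s : ℂ => 2 * s + n := by fun_prop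
  have h := this.tendsto ν
  rw [show 2 * ν + n = 0 by linear_combination -hν] at h
  exact h.mono_left nhdsWithin_le_nhds

theorem tendsto_two_mul_add_mul {n : ℕ} {μ ν : ℂ} (f : Test) (hν : -2 * ν = n) :
    Tendsto (fun s => (2 * s + n) * fourierCont μ f 0 s) (𝓝[≠] ν)
      (𝓝 (polarCoeff μ n * deltaR n f)) := by
  have h := ((tendsto_two_mul_add hν).mul (twistedFourier_polar f hν (μ := μ)).2).add_const
    (polarCoeff μ n * deltaR n f)
  rw [zero_mul, zero_add] at h
  refine h.congr' ?_
  filter_upwards [self_mem_nhdsWithin] with s hs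
  have := two_mul_add_ne hν hs
  field_simp
  ring

theorem deltaR_eulerT (n : ℕ) (ν : ℂ) (f : Test) :
    deltaR n (mulX (eulerT ν f)) = n * (2 * ν + n) * deltaR (n - 1) f := by
  rw [deltaR_mulX, eulerT, deltaR_add, deltaR_smul, deltaR_smul, deltaR_mulX]
  rcases n with _ | n
  · simp
  · rcases n with _ | n
    · simp
      ring
    · have e : deltaR n (derivT f) = -deltaR (n + 1) f := by
        rw [deltaR, deltaR, iteratedDeriv_succ']
        rw [pow_succ]
        change _ = -((-1) ^ n * -1 * iteratedDeriv n (derivT f) 0)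
        ring
      simp only [Nat.add_sub_cancel]
      rw [e]
      push_cast
      ring

/-- At a pole the finite part does not kill `u D_ν f`: the difference of `D_s` and `D_ν` is a
multiple of `s - ν`, which meets the pole. -/
theorem twistedFourier_mulX_eulerT_polar {n : ℕ} {μ ν : ℂ} (f : Test) (hν : -2 * ν = n) :
    twistedFourier μ ν (mulX (eulerT ν f)) 0 = -n * polarCoeff μ n * deltaR (n - 1) f := by
  refine tendsto_nhds_unique (twistedFourier_polar _ hν).2 ?_
  rw [show -n * polarCoeff μ n * deltaR (n - 1) f = polarCoeff μ n * deltaR n (mulX f) by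
    rw [deltaR_mulX]; ring]
  refine (tendsto_two_mul_add_mul (mulX f) hν).congr' ?_
  filter_upwards [eventually_mem_contDomain ν 0] with s hs
  have e : mulX (eulerT ν f) = -(2 * ν + 1) • mulX f + (-1 : ℂ) • mulX (mulX (derivT f)) := by
    ext x
    simp [eulerT]
    ring
  have h0 : deltaR n (mulX (eulerT ν f)) = 0 := by
    rw [deltaR_eulerT, show 2 * ν + n = 0 by linear_combination -hν]
    ring
  rw [h0, mul_zero, zero_div, sub_zero, e, fourierCont_add _ _ _ _ hs, fourierCont_smul _ _ _ _ hs,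
    fourierCont_smul _ _ _ _ hs]
  linear_combination -(fourierCont_mulX_eulerT μ f hs) - fourierCont μ (mulX f) 0 s * hν

theorem twistedFourier_mulX_eulerT {μ ν : ℂ} (f : Test) (hν : ∀ n : ℕ, -2 * ν ≠ n) :
    twistedFourier μ ν (mulX (eulerT ν f)) 0 = 0 := by
  have hm : ν ∈ contDomain 0 := fun _ => hν
  have e : mulX (eulerT ν f) = -(2 * ν + 1) • mulX f + (-1 : ℂ) • mulX (mulX (derivT f)) := by
    ext x
    simp [eulerT]
    ring
  rw [twistedFourier_of_mem _ hm, e, fourierCont_add _ _ _ _ hm, fourierCont_smul _ _ _ _ hm,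
    fourierCont_smul _ _ _ _ hm]
  linear_combination fourierCont_mulX_eulerT μ f hm

/-- If the polar part vanishes, the finite part is homogeneous. -/
theorem twistedFourier_mulX_derivT_polar {n : ℕ} {μ ν : ℂ} (f : Test) (hν : -2 * ν = n)
    (hR : polarCoeff μ n = 0) :
    twistedFourier μ ν (mulX (derivT f)) 0 = n * twistedFourier μ ν f 0 := by
  have h1 := (twistedFourier_polar (μ := μ) (mulX (derivT f)) hν).2
  have h2 := (twistedFourier_polar (μ := μ) f hν).2
  have h3 := tendsto_two_mul_add_mul (μ := μ) f hν
  simp only [hR, zero_mul, zero_div, sub_zero] at h1 h2 h3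
  refine tendsto_nhds_unique h1 ?_
  have h4 := (h2.const_mul (n : ℂ)).sub h3
  rw [sub_zero] at h4
  refine h4.congr' ?_
  filter_upwards [eventually_mem_contDomain ν 0] with s hs
  rw [fourierCont_mulX_derivT μ f hs]
  ring

/-! ### Continuity of the twisted Fourier transform -/

theorem tsupport_derivT_iterate_subset (n : ℕ) (f : Test) : tsupport (derivT^[n] f)
    ⊆ tsupport f := by
  rw [derivT_iterate]
  exact tsupport_iteratedDeriv_subset _ n

theorem cNorm_zero_derivT_iterate (n : ℕ) (f : Test) : cNorm 0 (derivT^[n] f) ≤ cNorm n f := by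
  rw [derivT_iterate]
  refine (cNorm_le (C := cNorm n f) fun i hi x => ?_).trans (by simp)
  rw [Nat.le_zero.1 hi, iteratedDeriv_zero]
  exact norm_iteratedDeriv_le_cNorm f le_rfl x

/-- Continuity of the twisted Fourier transform at frequency zero. At a pole, the derivative of
`polarPiece` is bounded by Cauchy's estimate on a circle of radius `1/4`. -/
theorem exists_twistedFourier_bound_zero (μ ν : ℂ) {u : ℝ} (hu : 0 < u) :
    ∃ (m : ℕ) (C : ℝ), 0 ≤ C ∧ ∀ f : Test, tsupport f ⊆ Set.Icc (-u) u →
      ‖twistedFourier μ ν f 0‖ ≤ C * cNorm m f := by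
  rcases mem_contDomain_or ν 0 with h | ⟨-, n, hn⟩
  · obtain ⟨N, hN⟩ := exists_nat_gt (-2 * ν.re)
    have hre : 0 < (ν + N / 2).re := by
      simp
      linarith
    obtain ⟨C, hC, hb⟩ := exists_integral_extInv_le (μ + N) (τ := (ν + N / 2).re) hre hu
    refine ⟨N, C * ‖∏ j ∈ Finset.range N, (2 * ν + (j : ℂ))‖⁻¹, by positivity, fun f hf => ?_⟩
    rw [twistedFourier_of_mem _ h, fourierCont_zeroPiece N μ f h (by linarith), zeroPiece, norm_div,
      norm_mul, norm_pow, norm_I, one_pow, one_mul, div_eq_mul_inv, mul_right_comm]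
    gcongr
    refine (norm_fourier_le _ _).trans ((hb _ le_rfl le_rfl _
      ((tsupport_derivT_iterate_subset N f).trans hf)).trans ?_)
    gcongr
    exact cNorm_zero_derivT_iterate N f
  · obtain ⟨C, hC, hb⟩ := exists_integral_extInv_le (μ + (n + 1 : ℕ)) (σ := 1 / 4) (τ := 3 / 4)
      (by norm_num) hu
    have hsph : ∀ z ∈ Metric.sphere ν (1 / 4), ‖z - ν‖ < 1 / 2 := by
      intro z hz
      rw [mem_sphere_iff_norm] at hz
      rw [hz]
      norm_num
    obtain ⟨B, hB⟩ := (isCompact_sphere ν (1 / 4)).exists_bound_of_continuousOn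
      (f := fun s => (∏ j ∈ Finset.range n, (2 * s + (j : ℂ)))⁻¹)
      (ContinuousOn.inv₀ (by fun_prop) fun z hz => (near_pole hn (hsph z hz)).2.1)
    refine ⟨n + 1, C * max B 0 * (1 / 4)⁻¹ / 2, by positivity, fun f hf => ?_⟩
    rw [(twistedFourier_polar f hn).1, norm_div]
    have hd : DiffContOnCl ℂ (polarPiece n μ f) (Metric.ball ν (1 / 4)) := by
      refine DifferentiableOn.diffContOnCl fun z hz => ?_
      refine (differentiableAt_polarPiece f hn ?_).differentiableWithinAt
      rw [closure_ball _ (by norm_num), mem_closedBall_iff_norm] at hz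
      linarith
    have key := Complex.norm_deriv_le_of_forall_mem_sphere_norm_le (by norm_num) hd
      (C := C * cNorm (n + 1) f * max B 0) fun z hz => by
        have hre : |z.re - ν.re| ≤ 1 / 4 := by
          rw [← sub_re]
          refine (abs_re_le_norm _).trans (le_of_eq ?_)
          rwa [mem_sphere_iff_norm] at hz
        rw [abs_le] at hre
        have h2 := congrArg Complex.re hn
        simp at h2
        have h3 : (z + (n + 1 : ℕ) / 2).re = z.re + (n + 1) / 2 := by
          simp
        rw [polarPiece, norm_div, norm_mul, norm_pow, norm_I, one_pow, one_mul, div_eq_mul_inv,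
          ← norm_inv]
        refine mul_le_mul ?_ ((hB z hz).trans (le_max_left _ _)) (norm_nonneg _)
          (mul_nonneg hC (cNorm_nonneg _ _))
        refine (norm_fourier_le _ _).trans ((hb _ ?_ ?_ _
          ((tsupport_derivT_iterate_subset (n + 1) f).trans hf)).trans ?_)
        · rw [h3]; linarith
        · rw [h3]; linarith
        · gcongr
          exact cNorm_zero_derivT_iterate (n + 1) f
    calc ‖deriv (polarPiece n μ f) ν‖ / ‖(2 : ℂ)‖
        ≤ (C * cNorm (n + 1) f * max B 0 / (1 / 4)) / 2 := by
          rw [Complex.norm_ofNat]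
          gcongr
      _ = _ := by ring

/-- Decay of the twisted Fourier transform in the frequency, uniformly on the test functions with
support in a given interval. -/
theorem exists_twistedFourier_bound (N : ℕ) (μ ν : ℂ) {u : ℝ} (hu : 0 < u)
    (hN : 0 < 2 * ν.re + N) :
    ∃ C : ℝ, 0 ≤ C ∧ ∀ f : Test, tsupport f ⊆ Set.Icc (-u) u → ∀ y : ℝ, y ≠ 0 →
      ‖twistedFourier μ ν f y‖ ≤ C * cNorm N f * (|y| ^ N)⁻¹ := by
  obtain ⟨C, hC, hb⟩ := exists_iteratedDeriv_extInv_bound N μ ν hu hN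
  refine ⟨C, hC, fun f hf y hy => ?_⟩
  have hm : ν ∈ contDomain y := fun h => absurd h hy
  rw [twistedFourier_of_mem _ hm, fourierCont_freq N μ f hy hN, freqPiece, norm_mul, mul_comm]
  refine mul_le_mul ((norm_fourier_le _ _).trans (hb f hf).2) ?_ (norm_nonneg _)
    (mul_nonneg hC (cNorm_nonneg _ _))
  rw [norm_pow, norm_inv, norm_neg, norm_mul, norm_mul, norm_mul, norm_I, norm_real, norm_real,
    ← inv_pow, Real.norm_eq_abs, Real.norm_eq_abs, abs_of_pos Real.pi_pos, Complex.norm_ofNat]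
  have hy0 : 0 < |y| := abs_pos.2 hy
  gcongr
  have := Real.pi_gt_three
  nlinarith

/-! ### Partitions -/

/-- A cutoff function equal to `1` on `[-1, 1]`, with support in `[-2, 2]`. -/
def cutoff : Test :=
  mkTest (fun x => ((⟨1, 2, one_pos, one_lt_two⟩ : ContDiffBump (0 : ℝ)) x : ℂ))
    (ofRealCLM.contDiff.comp (ContDiffBump.contDiff _))
    ((ContDiffBump.hasCompactSupport _).comp_left (g := ((↑) : ℝ → ℂ)) ofReal_zero)

theorem cutoff_eq_one {x : ℝ} (hx : |x| ≤ 1) : cutoff x = 1 := by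
  have h : (⟨1, 2, one_pos, one_lt_two⟩ : ContDiffBump (0 : ℝ)) x = 1 :=
    ContDiffBump.one_of_mem_closedBall _ (by simpa using hx)
  change (((⟨1, 2, one_pos, one_lt_two⟩ : ContDiffBump (0 : ℝ)) x : ℝ) : ℂ) = 1
  rw [h, ofReal_one]

theorem cutoff_eq_zero {x : ℝ} (hx : 2 ≤ |x|) : cutoff x = 0 := by
  have h : (⟨1, 2, one_pos, one_lt_two⟩ : ContDiffBump (0 : ℝ)) x = 0 :=
    ContDiffBump.zero_of_le_dist _ (by simpa using hx)
  change (((⟨1, 2, one_pos, one_lt_two⟩ : ContDiffBump (0 : ℝ)) x : ℝ) : ℂ) = 0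
  rw [h, ofReal_zero]

theorem extInv_half_weight (f : ℝ → ℂ) {x : ℝ} (hx : x ≠ 0) :
    extInv 0 (-1 / 2) f x = f (-1 / x) := by
  rw [extInv_of_ne _ _ _ hx, invFun, Jfac]
  norm_num

theorem tsupport_subset_Icc {f : ℝ → ℂ} {u : ℝ} (h : ∀ x, u < |x| → f x = 0) :
    tsupport f ⊆ Set.Icc (-u) u := by
  refine closure_minimal (fun x hx => ?_) isClosed_Icc
  by_contra hx'
  refine hx (h x ?_)
  by_contra h2
  exact hx' (abs_le.1 (not_lt.1 h2))

/-- The cutoff `1 - χ(-1/x)` complementary to `cutoff` under inversion. -/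
def coCutoff : Test :=
  mkTest (fun x => 1 - extInv 0 (-1 / 2) cutoff x) (contDiff_const.sub (contDiff_extInv _ _ _))
    (by
      refine HasCompactSupport.of_support_subset_isCompact (isCompact_Icc (a := (-1 : ℝ)) (b := 1))
        fun x hx => ?_
      by_contra hx'
      refine hx ?_
      have h1 : 1 < |x| := by
        by_contra h2
        exact hx' (abs_le.1 (not_lt.1 h2))
      have hx0 : x ≠ 0 := by
        rintro rfl
        norm_num at h1
      change 1 - extInv 0 (-1 / 2) cutoff x = 0
      rw [extInv_half_weight _ hx0, cutoff_eq_one, sub_self]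
      rw [abs_div, abs_neg, abs_one, div_le_one (by linarith)]
      exact h1.le)

theorem coCutoff_apply {x : ℝ} (hx : x ≠ 0) : coCutoff x = 1 - cutoff (-1 / x) := by
  rw [coCutoff, mkTest_apply, extInv_half_weight _ hx]

theorem coCutoff_zero : coCutoff 0 = 1 := by
  rw [coCutoff, mkTest_apply, extInv_zero, sub_zero]

theorem PS.smooth_chart {μ ν : ℂ} (F : PS μ ν) : ContDiff ℝ ∞ (chart F.1) := contDiff_chart F.2.2

/-- The first half of the standard partition of `F`. -/
def part₁ {μ ν : ℂ} (F : PS μ ν) : Test := smoothMul (chart F.1) (PS.smooth_chart F) cutoff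

/-- The second half of the standard partition of `F`. -/
def part₂ {μ ν : ℂ} (F : PS μ ν) : Test :=
  smoothMul (chart (flip F).1) (PS.smooth_chart (flip F)) coCutoff

theorem chart_flip_iota {μ ν : ℂ} (f : Test) (x : ℝ) :
    chart (flip (iota μ ν f)).1 x = extInv μ ν f x := by
  by_cases hx : x = 0
  · rw [hx, chart_flip_iota_zero, extInv_zero]
  · rw [chart_flip _ hx, chart_iota, extInv_of_ne _ _ _ hx]

/-- An element of `I_{μ,ν}^∞` is determined by its chart, as the big cell is dense. -/
theorem PS.ext_of_chart {μ ν : ℂ} {F G : PS μ ν} (h : ∀ x, chart F.1 x = chart G.1 x) : F = G := by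
  refine PS.ext_chart h ?_
  have h1 : ∀ x, x ≠ 0 → chart (flip F).1 x = chart (flip G).1 x := fun x hx => by
    rw [chart_flip F hx, chart_flip G hx, invFun, invFun, h]
  have h2 : Set.EqOn (chart (flip F).1) (chart (flip G).1) {0}ᶜ := fun x hx => h1 x hx
  have := h2.closure (PS.smooth_chart (flip F)).continuous (PS.smooth_chart (flip G)).continuous
  rw [closure_compl_singleton] at this
  exact this (Set.mem_univ 0)

theorem isPartition_part {μ ν : ℂ} (F : PS μ ν) : IsPartition F (part₁ F, part₂ F) := by
  refine PS.ext_of_chart fun x => ?_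
  rw [chart_add, chart_iota, chart_flip_iota]
  by_cases hx : x = 0
  · rw [hx, extInv_zero, part₁, smoothMul_apply, cutoff_eq_one (by simp)]
    ring
  · have hx' : -1 / x ≠ 0 := div_ne_zero (by norm_num) hx
    have h := invFun_invFun μ ν (chart F.1) hx
    rw [invFun, ← chart_flip F hx'] at h
    rw [extInv_of_ne _ _ _ hx, invFun, part₁, part₂, smoothMul_apply, smoothMul_apply,
      coCutoff_apply hx', show -1 / (-1 / x) = x by field_simp]
    linear_combination (1 - cutoff x) * h

section Partition

variable {μ ν : ℂ} {F : PS μ ν} {f : Test × Test}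

theorem IsPartition.chart_eq (h : IsPartition F f) (x : ℝ) :
    chart F.1 x = f.1 x + extInv μ ν f.2 x := by
  rw [← h, chart_add, chart_iota, chart_flip_iota]

theorem IsPartition.chart_flip_eq (h : IsPartition F f) (x : ℝ) :
    chart (QAD.flip F).1 x = extInv μ ν f.1 x + f.2 x := by
  rw [← h, flip_add, flip_flip, chart_add, chart_iota, chart_flip_iota]

theorem isPartition_iota (f : Test) : IsPartition (iota μ ν f) (f, 0) := by
  refine PS.ext_of_chart fun x => ?_
  rw [chart_add, chart_flip_iota]
  by_cases hx : x = 0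
  · simp [hx, extInv_zero]
  · simp [extInv_of_ne, hx, invFun]

theorem isPartition_flip_iota (f : Test) : IsPartition (QAD.flip (iota μ ν f)) (0, f) := by
  refine PS.ext_of_chart fun x => ?_
  rw [chart_add, chart_iota]
  simp

theorem IsPartition.add {G : PS μ ν} {g : Test × Test} (h : IsPartition F f)
    (h' : IsPartition G g) : IsPartition (F + G) (f + g) := by
  rw [IsPartition] at *
  rw [← h, ← h', Prod.fst_add, Prod.snd_add, iota_add, iota_add, flip_add]
  abel

theorem IsPartition.smul (c : ℂ) (h : IsPartition F f) : IsPartition (c • F) (c • f) := by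
  rw [IsPartition] at *
  rw [← h, Prod.smul_fst, Prod.smul_snd, iota_smul, iota_smul, flip_smul, smul_add]

theorem IsPartition.deltaInf_eq (h : IsPartition F f) (m : ℕ) : deltaInf m F = deltaR m f.2 := by
  rw [QAD.deltaInf_eq, deltaR, deltaR]
  congr 1
  refine Filter.EventuallyEq.iteratedDeriv_eq m ?_
  filter_upwards [extInv_eventually_zero μ ν f.1] with x hx
  rw [h.chart_flip_eq, hx, zero_add]

theorem fourier_congr_of_ne {g h : ℝ → ℂ} (e : ∀ x, x ≠ 0 → g x = h x) (y : ℝ) :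
    fourier g y = fourier h y := by
  refine integral_congr_ae ?_
  filter_upwards [Measure.ae_ne volume (0 : ℝ)] with x hx
  rw [e x hx]

/-- The functional `𝓕(f₁)(l) + 𝓕_{μ,ν,∞}(f₂)(l)` does not depend on the partition. -/
theorem fourier_add_twistedFourier_eq_zero {f : Test × Test}
    (h : IsPartition (0 : PS μ ν) f) (l : ℝ) : fourier f.1 l + twistedFourier μ ν f.2 l = 0 := by
  have h2 : ∀ x, f.2 x = -extInv μ ν f.1 x := by
    intro x
    have e := h.chart_flip_eq x
    have e0 : chart (QAD.flip (0 : PS μ ν)).1 x = 0 := by simp [chart, flip_apply]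
    rw [e0] at e
    linear_combination -e
  have h0 : (0 : ℝ) ∉ tsupport f.2 := by
    rw [notMem_tsupport_iff_eventuallyEq]
    filter_upwards [extInv_eventually_zero μ ν f.1] with x hx
    rw [h2, hx, neg_zero]
    rfl
  rw [twistedFourier_of_notMem μ ν f.2 h0, ← extInv_eq_testInv]
  have h1 : ∀ x, f.1 x = -1 * extInv μ ν f.2 x := by
    intro x
    have e := h.chart_eq x
    have e0 : chart (0 : PS μ ν).1 x = 0 := rfl
    rw [e0] at e
    linear_combination -e
  rw [show (f.1 : ℝ → ℂ) = fun x => -1 * extInv μ ν f.2 x from funext h1, fourier_smul]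
  ring

theorem Test.integrable (f : Test) : Integrable f :=
  f.smooth.continuous.integrable_of_hasCompactSupport f.hasCompactSupport

theorem fourier_test_add (f g : Test) (y : ℝ) :
    fourier (f + g : Test) y = fourier f y + fourier g y :=
  fourier_add f.integrable g.integrable y

theorem fourier_test_smul (c : ℂ) (f : Test) (y : ℝ) :
    fourier (c • f : Test) y = c * fourier f y := fourier_smul c f y

theorem fourier_add_twistedFourier_congr {f g : Test × Test} (h : IsPartition F f)
    (h' : IsPartition F g) (l : ℝ) : fourier f.1 l + twistedFourier μ ν f.2 l
      = fourier g.1 l + twistedFourier μ ν g.2 l := by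
  have h3 := h.add (h'.smul (-1))
  have e : F + (-1 : ℂ) • F = 0 := by module
  rw [e] at h3
  have := fourier_add_twistedFourier_eq_zero h3 l
  rw [Prod.fst_add, Prod.snd_add, Prod.smul_fst, Prod.smul_snd, fourier_test_add,
    twistedFourier_add, fourier_test_smul, twistedFourier_smul] at this
  linear_combination this

/-! ### Jacquet integrals -/

theorem IsPartition.jacquet_eq (h : IsPartition F f) (l : ℝ) :
    jacquet l F = fourier f.1 l + twistedFourier μ ν f.2 l := by
  rw [jacquet]
  split_ifs with hν hp
  · have hm : ν ∈ contDomain l := mem_contDomain_of_pos l hν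
    rw [twistedFourier_of_mem _ hm, fourierCont_of_pos _ _ _ hν,
      ← fourier_add f.1.integrable (integrable_extInv μ hν f.2), fourier]
    congr 1
    funext x
    rw [← h.chart_eq]
    congr 2
    ring
  · exact fourier_add_twistedFourier_congr hp.choose_spec h l
  · exact absurd ⟨f, h⟩ hp

theorem jacquet_add (l : ℝ) (F G : PS μ ν) : jacquet l (F + G) = jacquet l F + jacquet l G := by
  have h1 := isPartition_part F
  have h2 := isPartition_part G
  rw [(h1.add h2).jacquet_eq, h1.jacquet_eq, h2.jacquet_eq, Prod.fst_add, Prod.snd_add,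
    fourier_test_add, twistedFourier_add]
  ring

theorem jacquet_smul (l : ℝ) (c : ℂ) (F : PS μ ν) : jacquet l (c • F) = c * jacquet l F := by
  have h1 := isPartition_part F
  rw [(h1.smul c).jacquet_eq, h1.jacquet_eq, Prod.smul_fst, Prod.smul_snd, fourier_test_smul,
    twistedFourier_smul]
  ring

theorem deltaInf_add (m : ℕ) (F G : PS μ ν) :
    deltaInf m (F + G) = deltaInf m F + deltaInf m G := by
  have h1 := isPartition_part F
  have h2 := isPartition_part G
  rw [(h1.add h2).deltaInf_eq, h1.deltaInf_eq, h2.deltaInf_eq, Prod.snd_add, deltaR_add]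

theorem deltaInf_smul (m : ℕ) (c : ℂ) (F : PS μ ν) : deltaInf m (c • F) = c * deltaInf m F := by
  have h1 := isPartition_part F
  rw [(h1.smul c).deltaInf_eq, h1.deltaInf_eq, Prod.smul_snd, deltaR_smul]

theorem twistedFourier_zero_test (y : ℝ) : twistedFourier μ ν 0 y = 0 := by
  have := twistedFourier_smul μ ν 0 0 y
  rwa [zero_smul, zero_mul] at this

theorem fourier_zero_test (y : ℝ) : fourier (0 : Test) y = 0 := by
  have := fourier_test_smul 0 0 y
  rwa [zero_smul, zero_mul] at this

theorem deltaR_zero_test (m : ℕ) : deltaR m (0 : Test) = 0 := by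
  have := deltaR_smul m 0 0
  rwa [zero_smul, zero_mul] at this

theorem jacquet_iota (l : ℝ) (f : Test) : jacquet l (iota μ ν f) = fourier f l := by
  rw [(isPartition_iota f).jacquet_eq, twistedFourier_zero_test, add_zero]

theorem jacquet_flip_iota (l : ℝ) (f : Test) :
    jacquet l (QAD.flip (iota μ ν f)) = twistedFourier μ ν f l := by
  rw [(isPartition_flip_iota f).jacquet_eq, fourier_zero_test, zero_add]

theorem deltaInf_iota (m : ℕ) (f : Test) : deltaInf m (iota μ ν f) = 0 := by
  rw [(isPartition_iota f).deltaInf_eq, deltaR_zero_test]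

theorem deltaInf_flip_iota (m : ℕ) (f : Test) :
    deltaInf m (QAD.flip (iota μ ν f)) = deltaR m f := by
  rw [(isPartition_flip_iota f).deltaInf_eq]

theorem fourier_derivT (f : Test) (y : ℝ) :
    fourier (derivT f) y = -(2 * Real.pi * I * y) * fourier f y :=
  fourier_deriv f.differentiable f.integrable (derivT f).integrable y

theorem fourier_iteratedDeriv_test (N : ℕ) (f : Test) (y : ℝ) :
    fourier (iteratedDeriv N f) y = (-(2 * Real.pi * I * y)) ^ N * fourier f y := by
  induction N with
  | zero => simp
  | succ N ih =>
    rw [← derivT_iterate, Function.iterate_succ_apply', fourier_derivT, derivT_iterate, ih]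
    ring

theorem IsPartition.iteratedDeriv_chart (h : IsPartition F f) (N : ℕ) :
    iteratedDeriv N (chart F.1)
      = fun x => iteratedDeriv N f.1 x + iteratedDeriv N (extInv μ ν f.2) x := by
  funext x
  rw [show chart F.1 = (f.1 : ℝ → ℂ) + extInv μ ν f.2 from funext h.chart_eq]
  exact iteratedDeriv_add (f.1.smooth.contDiffAt.of_le (by exact_mod_cast le_top))
    ((contDiff_extInv μ ν f.2).contDiffAt.of_le (by exact_mod_cast le_top))

theorem integrable_iteratedDeriv_test (N : ℕ) (f : Test) : Integrable (iteratedDeriv N f) := by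
  rw [← derivT_iterate]
  exact (derivT^[N] f).integrable

/-- At a nonzero frequency the Jacquet integral is an absolutely convergent integral, after
sufficiently many integrations by parts. -/
theorem jacquet_of_ne (F : PS μ ν) {l : ℝ} (hl : l ≠ 0) {N : ℕ} (hN : 0 < 2 * ν.re + N) :
    jacquet l F = ((-(2 * Real.pi * I * l))⁻¹) ^ N * fourier (iteratedDeriv N (chart F.1)) l := by
  have h := isPartition_part F
  have hm : ν ∈ contDomain l := fun h => absurd h hl
  have hl' : -(2 * Real.pi * I * l : ℂ) ≠ 0 := by
    simp [hl, Real.pi_ne_zero]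
  rw [h.jacquet_eq, h.iteratedDeriv_chart, fourier_add (integrable_iteratedDeriv_test N _)
    (integrable_iteratedDeriv_extInv N μ ν hN _), fourier_iteratedDeriv_test,
    twistedFourier_of_mem _ hm, fourierCont_freq N μ _ hl hN, freqPiece, mul_add, ← mul_assoc,
    ← mul_pow, inv_mul_cancel₀ hl', one_pow, one_mul]

theorem fourier_comp_sub (g : ℝ → ℂ) (t y : ℝ) :
    fourier (fun x => g (x - t)) y = cexp (2 * Real.pi * I * y * t) * fourier g y := by
  rw [fourier, fourier, ← integral_const_mul,
    ← integral_sub_right_eq_self (fun x => cexp (2 * Real.pi * I * y * t)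
      * (g x * cexp (2 * Real.pi * I * x * y))) t]
  congr 1
  funext x
  rw [mul_left_comm, ← Complex.exp_add]
  congr 2
  push_cast
  ring

/-- Translation equivariance of the Jacquet integral at a nonzero frequency. -/
theorem jacquet_rho_of_ne (F : PS μ ν) {l : ℝ} (hl : l ≠ 0) (t : ℝ) :
    jacquet l (rho (tu t) F) = cexp (2 * Real.pi * I * l * t) * jacquet l F := by
  obtain ⟨N, hN⟩ := exists_nat_gt (-2 * ν.re)
  have hN' : 0 < 2 * ν.re + N := by linarith
  rw [jacquet_of_ne _ hl hN', jacquet_of_ne _ hl hN']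
  have e : iteratedDeriv N (chart (rho (tu t) F).1)
      = fun x => iteratedDeriv N (chart F.1) (x - t) := by
    rw [show chart (rho (tu t) F).1 = fun x => chart F.1 (x - t) from funext (chart_rho_tu t F)]
    exact iteratedDeriv_comp_sub_const N (chart F.1) t
  rw [e, fourier_comp_sub]
  ring

/-- In the two charts `ρ(E₊)` acts by `-d/dx` and by `u D_ν`. -/
theorem IsPartition.rhoEp (h : IsPartition F f) :
    IsPartition (rhoEp F) ((-1 : ℂ) • derivT f.1, mulX (eulerT ν f.2)) := by
  refine PS.ext_of_chart fun x => ?_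
  rw [chart_add, chart_iota, chart_flip_iota, chart_rhoEp,
    show chart F.1 = (f.1 : ℝ → ℂ) + extInv μ ν f.2 from funext h.chart_eq,
    deriv_add f.1.differentiable.differentiableAt
      ((contDiff_extInv μ ν f.2).differentiable (by simp) x),
    deriv_extInv, extInv_mulX]
  simp
  ring

theorem deltaInf_rhoEp (m : ℕ) (F : PS μ ν) :
    deltaInf m (rhoEp F) = m * (2 * ν + m) * deltaInf (m - 1) F := by
  have h := isPartition_part F
  rw [h.rhoEp.deltaInf_eq, h.deltaInf_eq, deltaR_eulerT]

theorem jacquet_zero_rhoEp_polar {n : ℕ} (F : PS μ ν) (hν : -2 * ν = n) :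
    jacquet 0 (rhoEp F) = -n * polarCoeff μ n * deltaInf (n - 1) F := by
  have h := isPartition_part F
  rw [h.rhoEp.jacquet_eq, h.deltaInf_eq, twistedFourier_mulX_eulerT_polar _ hν, fourier_test_smul,
    fourier_derivT]
  simp

theorem jacquet_zero_rhoEp (F : PS μ ν) (hν : ∀ n : ℕ, -2 * ν ≠ n) : jacquet 0 (rhoEp F) = 0 := by
  have h := isPartition_part F
  rw [h.rhoEp.jacquet_eq, twistedFourier_mulX_eulerT _ hν, fourier_test_smul, fourier_derivT]
  simp

end Partition

/-! ### Shifted lattices and coefficients of polynomial growth -/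

namespace ShiftedLattice

/-- A point of the shifted lattice. -/
def shift (L : ShiftedLattice) : ℝ := L.exists_eq.choose

/-- The signed distance of neighbouring points of the shifted lattice. -/
def step (L : ShiftedLattice) : ℝ := L.exists_eq.choose_spec.choose

theorem step_ne_zero (L : ShiftedLattice) : L.step ≠ 0 := L.exists_eq.choose_spec.choose_spec.1

theorem mem_iff (L : ShiftedLattice) {x : ℝ} :
    x ∈ L.carrier ↔ ∃ k : ℤ, x = L.shift + L.step * k := by
  have h := L.exists_eq.choose_spec.choose_spec.2
  conv_lhs => rw [h]
  rfl

/-- The parametrization `k ↦ u₁ + u₂ k` of a shifted lattice. -/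
def param (L : ShiftedLattice) : ℤ ≃ L.carrier :=
  Equiv.ofBijective (fun k => ⟨L.shift + L.step * k, L.mem_iff.2 ⟨k, rfl⟩⟩) (by
    constructor
    · intro a b h
      have h1 := congrArg Subtype.val h
      have h2 : L.step * (a - b : ℝ) = 0 := by
        simp only at h1
        linear_combination h1
      rcases mul_eq_zero.1 h2 with h3 | h3
      · exact absurd h3 L.step_ne_zero
      · exact_mod_cast sub_eq_zero.1 h3
    · rintro ⟨x, hx⟩
      obtain ⟨k, hk⟩ := L.mem_iff.1 hx
      exact ⟨k, Subtype.ext hk.symm⟩)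

theorem param_apply (L : ShiftedLattice) (k : ℤ) : (L.param k : ℝ) = L.shift + L.step * k := rfl

theorem mem_dual_iff (L : ShiftedLattice) {t : ℝ} : t ∈ L.dual ↔ ∃ k : ℤ, L.step * t = k := by
  constructor
  · intro h
    obtain ⟨k, hk⟩ := h _ (L.param 1).2 _ (L.param 0).2
    refine ⟨k, ?_⟩
    rw [← hk, param_apply, param_apply]
    push_cast
    ring
  · rintro ⟨k, hk⟩ l₁ h₁ l₂ h₂
    obtain ⟨a, rfl⟩ := L.mem_iff.1 h₁
    obtain ⟨b, rfl⟩ := L.mem_iff.1 h₂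
    refine ⟨(a - b) * k, ?_⟩
    push_cast
    rw [← hk]
    ring

theorem summable_inv_abs_add_sq (L : ShiftedLattice) (s : ℝ) :
    Summable fun l : L.carrier => (|(l : ℝ) + s| ^ 2)⁻¹ := by
  rw [← L.param.summable_iff]
  have h := (Real.summable_one_div_int_add_rpow ((L.shift + s) / L.step) 2).2 (by norm_num)
  refine (h.mul_left (|L.step| ^ 2)⁻¹).congr fun k => ?_
  have h0 := L.step_ne_zero
  simp only [Function.comp, param_apply]
  rw [show (2 : ℝ) = ((2 : ℕ) : ℝ) by norm_num, Real.rpow_natCast, one_div, ← mul_inv, ← mul_pow,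
    ← abs_mul]
  congr 3
  field_simp
  ring

theorem summable_one_add_abs (L : ShiftedLattice) :
    Summable fun l : L.carrier => ((1 + |(l : ℝ)|) ^ 2)⁻¹ := by
  refine ((L.summable_inv_abs_add_sq 0).add (L.summable_inv_abs_add_sq 1)).of_nonneg_of_le
    (fun l => by positivity) fun l => ?_
  rw [add_zero]
  by_cases h : (l : ℝ) = 0
  · simp [h]
  · have h1 : 0 < |(l : ℝ)| := abs_pos.2 h
    have h2 : ((1 + |(l : ℝ)|) ^ 2)⁻¹ ≤ (|(l : ℝ)| ^ 2)⁻¹ := by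
      gcongr
      linarith
    have h3 : 0 ≤ (|(l : ℝ) + 1| ^ 2)⁻¹ := by positivity
    linarith

theorem exists_pos_le_abs (L : ShiftedLattice) :
    ∃ ε : ℝ, 0 < ε ∧ ∀ l ∈ L.carrier, l ≠ 0 → ε ≤ |l| := by
  have hs := L.summable_inv_abs_add_sq 0
  set S := ∑' l : L.carrier, (|(l : ℝ) + 0| ^ 2)⁻¹ with hS
  have hS0 : 0 ≤ S := tsum_nonneg fun _ => by positivity
  refine ⟨(1 + S)⁻¹, by positivity, fun l hl h0 => ?_⟩
  have h1 : (|l| ^ 2)⁻¹ ≤ S := by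
    have h := hs.le_tsum ⟨l, hl⟩ fun _ _ => by positivity
    rwa [← hS, add_zero] at h
  have hl0 : 0 < |l| := abs_pos.2 h0
  rw [inv_le_comm₀ (by positivity) hl0]
  rw [← inv_pow] at h1
  nlinarith [sq_nonneg (|l|⁻¹ - 1)]

theorem finite_abs_le (L : ShiftedLattice) (R : ℝ) : {l : L.carrier | |(l : ℝ)| ≤ R}.Finite := by
  have h := L.summable_one_add_abs.tendsto_cofinite_zero
  have h2 : ∀ᶠ l : L.carrier in cofinite, ((1 + |(l : ℝ)|) ^ 2)⁻¹ < ((1 + |R|) ^ 2)⁻¹ :=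
    h.eventually_lt_const (by positivity)
  refine Set.Finite.subset h2 fun l hl h3 => ?_
  have hl' : |(l : ℝ)| ≤ |R| := le_trans hl (le_abs_self R)
  have : ((1 + |R|) ^ 2)⁻¹ ≤ ((1 + |(l : ℝ)|) ^ 2)⁻¹ := by gcongr
  exact absurd h3 (not_lt.2 this)

end ShiftedLattice

/-- Membership in `𝔐(L)` as a uniform bound on all of `L`. -/
theorem mem_coeffSpace_iff {L : ShiftedLattice} {α : L.carrier → ℂ} :
    α ∈ coeffSpace L ↔ ∃ (C : ℝ) (n : ℕ), 0 ≤ C ∧ ∀ l : L.carrier,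
      ‖α l‖ ≤ C * (1 + |(l : ℝ)|) ^ n := by
  constructor
  · rintro ⟨r, hr⟩
    obtain ⟨c, hc⟩ := hr.bound
    obtain ⟨n, hn⟩ := exists_nat_gt r
    rw [eventually_comap] at hc
    obtain ⟨R, hR⟩ := eventually_atTop.1 hc
    have hfin := L.finite_abs_le (max R 1)
    refine ⟨|c| + ∑ l ∈ hfin.toFinset, ‖α l‖, n, by positivity, fun l => ?_⟩
    have h1 : 1 ≤ (1 + |(l : ℝ)|) ^ n := one_le_pow₀ (by linarith [abs_nonneg (l : ℝ)])
    have hs : 0 ≤ ∑ l ∈ hfin.toFinset, ‖α l‖ := Finset.sum_nonneg fun _ _ => norm_nonneg _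
    by_cases hl : |(l : ℝ)| ≤ max R 1
    · have h2 : ‖α l‖ ≤ ∑ l ∈ hfin.toFinset, ‖α l‖ :=
        Finset.single_le_sum (f := fun l => ‖α l‖) (fun _ _ => norm_nonneg _)
          (by simpa using hl)
      nlinarith [abs_nonneg c]
    · have hl1 : max R 1 < |(l : ℝ)| := not_le.1 hl
      have hR1 : R ≤ |(l : ℝ)| := (le_max_left _ _).trans hl1.le
      have h11 : 1 ≤ |(l : ℝ)| := (le_max_right _ _).trans hl1.le
      have h2 := hR _ hR1 l rfl
      have h3 : ‖|(l : ℝ)| ^ r‖ ≤ (1 + |(l : ℝ)|) ^ n := by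
        rw [Real.norm_of_nonneg (by positivity)]
        calc |(l : ℝ)| ^ r ≤ |(l : ℝ)| ^ (n : ℝ) := Real.rpow_le_rpow_of_exponent_le h11 hn.le
          _ = |(l : ℝ)| ^ n := Real.rpow_natCast _ _
          _ ≤ _ := by gcongr; linarith
      calc ‖α l‖ ≤ |c| * (1 + |(l : ℝ)|) ^ n :=
            h2.trans (mul_le_mul (le_abs_self c) h3 (norm_nonneg _) (abs_nonneg c))
        _ ≤ _ := by gcongr; linarith
  · rintro ⟨C, n, hC, h⟩
    refine ⟨n, Asymptotics.IsBigO.of_bound (C * 2 ^ n) ?_⟩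
    rw [eventually_comap]
    filter_upwards [eventually_ge_atTop 1] with a ha l hl
    refine (h l).trans ?_
    subst hl
    rw [Real.rpow_natCast, norm_pow, Real.norm_of_nonneg (abs_nonneg _), mul_assoc, ← mul_pow]
    gcongr
    linarith

/-! ### Distributions on the real line -/

theorem mem_RDist_of_bound {T : Test → ℂ} (hl : IsLinearMap ℂ T)
    (h : ∀ u : ℝ, 0 < u → ∃ (m : ℕ) (C : ℝ), ∀ f : Test, tsupport f ⊆ Set.Icc (-u) u →
      ‖T f‖ ≤ C * cNorm m f) : T ∈ RDist := by
  refine ⟨hl, fun u hu => ?_⟩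
  obtain ⟨m, C, hC⟩ := h u hu
  refine ⟨m, |C| + 1, by positivity, fun f hf => (hC f hf).trans ?_⟩
  exact mul_le_mul_of_nonneg_right (by linarith [le_abs_self C]) (cNorm_nonneg m f)

theorem exists_bound_of_mem_RDist {T : Test → ℂ} (h : T ∈ RDist) {u : ℝ} (hu : 0 < u) :
    ∃ (m : ℕ) (C : ℝ), 0 < C ∧ ∀ f : Test, tsupport f ⊆ Set.Icc (-u) u →
      ‖T f‖ ≤ C * cNorm m f := h.2 u hu

theorem RDist_add {S T : Test → ℂ} (hS : S ∈ RDist) (hT : T ∈ RDist) :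
    (fun f => S f + T f) ∈ RDist := by
  refine mem_RDist_of_bound ⟨fun f g => ?_, fun c f => ?_⟩ fun u hu => ?_
  · rw [hS.1.map_add, hT.1.map_add]
    ring
  · rw [hS.1.map_smul, hT.1.map_smul, smul_add]
  · obtain ⟨m, C, hC, h1⟩ := exists_bound_of_mem_RDist hS hu
    obtain ⟨n, D, hD, h2⟩ := exists_bound_of_mem_RDist hT hu
    refine ⟨max m n, C + D, fun f hf => (norm_add_le _ _).trans ?_⟩
    rw [add_mul]
    refine add_le_add ((h1 f hf).trans ?_) ((h2 f hf).trans ?_)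
    · exact mul_le_mul_of_nonneg_left (cNorm_mono f (le_max_left _ _)) hC.le
    · exact mul_le_mul_of_nonneg_left (cNorm_mono f (le_max_right _ _)) hD.le

theorem RDist_smul {T : Test → ℂ} (hT : T ∈ RDist) (c : ℂ) : (fun f => c * T f) ∈ RDist := by
  refine mem_RDist_of_bound ⟨fun f g => ?_, fun c f => ?_⟩ fun u hu => ?_
  · rw [hT.1.map_add, mul_add]
  · rw [hT.1.map_smul, smul_eq_mul, smul_eq_mul]
    ring
  · obtain ⟨m, C, hC, h1⟩ := exists_bound_of_mem_RDist hT hu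
    refine ⟨m, ‖c‖ * C, fun f hf => ?_⟩
    rw [norm_mul, mul_assoc]
    exact mul_le_mul_of_nonneg_left (h1 f hf) (norm_nonneg _)

theorem RDist_sum {ι : Type*} (s : Finset ι) {T : ι → Test → ℂ} (hT : ∀ i, T i ∈ RDist) :
    (fun f => ∑ i ∈ s, T i f) ∈ RDist := by
  classical
  induction s using Finset.induction_on with
  | empty =>
    refine mem_RDist_of_bound ⟨fun f g => by simp, fun c f => by simp⟩ fun u hu => ⟨0, 0, by simp⟩
  | insert i s hi ih =>
    simp only [Finset.sum_insert hi]
    exact RDist_add (hT i) ih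

theorem deltaR_mem_RDist (m : ℕ) : (fun f : Test => deltaR m f) ∈ RDist := by
  refine mem_RDist_of_bound ⟨fun f g => deltaR_add m f g, fun c f => deltaR_smul m c f⟩
    fun u _ => ⟨m, 1, fun f _ => ?_⟩
  rw [deltaR, norm_mul, norm_pow, norm_neg, norm_one, one_pow, one_mul, one_mul]
  exact norm_iteratedDeriv_le_cNorm f le_rfl 0

theorem sum_deltaR_mem_RDist (β : ℕ →₀ ℂ) :
    (fun f : Test => β.sum fun m b => b * deltaR m f) ∈ RDist :=
  RDist_sum β.support fun m => RDist_smul (deltaR_mem_RDist m) (β m)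

/-- A family of linear functionals indexed by a shifted lattice that is rapidly decreasing,
uniformly with respect to a seminorm on test functions with support in a given interval. -/
structure RapidFamily (L : ShiftedLattice) (Φ : ℝ → Test → ℂ) : Prop where
  linear : ∀ l, IsLinearMap ℂ (Φ l)
  bound : ∀ (u : ℝ) (_ : 0 < u) (M : ℕ), ∃ (m : ℕ) (D : ℝ), 0 ≤ D ∧ ∀ f : Test,
    tsupport f ⊆ Set.Icc (-u) u → ∀ l ∈ L.carrier,
      ‖Φ l f‖ ≤ D * cNorm m f * ((1 + |l|) ^ M)⁻¹

section Rapid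

variable {L : ShiftedLattice} {Φ : ℝ → Test → ℂ} {α : L.carrier → ℂ}

theorem RapidFamily.exists_le (hΦ : RapidFamily L Φ) (hα : α ∈ coeffSpace L) {u : ℝ} (hu : 0 < u) :
    ∃ (m : ℕ) (D : ℝ), 0 ≤ D ∧ ∀ f : Test, tsupport f ⊆ Set.Icc (-u) u → ∀ l : L.carrier,
      ‖α l * Φ l f‖ ≤ D * cNorm m f * ((1 + |(l : ℝ)|) ^ 2)⁻¹ := by
  obtain ⟨C, n, hC, h⟩ := mem_coeffSpace_iff.1 hα
  obtain ⟨m, D, hD, hb⟩ := hΦ.bound u hu (n + 2)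
  refine ⟨m, C * D, by positivity, fun f hf l => ?_⟩
  have h1 : 0 < 1 + |(l : ℝ)| := by positivity
  rw [norm_mul]
  calc ‖α l‖ * ‖Φ l f‖
      ≤ (C * (1 + |(l : ℝ)|) ^ n) * (D * cNorm m f * ((1 + |(l : ℝ)|) ^ (n + 2))⁻¹) :=
        mul_le_mul (h l) (hb f hf l l.2) (norm_nonneg _) (by positivity)
    _ = _ := by
        rw [pow_add]
        field_simp

theorem RapidFamily.summable (hΦ : RapidFamily L Φ) (hα : α ∈ coeffSpace L) (f : Test) :
    Summable fun l : L.carrier => α l * Φ l f := by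
  obtain ⟨u, hu, hf⟩ := f.exists_tsupport_subset
  obtain ⟨m, D, -, h⟩ := hΦ.exists_le hα hu
  exact Summable.of_norm_bounded (L.summable_one_add_abs.mul_left _) (h f hf)

theorem RapidFamily.tsum_mem_RDist (hΦ : RapidFamily L Φ) (hα : α ∈ coeffSpace L) :
    (fun f => ∑' l : L.carrier, α l * Φ l f) ∈ RDist := by
  refine mem_RDist_of_bound ⟨fun f g => ?_, fun c f => ?_⟩ fun u hu => ?_
  · rw [← (hΦ.summable hα f).tsum_add (hΦ.summable hα g)]
    congr 1
    funext l
    rw [(hΦ.linear l).map_add, mul_add]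
  · rw [smul_eq_mul, ← tsum_mul_left]
    congr 1
    funext l
    rw [(hΦ.linear l).map_smul, smul_eq_mul]
    ring
  · obtain ⟨m, D, -, h⟩ := hΦ.exists_le hα hu
    refine ⟨m, D * ∑' l : L.carrier, ((1 + |(l : ℝ)|) ^ 2)⁻¹, fun f hf => ?_⟩
    have := tsum_of_norm_bounded (L.summable_one_add_abs.mul_left (D * cNorm m f)).hasSum (h f hf)
    rw [tsum_mul_left] at this
    linarith

end Rapid

theorem integral_norm_test_le {u : ℝ} (hu : 0 < u) {f : Test} (hf : tsupport f ⊆ Set.Icc (-u) u) :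
    ∫ x, ‖f x‖ ≤ 2 * u * cNorm 0 f := by
  have h1 : ∫ x, ‖f x‖ = ∫ x in Set.Icc (-u) u, ‖f x‖ := by
    rw [setIntegral_eq_integral_of_forall_compl_eq_zero fun x hx => ?_]
    rw [image_eq_zero_of_notMem_tsupport fun h => hx (hf h), norm_zero]
  rw [h1]
  have h2 := norm_setIntegral_le_of_norm_le_const (μ := volume) (s := Set.Icc (-u) u)
    (f := fun x => ‖f x‖) (C := cNorm 0 f) (by simp) fun x _ => by
      simpa using f.norm_le_cNorm x
  rw [Real.norm_of_nonneg (integral_nonneg fun _ => norm_nonneg _)] at h2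
  refine h2.trans (le_of_eq ?_)
  rw [Real.volume_real_Icc_of_le (by linarith)]
  ring

theorem norm_fourier_test_le (N : ℕ) {u : ℝ} (hu : 0 < u) {f : Test}
    (hf : tsupport f ⊆ Set.Icc (-u) u) (y : ℝ) :
    |y| ^ N * ‖fourier f y‖ ≤ 2 * u * cNorm N f := by
  have h1 := fourier_iteratedDeriv_test N f y
  have h2 : ‖fourier (iteratedDeriv N f) y‖ ≤ 2 * u * cNorm N f := by
    rw [← derivT_iterate]
    refine (norm_fourier_le _ _).trans ((integral_norm_test_le hu
      ((tsupport_derivT_iterate_subset N f).trans hf)).trans ?_)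
    gcongr
    exact cNorm_zero_derivT_iterate N f
  refine le_trans ?_ h2
  rw [h1, norm_mul, norm_pow, norm_neg, norm_mul, norm_mul, norm_mul, norm_I, norm_real, norm_real,
    Real.norm_eq_abs, Real.norm_eq_abs, abs_of_pos Real.pi_pos, Complex.norm_ofNat]
  gcongr
  have := Real.pi_gt_three
  nlinarith [abs_nonneg y]

theorem rapidFamily_fourier (L : ShiftedLattice) :
    RapidFamily L fun l f => fourier f l where
  linear l := ⟨fun f g => fourier_test_add f g l, fun c f => fourier_test_smul c f l⟩
  bound u hu M := by
    refine ⟨M, 2 ^ M * (4 * u), by positivity, fun f hf l _ => ?_⟩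
    have hl := abs_nonneg l
    rw [← div_eq_mul_inv, le_div_iff₀ (by positivity)]
    have h0 := norm_fourier_test_le 0 hu hf l
    have hM := norm_fourier_test_le M hu hf l
    rw [pow_zero, one_mul] at h0
    have h0' : cNorm 0 f ≤ cNorm M f := cNorm_mono f (Nat.zero_le M)
    have h1 : (1 + |l|) ^ M ≤ 2 ^ M * (1 + |l| ^ M) := by
      rcases le_total |l| 1 with h | h
      · calc (1 + |l|) ^ M ≤ 2 ^ M := by gcongr; linarith
          _ ≤ _ := le_mul_of_one_le_right (by positivity) (by linarith [pow_nonneg hl M])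
      · calc (1 + |l|) ^ M ≤ (2 * |l|) ^ M := by gcongr; linarith
          _ = 2 ^ M * |l| ^ M := mul_pow _ _ _
          _ ≤ _ := by gcongr; linarith
    calc ‖fourier f l‖ * (1 + |l|) ^ M ≤ ‖fourier f l‖ * (2 ^ M * (1 + |l| ^ M)) := by gcongr
      _ = 2 ^ M * (‖fourier f l‖ + |l| ^ M * ‖fourier f l‖) := by ring
      _ ≤ 2 ^ M * (2 * u * cNorm M f + 2 * u * cNorm M f) := by
          gcongr
          exact h0.trans (by gcongr)
      _ = _ := by ring

theorem rapidFamily_twistedFourier (L : ShiftedLattice) (μ ν : ℂ) :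
    RapidFamily L fun l f => twistedFourier μ ν f l where
  linear l := ⟨fun f g => twistedFourier_add μ ν f g l, fun c f => twistedFourier_smul μ ν c f l⟩
  bound u hu M := by
    obtain ⟨K, hK⟩ := exists_nat_gt (-2 * ν.re)
    have hN : 0 < 2 * ν.re + (M + K : ℕ) := by
      push_cast
      linarith [(Nat.cast_nonneg M : (0 : ℝ) ≤ M)]
    obtain ⟨C, hC, h1⟩ := exists_twistedFourier_bound (M + K) μ ν hu hN
    obtain ⟨m, C', hC', h0⟩ := exists_twistedFourier_bound_zero μ ν hu
    obtain ⟨ε, hε, hL⟩ := L.exists_pos_le_abs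
    have hp : 0 ≤ C * (1 + 1 / ε) ^ (M + K) := by positivity
    refine ⟨max m (M + K), C' + C * (1 + 1 / ε) ^ (M + K), by positivity, fun f hf l hl => ?_⟩
    have n0 := cNorm_nonneg (max m (M + K)) f
    by_cases hl0 : l = 0
    · subst hl0
      refine (h0 f hf).trans ?_
      simp only [abs_zero, add_zero, one_pow, inv_one, mul_one]
      exact mul_le_mul (by linarith) (cNorm_mono f (le_max_left _ _)) (cNorm_nonneg _ _)
        (by positivity)
    · have hl1 := hL l hl hl0
      have hl2 : 0 < |l| := abs_pos.2 hl0
      refine (h1 f hf l hl0).trans ?_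
      have e1 : 1 + |l| ≤ (1 + 1 / ε) * |l| := by
        have : 1 ≤ 1 / ε * |l| := by
          rw [one_div, inv_mul_eq_div, le_div_iff₀ hε]
          linarith
        linarith
      have e2 : (|l| ^ (M + K))⁻¹ ≤ (1 + 1 / ε) ^ (M + K) * ((1 + |l|) ^ M)⁻¹ := by
        rw [inv_le_iff_one_le_mul₀ (by positivity), mul_right_comm, ← div_eq_mul_inv,
          one_le_div (by positivity), ← mul_pow]
        calc (1 + |l|) ^ M ≤ (1 + |l|) ^ (M + K) :=
              pow_le_pow_right₀ (by linarith) (Nat.le_add_right _ _)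
          _ ≤ _ := by gcongr
      calc C * cNorm (M + K) f * (|l| ^ (M + K))⁻¹
          ≤ C * cNorm (max m (M + K)) f * ((1 + 1 / ε) ^ (M + K) * ((1 + |l|) ^ M)⁻¹) := by
            gcongr
            exact cNorm_mono f (le_max_right _ _)
        _ = C * (1 + 1 / ε) ^ (M + K) * cNorm (max m (M + K)) f * ((1 + |l|) ^ M)⁻¹ := by ring
        _ ≤ _ := by
            gcongr
            linarith

/-! ### Fourier expansions as functionals -/

section Expansion

variable {L : ShiftedLattice} {μ ν : ℂ} {α : L.carrier → ℂ}

theorem summable_jacquet (hα : α ∈ coeffSpace L) (F : PS μ ν) :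
    Summable fun l : L.carrier => α l * jacquet (l : ℝ) F := by
  refine (((rapidFamily_fourier L).summable hα (part₁ F)).add
    ((rapidFamily_twistedFourier L μ ν).summable hα (part₂ F))).congr fun l => ?_
  rw [(isPartition_part F).jacquet_eq, mul_add]

theorem sum_deltaInf_add (β : ℕ →₀ ℂ) (F G : PS μ ν) :
    (β.sum fun m b => b * deltaInf m (F + G))
      = (β.sum fun m b => b * deltaInf m F) + β.sum fun m b => b * deltaInf m G := by
  rw [← Finsupp.sum_add]
  congr 1
  funext m b
  rw [deltaInf_add, mul_add]

theorem isLinearMap_expansion (hα : α ∈ coeffSpace L) (β : ℕ →₀ ℂ) :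
    IsLinearMap ℂ (expansion L μ ν α β) := by
  constructor
  · intro F G
    rw [expansion, expansion, expansion, sum_deltaInf_add, add_add_add_comm,
      ← (summable_jacquet hα F).tsum_add (summable_jacquet hα G)]
    congr 2
    funext l
    rw [jacquet_add, mul_add]
  · intro c F
    rw [expansion, expansion, smul_add, smul_eq_mul, smul_eq_mul, ← tsum_mul_left, Finsupp.mul_sum]
    congr 2
    · funext l
      rw [jacquet_smul]
      ring
    · funext m b
      rw [deltaInf_smul]
      ring

theorem toRDist_expansion (α : L.carrier → ℂ) (β : ℕ →₀ ℂ) (f : Test) :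
    toRDist (expansion L μ ν α β) f = ∑' l : L.carrier, α l * fourier f l := by
  rw [toRDist, expansion]
  simp [jacquet_iota, deltaInf_iota, Finsupp.sum]

theorem toRDist_distInv_expansion (α : L.carrier → ℂ) (β : ℕ →₀ ℂ) (f : Test) :
    toRDist (distInv (expansion L μ ν α β)) f
      = ∑' l : L.carrier, α l * twistedFourier μ ν f l + β.sum fun m b => b * deltaR m f := by
  rw [toRDist, distInv, expansion]
  simp [jacquet_flip_iota, deltaInf_flip_iota]

theorem toRDist_expansion_mem_RDist (hα : α ∈ coeffSpace L) (β : ℕ →₀ ℂ) :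
    toRDist (expansion L μ ν α β) ∈ RDist := by
  rw [show toRDist (expansion L μ ν α β) = _ from funext (toRDist_expansion α β)]
  exact (rapidFamily_fourier L).tsum_mem_RDist hα

theorem toRDist_distInv_expansion_mem_RDist (hα : α ∈ coeffSpace L) (β : ℕ →₀ ℂ) :
    toRDist (distInv (expansion L μ ν α β)) ∈ RDist := by
  rw [show toRDist (distInv (expansion L μ ν α β)) = _ from
    funext (toRDist_distInv_expansion α β)]
  exact RDist_add ((rapidFamily_twistedFourier L μ ν).tsum_mem_RDist hα) (sum_deltaR_mem_RDist β)

end Expansion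

/-! ### Series of exponentials -/

/-- The exponential `x ↦ exp (-2π i l x)`. -/
def wave (l x : ℝ) : ℂ := cexp (-(2 * Real.pi * I * l) * x)

theorem contDiff_wave (l : ℝ) : ContDiff ℝ ∞ (wave l) :=
  (contDiff_const.mul ofRealCLM.contDiff).cexp

theorem norm_wave (l x : ℝ) : ‖wave l x‖ = 1 := by
  rw [wave, Complex.norm_exp]
  simp

theorem iteratedDeriv_const_mul_wave (k : ℕ) (c : ℂ) (l : ℝ) :
    iteratedDeriv k (fun x => c * wave l x)
      = fun x => c * (-(2 * Real.pi * I * l)) ^ k * wave l x := by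
  induction k with
  | zero => simp
  | succ k ih =>
    rw [iteratedDeriv_succ, ih]
    funext x
    have h : HasDerivAt (fun x : ℝ => wave l x) (wave l x * (-(2 * Real.pi * I * l) * 1)) x := by
      unfold wave
      exact ((hasDerivAt_id' x).ofReal_comp.const_mul _).cexp
    rw [(h.const_mul _).deriv]
    ring

theorem norm_freq_pow_le (l : ℝ) (k : ℕ) :
    ‖(-(2 * Real.pi * I * l) : ℂ) ^ k‖ ≤ (2 * Real.pi) ^ k * (1 + |l|) ^ k := by
  rw [norm_pow, norm_neg, norm_mul, norm_mul, norm_mul, norm_I, norm_real, norm_real,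
    Real.norm_eq_abs, Real.norm_eq_abs, abs_of_pos Real.pi_pos, Complex.norm_ofNat, ← mul_pow]
  have := Real.pi_pos
  have := abs_nonneg l
  refine pow_le_pow_left₀ (by positivity) ?_ k
  rw [mul_one]
  nlinarith

theorem norm_iteratedDeriv_const_mul_wave_le (k : ℕ) (c : ℂ) (l x : ℝ) :
    ‖iteratedDeriv k (fun x => c * wave l x) x‖
      ≤ (2 * Real.pi) ^ k * (‖c‖ * (1 + |l|) ^ k) := by
  rw [iteratedDeriv_const_mul_wave]
  simp only [norm_mul, norm_wave, mul_one]
  have := mul_le_mul_of_nonneg_left (norm_freq_pow_le l k) (norm_nonneg c)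
  linarith

section WaveSum

variable {L : ShiftedLattice}

/-- Rapidly decreasing functions on a shifted lattice. -/
def RapidCoeff (c : L.carrier → ℂ) : Prop :=
  ∀ k : ℕ, Summable fun l : L.carrier => ‖c l‖ * (1 + |(l : ℝ)|) ^ k

/-- The sum of a series of exponentials with frequencies in a shifted lattice. -/
def waveSum (c : L.carrier → ℂ) (x : ℝ) : ℂ := ∑' l : L.carrier, c l * wave l x

theorem RapidCoeff.summable {c : L.carrier → ℂ} (hc : RapidCoeff c) (x : ℝ) :
    Summable fun l : L.carrier => c l * wave l x := by
  refine Summable.of_norm_bounded (hc 0) fun l => ?_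
  rw [norm_mul, norm_wave]
  simp

theorem RapidCoeff.contDiff {c : L.carrier → ℂ} (hc : RapidCoeff c) :
    ContDiff ℝ ∞ (waveSum c) := by
  refine contDiff_tsum (N := ⊤) (v := fun k l => (2 * Real.pi) ^ k * (‖c l‖ * (1 + |(l : ℝ)|) ^ k))
    (fun l => contDiff_const.mul (contDiff_wave l)) (fun k _ => (hc k).mul_left _)
    fun k l x _ => ?_
  rw [norm_iteratedFDeriv_eq_norm_iteratedDeriv]
  exact norm_iteratedDeriv_const_mul_wave_le k (c l) l x

theorem RapidCoeff.norm_iteratedDeriv_le {c : L.carrier → ℂ} (hc : RapidCoeff c) (k : ℕ) (x : ℝ) :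
    ‖iteratedDeriv k (waveSum c) x‖
      ≤ (2 * Real.pi) ^ k * ∑' l : L.carrier, ‖c l‖ * (1 + |(l : ℝ)|) ^ k := by
  have hb : ∀ (k : ℕ) (l : L.carrier) (x : ℝ),
      ‖iteratedFDeriv ℝ k (fun x => c l * wave l x) x‖
        ≤ (2 * Real.pi) ^ k * (‖c l‖ * (1 + |(l : ℝ)|) ^ k) := fun k l x => by
    rw [norm_iteratedFDeriv_eq_norm_iteratedDeriv]
    exact norm_iteratedDeriv_const_mul_wave_le k (c l) l x
  have e : iteratedFDeriv ℝ k (waveSum c) x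
      = ∑' l : L.carrier, iteratedFDeriv ℝ k (fun x => c l * wave l x) x :=
    iteratedFDeriv_tsum_apply (N := ⊤) (f := fun (l : L.carrier) (x : ℝ) => c l * wave l x)
      (fun l => contDiff_const.mul (contDiff_wave l))
      (fun k _ => (hc k).mul_left _) (fun k l x _ => hb k l x) le_top x
  rw [← norm_iteratedFDeriv_eq_norm_iteratedDeriv, e, ← tsum_mul_left]
  exact tsum_of_norm_bounded ((hc k).mul_left _).hasSum fun l => hb k l x

end WaveSum

theorem cNorm_smoothMul_le {ψ : ℝ → ℂ} (h : ContDiff ℝ ∞ ψ) (f : Test) {m : ℕ} {B : ℝ}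
    (hB0 : 0 ≤ B) (hB : ∀ k ≤ m, ∀ x ∈ tsupport f, ‖iteratedDeriv k ψ x‖ ≤ B) :
    cNorm m (smoothMul ψ h f) ≤ (m + 1) * (2 ^ m * B * cNorm m f) := by
  refine cNorm_le fun n hn x => (norm_iteratedDeriv_mul_le h f.smooth n x).trans ?_
  calc ∑ i ∈ Finset.range (n + 1),
        (n.choose i : ℝ) * ‖iteratedDeriv i ψ x‖ * ‖iteratedDeriv (n - i) f x‖
      ≤ ∑ i ∈ Finset.range (n + 1), (n.choose i : ℝ) * B * cNorm m f := by
        refine Finset.sum_le_sum fun i hi => ?_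
        by_cases hx : x ∈ tsupport f
        · gcongr
          · exact hB i ((Nat.lt_succ_iff.1 (Finset.mem_range.1 hi)).trans hn) x hx
          · exact norm_iteratedDeriv_le_cNorm f ((Nat.sub_le n i).trans hn) x
        · rw [image_eq_zero_of_notMem_tsupport fun h =>
            hx (tsupport_iteratedDeriv_subset f (n - i) h), norm_zero, mul_zero]
          have := cNorm_nonneg m f
          positivity
    _ = 2 ^ n * B * cNorm m f := by
        rw [← Finset.sum_mul, ← Finset.sum_mul]
        congr 2
        exact_mod_cast Nat.sum_range_choose n
    _ ≤ _ := by
        have := cNorm_nonneg m f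
        gcongr
        norm_num

theorem Test.sum_apply {ι : Type*} (s : Finset ι) (g : ι → Test) (x : ℝ) :
    (∑ i ∈ s, g i) x = ∑ i ∈ s, g i x := by
  classical
  induction s using Finset.induction_on with
  | empty => rfl
  | insert i s hi ih => rw [Finset.sum_insert hi, Finset.sum_insert hi, ← ih]; rfl

theorem map_test_sum {T : Test → ℂ} (hT : IsLinearMap ℂ T) {ι : Type*} (s : Finset ι)
    (c : ι → ℂ) (g : ι → Test) : T (∑ i ∈ s, c i • g i) = ∑ i ∈ s, c i * T (g i) := by
  change hT.mk' T _ = _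
  rw [map_sum]
  exact Finset.sum_congr rfl fun i _ => hT.map_smul _ _

section Exchange

variable {L : ShiftedLattice} {T : Test → ℂ}

/-- A distribution may be applied term by term to a rapidly convergent series of exponentials,
multiplied by a test function. -/
theorem map_smoothMul_waveSum (hT : T ∈ RDist) (χ : Test) {c : L.carrier → ℂ}
    (hc : RapidCoeff c) : T (smoothMul (waveSum c) hc.contDiff χ)
      = ∑' l : L.carrier, c l * T (smoothMul (wave l) (contDiff_wave l) χ) := by
  classical
  obtain ⟨u, hu, hχ⟩ := χ.exists_tsupport_subset
  obtain ⟨m, C, hC, hb⟩ := exists_bound_of_mem_RDist hT hu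
  refine (HasSum.tsum_eq ?_).symm
  set A : ℝ := C * ((m + 1) * (2 ^ m * (2 * Real.pi) ^ m * cNorm m χ)) with hA
  have key : ∀ s : Finset L.carrier,
      ‖∑ l ∈ s, c l * T (smoothMul (wave l) (contDiff_wave l) χ)
        - T (smoothMul (waveSum c) hc.contDiff χ)‖
      ≤ A * (∑' l : L.carrier, ‖c l‖ * (1 + |(l : ℝ)|) ^ m
        - ∑ l ∈ s, ‖c l‖ * (1 + |(l : ℝ)|) ^ m) := by
    intro s
    -- the error is the value of `T` at the tail of the series
    set c' : L.carrier → ℂ := fun l => if l ∈ s then 0 else c l with hc'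
    have hle : ∀ l, ‖c' l‖ ≤ ‖c l‖ := fun l => by
      simp only [hc']
      split_ifs <;> simp
    have hr : RapidCoeff c' := fun k => (hc k).of_nonneg_of_le (fun l => by positivity)
      fun l => by have := hle l; gcongr
    have e1 : smoothMul (waveSum c) hc.contDiff χ
        = (∑ l ∈ s, c l • smoothMul (wave l) (contDiff_wave l) χ)
          + smoothMul (waveSum c') hr.contDiff χ := by
      ext x
      have e2 : waveSum c x = ∑ l ∈ s, c l * wave l x + waveSum c' x := by
        have h1 : waveSum c x - waveSum c' x = ∑' l, (c l * wave l x - c' l * wave l x) :=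
          ((hc.summable x).tsum_sub (hr.summable x)).symm
        have h2 : ∑' l : L.carrier, (c l * wave l x - c' l * wave l x)
          = ∑ l ∈ s, c l * wave l x := by
          rw [tsum_eq_sum (s := s) fun l hl => by simp [hc', hl]]
          refine Finset.sum_congr rfl fun l hl => ?_
          simp [hc', hl]
        rw [← h2, ← h1]
        ring
      change waveSum c x * χ x = (∑ l ∈ s, c l • smoothMul (wave l) (contDiff_wave l) χ) x
        + waveSum c' x * χ x
      rw [Test.sum_apply, e2, add_mul, Finset.sum_mul]
      congr 1
      refine Finset.sum_congr rfl fun l _ => ?_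
      exact mul_assoc _ _ _
    have e3 : ∑' l : L.carrier, ‖c l‖ * (1 + |(l : ℝ)|) ^ m
        - ∑ l ∈ s, ‖c l‖ * (1 + |(l : ℝ)|) ^ m
          = ∑' l : L.carrier, ‖c' l‖ * (1 + |(l : ℝ)|) ^ m := by
      have h1 := ((hc m).tsum_sub (hr m)).symm
      have h2 : ∑' l : L.carrier, (‖c l‖ * (1 + |(l : ℝ)|) ^ m - ‖c' l‖ * (1 + |(l : ℝ)|) ^ m)
          = ∑ l ∈ s, ‖c l‖ * (1 + |(l : ℝ)|) ^ m := by
        rw [tsum_eq_sum (s := s) fun l hl => by simp [hc', hl]]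
        refine Finset.sum_congr rfl fun l hl => ?_
        simp [hc', hl]
      rw [h2] at h1
      linarith
    rw [e1, hT.1.map_add, map_test_sum hT.1, e3, sub_add_cancel_left, norm_neg]
    refine (hb _ ((tsupport_smoothMul_subset _ _ _).trans hχ)).trans ?_
    have hB : ∀ k ≤ m, ∀ x, ‖iteratedDeriv k (waveSum c') x‖
        ≤ (2 * Real.pi) ^ m * ∑' l : L.carrier, ‖c' l‖ * (1 + |(l : ℝ)|) ^ m := by
      intro k hk x
      refine (hr.norm_iteratedDeriv_le k x).trans ?_
      have h2 : (1 : ℝ) ≤ 2 * Real.pi := by linarith [Real.pi_gt_three]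
      refine mul_le_mul (pow_le_pow_right₀ h2 hk) ?_ (tsum_nonneg fun l => by positivity)
        (by positivity)
      refine (hr k).tsum_le_tsum (fun l => ?_) (hr m)
      exact mul_le_mul_of_nonneg_left
        (pow_le_pow_right₀ (by linarith [abs_nonneg (l : ℝ)]) hk) (norm_nonneg _)
    have := mul_le_mul_of_nonneg_left (cNorm_smoothMul_le hr.contDiff χ
      ((norm_nonneg _).trans (hB 0 (Nat.zero_le m) 0)) fun k hk x _ => hB k hk x) hC.le
    refine this.trans (le_of_eq ?_)
    rw [hA]
    ring
  rw [HasSum, SummationFilter.unconditional_filter, tendsto_iff_norm_sub_tendsto_zero]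
  have hlim := ((hc m).hasSum.const_sub (∑' l : L.carrier, ‖c l‖ * (1 + |(l : ℝ)|) ^ m)).const_mul A
  rw [sub_self, mul_zero] at hlim
  exact squeeze_zero (fun _ => norm_nonneg _) key hlim

end Exchange

/-! ### Fourier expansion of quasi-periodic distributions -/

section Poisson

variable (L : ShiftedLattice)

/-- The twisted Poisson summation formula for a test function. -/
theorem tsum_translate_eq_waveSum (f : Test) (x : ℝ) :
    ∑' k : ℤ, cexp (2 * Real.pi * I * L.shift * (k / L.step)) * f (x + k / L.step)
      = |L.step| * waveSum (fun l : L.carrier => fourier f l) x := by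
  have h0 := L.step_ne_zero
  set h := L.step with hh
  set a := L.shift with ha
  -- Poisson summation for `y ↦ g (y / h)`, where the factor `exp (2π i a x)` shifts the lattice
  set g : ℝ → ℂ := fun x => cexp (2 * Real.pi * I * a * x) * f x with hg
  have hgs : ContDiff ℝ ∞ g := (contDiff_const.mul ofRealCLM.contDiff).cexp.mul f.smooth
  have hgc : HasCompactSupport g := f.hasCompactSupport.mul_left
  have hφs : ContDiff ℝ ∞ fun y => g (y / h) := hgs.comp (contDiff_id.div_const h)
  have hφc : HasCompactSupport fun y => g (y / h) := by
    have := hgc.comp_homeomorph (Homeomorph.mulRight₀ h⁻¹ (inv_ne_zero h0))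
    simpa [Function.comp_def, div_eq_mul_inv] using this
  have hP := SchwartzMap.tsum_eq_tsum_fourier (hφc.toSchwartzMap hφs) (h * x)
  have e1 : ∀ k : ℤ, hφc.toSchwartzMap hφs (h * x + k) = g (x + k / h) := fun k => by
    change g ((h * x + k) / h) = _
    congr 1
    field_simp
  have e2 : ∀ n : ℤ, (FourierTransform.fourier (hφc.toSchwartzMap hφs) : SchwartzMap ℝ ℂ) n
      = |h| * fourier f (a - h * n) := by
    intro n
    rw [SchwartzMap.fourier_coe, Real.fourier_real_eq_integral_exp_smul, fourier]
    have := Measure.integral_comp_mul_left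
      (fun v : ℝ => cexp (((-2 * Real.pi * v * (n : ℝ) : ℝ) : ℂ) * I) • g (v / h)) h
    rw [abs_inv] at this
    have h1 : ∫ v : ℝ, cexp (((-2 * Real.pi * v * (n : ℝ) : ℝ) : ℂ) * I) • (hφc.toSchwartzMap hφs) v
        = |h| • ∫ x : ℝ, cexp (((-2 * Real.pi * (h * x) * (n : ℝ) : ℝ) : ℂ) * I) • g (h * x / h) :=
          by
      rw [this, smul_smul, mul_inv_cancel₀ (abs_ne_zero.2 h0), one_smul]
      rfl
    rw [h1, real_smul]
    congr 2
    funext x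
    rw [mul_div_cancel_left₀ _ h0, hg, smul_eq_mul, ← mul_assoc, ← Complex.exp_add, mul_comm]
    congr 2
    push_cast
    ring
  have e3 : ∀ n : ℤ, (_root_.fourier n ((h * x : ℝ) : UnitAddCircle) : ℂ)
      = cexp (2 * Real.pi * I * (h * n) * x) := by
    intro n
    rw [fourier_coe_apply]
    congr 1
    push_cast
    ring
  simp only [e1, e2, e3] at hP
  have e4 : ∀ k : ℤ, cexp (2 * Real.pi * I * a * (k / h)) * f (x + k / h)
      = wave a x * g (x + k / h) := by
    intro k
    rw [hg, wave, ← mul_assoc, ← Complex.exp_add]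
    congr 2
    push_cast
    ring
  simp only [e4]
  rw [tsum_mul_left, hP, waveSum, ← tsum_mul_left, ← tsum_mul_left,
    ← ((Equiv.neg ℤ).trans L.param).tsum_eq]
  congr 1
  funext n
  rw [Equiv.trans_apply, L.param_apply, ← hh, ← ha, Equiv.neg_apply]
  have e5 : a + h * ((-n : ℤ) : ℝ) = a - h * n := by
    push_cast
    ring
  have e6 : wave (a - h * n) x = wave a x * cexp (2 * Real.pi * I * (h * n) * x) := by
    rw [wave, wave, ← Complex.exp_add]
    congr 1
    push_cast
    ring
  rw [e5, e6]
  ring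

/-- The function `S(hx) - S(hx - 1)`, with `S` a smooth step and `h` the step of the lattice. Its
translates by the periods `k / h` form a partition of unity. -/
def unitTest : Test :=
  mkTest (fun x => ((Real.smoothTransition (L.step * x)
      - Real.smoothTransition (L.step * x - 1) : ℝ) : ℂ))
    (ofRealCLM.contDiff.comp
      ((Real.smoothTransition.contDiff.comp (contDiff_const.mul contDiff_id)).sub
        (Real.smoothTransition.contDiff.comp ((contDiff_const.mul contDiff_id).sub contDiff_const))))
    (by
      have h0 := abs_pos.2 L.step_ne_zero
      refine HasCompactSupport.of_support_subset_isCompact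
        (isCompact_Icc (a := -(2 / |L.step|)) (b := 2 / |L.step|)) fun x hx => ?_
      by_contra hx'
      refine hx ?_
      have h1 : 2 < |L.step * x| := by
        rw [abs_mul, ← div_lt_iff₀' h0]
        by_contra h2
        exact hx' (abs_le.1 (not_lt.1 h2))
      rcases lt_abs.1 h1 with h2 | h2
      · simp [Real.smoothTransition.one_of_one_le (show 1 ≤ L.step * x by linarith),
          Real.smoothTransition.one_of_one_le (show 1 ≤ L.step * x - 1 by linarith)]
      · simp [Real.smoothTransition.zero_of_nonpos (show L.step * x ≤ 0 by linarith),
          Real.smoothTransition.zero_of_nonpos (show L.step * x - 1 ≤ 0 by linarith)])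

theorem unitTest_apply (x : ℝ) : unitTest L x
    = ((Real.smoothTransition (L.step * x) - Real.smoothTransition (L.step * x - 1) : ℝ) : ℂ) := rfl

theorem unitTest_eq_zero {x : ℝ} (h : 2 ≤ |L.step * x|) : unitTest L x = 0 := by
  rw [unitTest_apply]
  rcases le_abs.1 h with h2 | h2
  · simp [Real.smoothTransition.one_of_one_le (show 1 ≤ L.step * x by linarith),
      Real.smoothTransition.one_of_one_le (show 1 ≤ L.step * x - 1 by linarith)]
  · simp [Real.smoothTransition.zero_of_nonpos (show L.step * x ≤ 0 by linarith),
      Real.smoothTransition.zero_of_nonpos (show L.step * x - 1 ≤ 0 by linarith)]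

/-- The integers of absolute value at most `K`. -/
def intBall (K : ℕ) : Finset ℤ := Finset.Icc (-(K : ℤ)) K

theorem sum_intBall_telescope (S : ℝ → ℝ) (y : ℝ) (K : ℕ) :
    ∑ k ∈ intBall K, (S (y + k) - S (y + k - 1)) = S (y + K) - S (y - K - 1) := by
  induction K with
  | zero => simp [intBall]
  | succ K ih =>
    have e : intBall (K + 1) = insert ((K : ℤ) + 1) (insert (-((K : ℤ) + 1)) (intBall K)) := by
      ext k
      simp only [intBall, Finset.mem_insert, Finset.mem_Icc]
      push_cast
      omega
    rw [e, Finset.sum_insert, Finset.sum_insert, ih]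
    · push_cast
      rw [show y + (K + 1 : ℝ) - 1 = y + K by ring, show y + -(K + 1 : ℝ) = y - K - 1 by ring,
        show y - (K + 1 : ℝ) - 1 = y - K - 1 - 1 by ring]
      ring
    · simp only [intBall, Finset.mem_Icc]
      omega
    · simp only [intBall, Finset.mem_insert, Finset.mem_Icc]
      omega

theorem sum_unitTest {K : ℕ} {x : ℝ} (hK : |L.step * x| + 1 ≤ K) :
    ∑ k ∈ intBall K, unitTest L (x + k / L.step) = 1 := by
  have h0 := L.step_ne_zero
  have h1 := abs_le.1 (show |L.step * x| ≤ K - 1 by linarith)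
  have e : ∀ k : ℤ, unitTest L (x + k / L.step) = ((Real.smoothTransition (L.step * x + k)
      - Real.smoothTransition (L.step * x + k - 1) : ℝ) : ℂ) := fun k => by
    rw [unitTest_apply, mul_add, mul_div_cancel₀ _ h0]
  simp only [e]
  rw [← ofReal_sum, sum_intBall_telescope, Real.smoothTransition.one_of_one_le (by linarith),
    Real.smoothTransition.zero_of_nonpos (by linarith)]
  simp

theorem omega_period (k : ℤ) : L.omega (k / L.step)
    = cexp (2 * Real.pi * I * L.shift * (k / L.step)) := by
  have h1 : L.shift ∈ L.carrier := L.mem_iff.2 ⟨0, by simp⟩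
  rw [L.omega_eq h1 (L.mem_dual_iff.2 ⟨k, mul_div_cancel₀ _ L.step_ne_zero⟩)]
  push_cast
  rfl

theorem rapidCoeff_fourier (f : Test) : RapidCoeff fun l : L.carrier => fourier f l := by
  intro k
  obtain ⟨u, hu, hf⟩ := f.exists_tsupport_subset
  obtain ⟨m, D, hD, hb⟩ := (rapidFamily_fourier L).bound u hu (k + 2)
  refine Summable.of_nonneg_of_le (fun l => by positivity) (fun l => ?_)
    (L.summable_one_add_abs.mul_left (D * cNorm m f))
  have h1 : 0 < 1 + |(l : ℝ)| := by positivity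
  refine (mul_le_mul_of_nonneg_right (hb f hf l l.2) (by positivity)).trans (le_of_eq ?_)
  rw [pow_add]
  field_simp

/-- The coefficients of the Fourier expansion of a quasi-periodic distribution. -/
def fourierCoeffs (T : Test → ℂ) (l : L.carrier) : ℂ :=
  |L.step| * T (smoothMul (wave l) (contDiff_wave l) (unitTest L))

variable {L}

theorem fourierCoeffs_mem {T : Test → ℂ} (hT : T ∈ RDist) : fourierCoeffs L T ∈ coeffSpace L := by
  obtain ⟨u, hu, hχ⟩ := (unitTest L).exists_tsupport_subset
  obtain ⟨m, C, hC, hb⟩ := exists_bound_of_mem_RDist hT hu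
  have hn := cNorm_nonneg m (unitTest L)
  refine mem_coeffSpace_iff.2 ⟨|L.step| * (C * ((m + 1) * (2 ^ m * (2 * Real.pi) ^ m
    * cNorm m (unitTest L)))), m, by positivity, fun l => ?_⟩
  have hB : ∀ k ≤ m, ∀ x, ‖iteratedDeriv k (wave l) x‖
    ≤ (2 * Real.pi) ^ m * (1 + |(l : ℝ)|) ^ m := by
    intro k hk x
    have h1 := norm_iteratedDeriv_const_mul_wave_le k 1 l x
    simp only [one_mul, norm_one] at h1
    have h2 : (1 : ℝ) ≤ 2 * Real.pi := by linarith [Real.pi_gt_three]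
    exact h1.trans (mul_le_mul (pow_le_pow_right₀ h2 hk)
      (pow_le_pow_right₀ (by linarith [abs_nonneg (l : ℝ)]) hk) (by positivity) (by positivity))
  have h1 := hb (smoothMul (wave l) (contDiff_wave l) (unitTest L))
    ((tsupport_smoothMul_subset _ _ _).trans hχ)
  have h2 := mul_le_mul_of_nonneg_left (cNorm_smoothMul_le (contDiff_wave l) (unitTest L)
    (by positivity) fun k hk x _ => hB k hk x) hC.le
  rw [fourierCoeffs, norm_mul, norm_real, Real.norm_eq_abs, abs_abs]
  refine (mul_le_mul_of_nonneg_left (h1.trans h2) (abs_nonneg _)).trans (le_of_eq ?_)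
  ring

/-- A quasi-periodic distribution is the sum of its Fourier series. By quasi-periodicity, the terms of
a decomposition of `f` by a partition of unity are moved to the support of `unitTest L`, where the
sum of the translates of `f` is a series of exponentials by Poisson summation. -/
theorem PeriodicDist.map_eq {T : Test → ℂ} (hT : T ∈ PeriodicDist L) (f : Test) :
    T f = ∑' l : L.carrier, fourierCoeffs L T l * fourier f l := by
  have h0 := L.step_ne_zero
  obtain ⟨u, hu, hf⟩ := f.exists_tsupport_subset
  obtain ⟨K, hK⟩ := exists_nat_ge (|L.step| * u + 2)
  -- `f` is a finite sum of the products of `f` and the translates of `unitTest L`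
  have e1 : f = ∑ k ∈ intBall K, (1 : ℂ) • translate (k / L.step)
      (smoothMul (translate (-(k / L.step)) f) (translate (-(k / L.step)) f).smooth (unitTest L)) := by
    ext x
    rw [Test.sum_apply]
    have : ∀ k : ℤ, ((1 : ℂ) • translate (k / L.step) (smoothMul (translate (-(k / L.step)) f)
        (translate (-(k / L.step)) f).smooth (unitTest L))) x
          = f x * unitTest L (x + k / L.step) := by
      intro k
      rw [one_smul]
      change f (x + k / L.step + -(k / L.step)) * unitTest L (x + k / L.step) = _
      rw [add_neg_cancel_right]
    simp only [this]
    rw [← Finset.mul_sum]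
    by_cases hx : u < |x|
    · rw [Test.eq_zero_of_lt hf hx, zero_mul]
    · rw [sum_unitTest, mul_one]
      rw [abs_mul]
      have := mul_le_mul_of_nonneg_left (not_lt.1 hx) (abs_nonneg L.step)
      linarith
  have e2 : ∀ k : ℤ, T (translate (k / L.step)
      (smoothMul (translate (-(k / L.step)) f) (translate (-(k / L.step)) f).smooth (unitTest L)))
      = L.omega (-(k / L.step)) * T (smoothMul (translate (-(k / L.step)) f)
        (translate (-(k / L.step)) f).smooth (unitTest L)) := fun k =>
    hT.2 _ (L.mem_dual_iff.2 ⟨k, mul_div_cancel₀ _ h0⟩) _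
  have e3 : smoothMul (waveSum fun l : L.carrier => fourier f l) (rapidCoeff_fourier L f).contDiff
      (unitTest L) = ((|L.step| : ℝ) : ℂ)⁻¹ • ∑ k ∈ intBall K, L.omega (-(k / L.step)) •
        smoothMul (translate (-(k / L.step)) f) (translate (-(k / L.step)) f).smooth
          (unitTest L) := by
    ext x
    have h1 : ((|L.step| : ℝ) : ℂ) ≠ 0 := by simpa using h0
    change waveSum _ x * unitTest L x = ((|L.step| : ℝ) : ℂ)⁻¹ * (∑ k ∈ intBall K,
      L.omega (-(k / L.step)) • smoothMul (translate (-(k / L.step)) f)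
        (translate (-(k / L.step)) f).smooth (unitTest L)) x
    rw [Test.sum_apply, eq_inv_mul_iff_mul_eq₀ h1, ← mul_assoc, ← tsum_translate_eq_waveSum]
    have h2 : ∀ k : ℤ, (L.omega (-(k / L.step)) • smoothMul (translate (-(k / L.step)) f)
        (translate (-(k / L.step)) f).smooth (unitTest L)) x
        = L.omega ((-k : ℤ) / L.step) * f (x + (-k : ℤ) / L.step) * unitTest L x := by
      intro k
      change L.omega (-(k / L.step)) * (f (x + -(k / L.step)) * unitTest L x) = _
      push_cast
      rw [neg_div, mul_assoc]
    simp only [h2, omega_period]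
    by_cases hx : 2 ≤ |L.step * x|
    · rw [unitTest_eq_zero L hx]
      simp
    · rw [← Finset.sum_mul, ← (Equiv.neg ℤ).tsum_eq]
      congr 1
      refine tsum_eq_sum fun k hk => ?_
      rw [Equiv.neg_apply, Test.eq_zero_of_lt hf, mul_zero]
      have hk1 : (K : ℝ) < |(k : ℝ)| := by
        have : (K : ℤ) < |k| := by
          rw [intBall, Finset.mem_Icc, ← abs_le, not_le] at hk
          exact hk
        exact_mod_cast this
      have hh : 0 < |L.step| := abs_pos.2 h0
      rw [← mul_lt_mul_iff_right₀ hh, ← abs_mul, mul_add, mul_div_cancel₀ _ h0]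
      push_cast
      have := abs_sub_abs_le_abs_sub (k : ℝ) (L.step * x)
      rw [abs_sub_comm] at this
      rw [← sub_eq_add_neg]
      linarith [not_le.1 hx]
  have e4 := map_smoothMul_waveSum hT.1 (unitTest L) (rapidCoeff_fourier L f)
  rw [e3, hT.1.1.map_smul, map_test_sum hT.1.1, smul_eq_mul] at e4
  conv_lhs => rw [e1]
  rw [map_test_sum hT.1.1]
  simp only [e2, one_mul]
  have h1 : ((|L.step| : ℝ) : ℂ) ≠ 0 := by simpa using h0
  rw [inv_mul_eq_iff_eq_mul₀ h1, ← tsum_mul_left] at e4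
  rw [e4]
  congr 1
  funext l
  rw [fourierCoeffs]
  ring

end Poisson

section Uniqueness

variable (L : ShiftedLattice)

/-- The derivative of the smooth step `S(hx)`. -/
def stepDeriv : Test :=
  mkTest (deriv fun x : ℝ => (Real.smoothTransition (L.step * x) : ℂ))
    (contDiff_infty_iff_deriv.1 (ofRealCLM.contDiff.comp
      (Real.smoothTransition.contDiff.comp (contDiff_const.mul contDiff_id)))).2
    (by
      have h0 := abs_pos.2 L.step_ne_zero
      refine HasCompactSupport.of_support_subset_isCompact
        (isCompact_Icc (a := -(2 / |L.step|)) (b := 2 / |L.step|)) fun x hx => ?_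
      by_contra hx'
      refine hx ?_
      have h1 : 2 < |L.step * x| := by
        rw [abs_mul, ← div_lt_iff₀' h0]
        by_contra h2
        exact hx' (abs_le.1 (not_lt.1 h2))
      have hc : Continuous fun y : ℝ => L.step * y := by fun_prop
      rcases lt_abs.1 h1 with h2 | h2
      · have : (fun x : ℝ => (Real.smoothTransition (L.step * x) : ℂ)) =ᶠ[𝓝 x] fun _ => 1 := by
          filter_upwards [hc.continuousAt.eventually_const_lt h2] with y hy
          rw [Real.smoothTransition.one_of_one_le (by linarith), ofReal_one]
        rw [this.deriv_eq, deriv_const]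
      · have : (fun x : ℝ => (Real.smoothTransition (L.step * x) : ℂ)) =ᶠ[𝓝 x] fun _ => 0 := by
          filter_upwards [hc.continuousAt.eventually_lt_const (show L.step * x < -2 by linarith)]
            with y hy
          rw [Real.smoothTransition.zero_of_nonpos (by linarith), ofReal_zero]
        rw [this.deriv_eq, deriv_const])

theorem derivT_unitTest (x : ℝ) :
    derivT (unitTest L) x = stepDeriv L x + (-1) * stepDeriv L (x - 1 / L.step) := by
  have h0 := L.step_ne_zero
  set σ : ℝ → ℂ := fun x : ℝ => (Real.smoothTransition (L.step * x) : ℂ) with hσ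
  have hd : Differentiable ℝ σ := (ofRealCLM.contDiff.comp
    ((Real.smoothTransition.contDiff (n := ⊤)).comp
      (contDiff_const.mul contDiff_id))).differentiable (by simp)
  have e : (unitTest L : ℝ → ℂ) = fun x => σ x - σ (x - 1 / L.step) := by
    funext y
    rw [unitTest_apply, ofReal_sub, hσ]
    simp only
    rw [mul_sub, mul_one_div_cancel h0]
  have hd2 : DifferentiableAt ℝ (fun x => σ (x - 1 / L.step)) x := by
    have := hd.comp (differentiable_id.sub_const (1 / L.step))
    exact this x
  rw [derivT_apply, e, deriv_fun_sub (hd x) hd2, deriv_comp_sub_const]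
  change _ = deriv σ x + (-1) * deriv σ (x - 1 / L.step)
  ring

/-- The derivative of `unitTest L` is a difference of translates by a period, so its Fourier transform
vanishes at the multiples of the step. -/
theorem fourier_unitTest_of_ne {n : ℤ} (hn : n ≠ 0) : fourier (unitTest L) (L.step * n) = 0 := by
  have h0 := L.step_ne_zero
  have h1 := fourier_derivT (unitTest L) (L.step * n)
  have h2 : fourier (derivT (unitTest L)) (L.step * n) = 0 := by
    rw [show (derivT (unitTest L) : ℝ → ℂ) = fun x => stepDeriv L x
      + (-1) * stepDeriv L (x - 1 / L.step) from funext (derivT_unitTest L),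
      fourier_add (stepDeriv L).integrable
        (((stepDeriv L).integrable.comp_sub_right (1 / L.step)).const_mul _), fourier_smul,
      fourier_comp_sub]
    have : cexp (2 * Real.pi * I * (L.step * n : ℝ) * (1 / L.step : ℝ)) = 1 := by
      rw [Complex.exp_eq_one_iff]
      refine ⟨n, ?_⟩
      have : (L.step : ℂ) ≠ 0 := by exact_mod_cast h0
      push_cast
      field_simp
    rw [this]
    ring
  rw [h2] at h1
  have h3 : (-(2 * Real.pi * I * (L.step * n : ℝ)) : ℂ) ≠ 0 := by
    simp [h0, hn, Real.pi_ne_zero]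
  exact (mul_eq_zero.1 h1.symm).resolve_left h3

theorem fourier_unitTest_zero : fourier (unitTest L) 0 ≠ 0 := by
  have h0 := L.step_ne_zero
  rw [fourier_zero]
  set r : ℝ → ℝ := fun x => Real.smoothTransition (L.step * x)
    - Real.smoothTransition (L.step * x - 1) with hr
  have e : (unitTest L : ℝ → ℂ) = fun x => (r x : ℂ) := funext (unitTest_apply L)
  rw [e, integral_complex_ofReal]
  have hc : Continuous r := by
    have := Real.smoothTransition.continuous
    fun_prop
  have hs : HasCompactSupport r := by
    have := (unitTest L).hasCompactSupport.comp_left (g := Complex.re) Complex.zero_re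
    rw [e] at this
    exact this
  have hp : 0 < ∫ x, r x := by
    refine hc.integral_pos_of_hasCompactSupport_nonneg_nonzero hs (x := 1 / L.step) (fun x => ?_) ?_
    · exact sub_nonneg.2 (Real.smoothTransition.monotone (by linarith))
    · simp [hr, h0]
  exact_mod_cast hp.ne'

theorem fourier_smoothMul_wave (l y : ℝ) (f : Test) :
    fourier (smoothMul (wave l) (contDiff_wave l) f) y = fourier f (y - l) := by
  rw [fourier, fourier]
  congr 1
  funext x
  rw [smoothMul_apply, wave, mul_comm (cexp _), mul_assoc, ← Complex.exp_add]
  congr 2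
  push_cast
  ring

variable {L}

/-- The coefficients of a Fourier expansion are determined by the distribution. -/
theorem coeff_unique {α α' : L.carrier → ℂ} (h : ∀ f : Test,
    ∑' l : L.carrier, α l * fourier f l = ∑' l : L.carrier, α' l * fourier f l) : α = α' := by
  funext l₀
  have key : ∀ γ : L.carrier → ℂ, ∑' l : L.carrier, γ l
      * fourier (smoothMul (wave l₀) (contDiff_wave l₀) (unitTest L)) l
      = γ l₀ * fourier (unitTest L) 0 := by
    intro γ
    rw [tsum_eq_single l₀, fourier_smoothMul_wave, sub_self]
    intro l hl
    obtain ⟨k, rfl⟩ := L.param.surjective l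
    obtain ⟨k₀, rfl⟩ := L.param.surjective l₀
    have hk : k - k₀ ≠ 0 := fun h => hl (by rw [sub_eq_zero.1 h])
    rw [fourier_smoothMul_wave, L.param_apply, L.param_apply,
      show L.shift + L.step * k - (L.shift + L.step * k₀) = L.step * ((k - k₀ : ℤ) : ℝ) by
        push_cast; ring, fourier_unitTest_of_ne L hk, mul_zero]
  -- the Fourier transform of this test function vanishes on `L` off `l₀`
  have := h (smoothMul (wave l₀) (contDiff_wave l₀) (unitTest L))
  rw [key, key] at this
  exact mul_right_cancel₀ (fourier_unitTest_zero L) this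

end Uniqueness

/-! ### Distributions supported at the origin -/

theorem deltaR_cutoff (n : ℕ) : deltaR n cutoff = if n = 0 then 1 else 0 := by
  have h : (cutoff : ℝ → ℂ) =ᶠ[𝓝 0] fun _ => 1 := by
    filter_upwards [Metric.closedBall_mem_nhds (0 : ℝ) one_pos] with x hx
    exact cutoff_eq_one (by simpa using hx)
  rw [deltaR, h.iteratedDeriv_eq n, iteratedDeriv_const]
  split_ifs with h0
  · simp [h0]
  · simp

/-- The test function equal to `x ^ k` near the origin. -/
def powTest (k : ℕ) : Test := mulX^[k] cutoff

theorem powTest_apply (k : ℕ) (x : ℝ) : powTest k x = (x : ℂ) ^ k * cutoff x := by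
  induction k with
  | zero => simp [powTest]
  | succ k ih =>
    rw [powTest, Function.iterate_succ_apply', mulX_apply, ← powTest, ih]
    ring

theorem deltaR_powTest (k n : ℕ) :
    deltaR n (powTest k) = if n = k then (-1) ^ k * (k.factorial : ℂ) else 0 := by
  induction k generalizing n with
  | zero =>
    rw [powTest, Function.iterate_zero, id, deltaR_cutoff]
    simp
  | succ k ih =>
    rw [powTest, Function.iterate_succ_apply', deltaR_mulX, ← powTest, ih]
    rcases n with _ | n
    · simp
    · simp only [Nat.add_sub_cancel, Nat.add_right_cancel_iff]
      split_ifs with h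
      · rw [h, Nat.factorial_succ]
        push_cast
        ring
      · simp

theorem sum_deltaR_powTest (β : ℕ →₀ ℂ) (k : ℕ) :
    (β.sum fun m b => b * deltaR m (powTest k)) = β k * ((-1) ^ k * (k.factorial : ℂ)) := by
  rw [Finsupp.sum, Finset.sum_eq_single k]
  · rw [deltaR_powTest, if_pos rfl]
  · intro m _ hm
    rw [deltaR_powTest, if_neg hm, mul_zero]
  · intro hk
    rw [Finsupp.notMem_support_iff.1 hk, zero_mul]

theorem deltaCoeff_unique {β β' : ℕ →₀ ℂ} (h : ∀ f : Test,
    (β.sum fun m b => b * deltaR m f) = β'.sum fun m b => b * deltaR m f) : β = β' := by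
  ext k
  have := h (powTest k)
  rw [sum_deltaR_powTest, sum_deltaR_powTest] at this
  refine mul_right_cancel₀ (mul_ne_zero (pow_ne_zero _ (by norm_num)) ?_) this
  exact_mod_cast k.factorial_ne_zero

/-- A smooth function that vanishes to order `m` at the origin satisfies Taylor bounds. -/
theorem norm_iteratedDeriv_le_of_flat (m : ℕ) (f : Test) (h : ∀ j ≤ m, iteratedDeriv j f 0 = 0)
    (j : ℕ) : ∀ k : ℕ, k + j = m + 1 → ∀ x : ℝ,
      ‖iteratedDeriv k f x‖ ≤ cNorm (m + 1) f * |x| ^ j := by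
  induction j with
  | zero =>
    intro k hk x
    rw [pow_zero, mul_one]
    exact norm_iteratedDeriv_le_cNorm f (by omega) x
  | succ j ih =>
    intro k hk x
    have hd : ∀ y : ℝ, DifferentiableAt ℝ (iteratedDeriv k f) y := fun y => by
      rw [← derivT_iterate]
      exact (derivT^[k] f).differentiable y
    have hb : ∀ y ∈ Set.Icc (-|x|) |x|,
        ‖deriv (iteratedDeriv k f) y‖ ≤ cNorm (m + 1) f * |x| ^ j := by
      intro y hy
      rw [← iteratedDeriv_succ]
      refine (ih (k + 1) (by omega) y).trans ?_
      have := cNorm_nonneg (m + 1) f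
      have := abs_le.2 hy
      gcongr
    have := (convex_Icc (-|x|) |x|).norm_image_sub_le_of_norm_deriv_le (fun y _ => hd y) hb
      (x := 0) (y := x) (by simp) ⟨neg_abs_le x, le_abs_self x⟩
    rw [h k (by omega), sub_zero, sub_zero, Real.norm_eq_abs] at this
    rw [pow_succ, ← mul_assoc]
    exact this

/-- The rescaled cutoff `χ(x / ε)`. -/
def scaledCutoff (ε : ℝ) (x : ℝ) : ℂ := cutoff (ε⁻¹ * x)

theorem contDiff_scaledCutoff (ε : ℝ) : ContDiff ℝ ∞ (scaledCutoff ε) :=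
  cutoff.smooth.comp (contDiff_const.mul contDiff_id)

theorem norm_iteratedDeriv_scaledCutoff_le {ε : ℝ} (hε : 0 < ε) {m k : ℕ} (hk : k ≤ m) (x : ℝ) :
    ‖iteratedDeriv k (scaledCutoff ε) x‖ ≤ (ε ^ k)⁻¹ * cNorm m cutoff := by
  have e : iteratedDeriv k (scaledCutoff ε) = fun x => ε⁻¹ ^ k • iteratedDeriv k cutoff (ε⁻¹ * x) :=
    iteratedDeriv_comp_const_smul (cutoff.smooth.of_le (by exact_mod_cast le_top)) ε⁻¹
  rw [e, norm_smul, norm_pow, norm_inv, Real.norm_of_nonneg hε.le, inv_pow]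
  exact mul_le_mul_of_nonneg_left (norm_iteratedDeriv_le_cNorm cutoff hk _) (by positivity)

/-- A distribution supported at the origin kills the test functions that vanish at the origin
to its order. -/
theorem map_eq_zero_of_flat {T : Test → ℂ} (hT : T ∈ RDist)
    (h0 : ∀ f : Test, (0 : ℝ) ∉ tsupport f → T f = 0) :
    ∃ m : ℕ, ∀ f : Test, (∀ j ≤ m, iteratedDeriv j f 0 = 0) → T f = 0 := by
  obtain ⟨m, C, hC, hb⟩ := exists_bound_of_mem_RDist hT (u := 2) (by norm_num)
  refine ⟨m, fun f hf => ?_⟩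
  set A := C * ((m + 1) * (2 ^ m * cNorm m cutoff * (cNorm (m + 1) f * 2 ^ (m + 1)))) with hA
  have n1 := cNorm_nonneg m cutoff
  have n2 := cNorm_nonneg (m + 1) f
  have key : ∀ ε : ℝ, 0 < ε → ε ≤ 1 → ‖T f‖ ≤ A * ε := by
    intro ε hε hε1
    set g := smoothMul (scaledCutoff ε) (contDiff_scaledCutoff ε) f with hg
    -- `T` only sees the values of `f` near the origin
    have e1 : T f = T g := by
      have h1 : T (f + (-1 : ℂ) • g) = 0 := by
        refine h0 _ ?_
        rw [notMem_tsupport_iff_eventuallyEq]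
        filter_upwards [Metric.closedBall_mem_nhds (0 : ℝ) hε] with x hx
        change f x + (-1) * (scaledCutoff ε x * f x) = 0
        rw [scaledCutoff, cutoff_eq_one, one_mul]
        · ring
        · have hx' : |x| ≤ ε := by simpa using hx
          rw [abs_mul, abs_inv, abs_of_pos hε, inv_mul_le_iff₀ hε, mul_one]
          exact hx'
      rw [hT.1.map_add, hT.1.map_smul, smul_eq_mul] at h1
      linear_combination h1
    have hz : ∀ x, 2 * ε < |x| → g x = 0 := by
      intro x hx
      rw [hg, smoothMul_apply, scaledCutoff, cutoff_eq_zero, zero_mul]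
      rw [abs_mul, abs_inv, abs_of_pos hε, inv_mul_eq_div, le_div_iff₀ hε]
      exact hx.le
    have hsupp := tsupport_subset_Icc hz
    rw [e1]
    refine (hb g (hsupp.trans (Set.Icc_subset_Icc (by linarith) (by linarith)))).trans ?_
    rw [hA, mul_assoc]
    refine mul_le_mul_of_nonneg_left ?_ hC.le
    rw [mul_assoc]
    refine cNorm_le fun k hk x => ?_
    by_cases hx : x ∈ Set.Icc (-(2 * ε)) (2 * ε)
    · have hx' : |x| ≤ 2 * ε := abs_le.2 hx
      refine (norm_iteratedDeriv_mul_le (contDiff_scaledCutoff ε) f.smooth k x).trans ?_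
      calc ∑ i ∈ Finset.range (k + 1), (k.choose i : ℝ) * ‖iteratedDeriv i (scaledCutoff ε) x‖
            * ‖iteratedDeriv (k - i) f x‖
          ≤ ∑ i ∈ Finset.range (k + 1), (k.choose i : ℝ)
            * (cNorm m cutoff * (cNorm (m + 1) f * 2 ^ (m + 1)) * ε) := by
            refine Finset.sum_le_sum fun i hi => ?_
            have hi' : i ≤ k := Nat.lt_succ_iff.1 (Finset.mem_range.1 hi)
            have h1 := norm_iteratedDeriv_scaledCutoff_le hε (hi'.trans hk) x
            -- the flatness of `f` beats the derivatives of the cutoff by one power of `ε`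
            have h2 := norm_iteratedDeriv_le_of_flat m f hf (m + 1 - (k - i)) (k - i) (by omega) x
            rw [mul_assoc]
            refine mul_le_mul_of_nonneg_left ?_ (Nat.cast_nonneg _)
            have h3 : |x| ^ (m + 1 - (k - i)) ≤ 2 ^ (m + 1) * (ε ^ i * ε) := by
              calc |x| ^ (m + 1 - (k - i)) ≤ (2 * ε) ^ (m + 1 - (k - i)) := by gcongr
                _ = 2 ^ (m + 1 - (k - i)) * ε ^ (m + 1 - (k - i)) := mul_pow _ _ _
                _ ≤ 2 ^ (m + 1) * ε ^ (i + 1) := by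
                    refine mul_le_mul (pow_le_pow_right₀ (by norm_num) (by omega))
                      (pow_le_pow_of_le_one hε.le hε1 (by omega)) (by positivity) (by positivity)
                _ = _ := by rw [pow_succ ε]
            calc ‖iteratedDeriv i (scaledCutoff ε) x‖ * ‖iteratedDeriv (k - i) f x‖
                ≤ ((ε ^ i)⁻¹ * cNorm m cutoff) * (cNorm (m + 1) f * (2 ^ (m + 1) * (ε ^ i * ε))) :=
                  by
                  refine mul_le_mul h1 (h2.trans (mul_le_mul_of_nonneg_left h3 n2)) (norm_nonneg _)
                    (by positivity)
              _ = _ := by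
                  field_simp
        _ = 2 ^ k * (cNorm m cutoff * (cNorm (m + 1) f * 2 ^ (m + 1)) * ε) := by
            rw [← Finset.sum_mul]
            congr 1
            exact_mod_cast Nat.sum_range_choose k
        _ ≤ 2 ^ m * (cNorm m cutoff * (cNorm (m + 1) f * 2 ^ (m + 1)) * ε) := by
            gcongr
            norm_num
        _ = _ := by ring
    · have : iteratedDeriv k g x = 0 :=
        image_eq_zero_of_notMem_tsupport fun h => hx (hsupp (tsupport_iteratedDeriv_subset _ k h))
      rw [this, norm_zero]
      positivity
  have hlim : Tendsto (fun ε : ℝ => A * ε) (𝓝[>] 0) (𝓝 0) := by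
    have : Tendsto (fun ε : ℝ => A * ε) (𝓝 0) (𝓝 (A * 0)) := tendsto_id.const_mul A
    rw [mul_zero] at this
    exact this.mono_left nhdsWithin_le_nhds
  have := ge_of_tendsto hlim (b := ‖T f‖) (by
    filter_upwards [Ioc_mem_nhdsGT (one_pos : (0 : ℝ) < 1)] with ε hε
    exact key ε hε.1 hε.2)
  exact norm_le_zero_iff.1 this

/-- A distribution supported at the origin is a finite combination of derivatives of the delta
distribution. -/
theorem exists_eq_sum_deltaR {T : Test → ℂ} (hT : T ∈ RDist)
    (h0 : ∀ f : Test, (0 : ℝ) ∉ tsupport f → T f = 0) :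
    ∃ β : ℕ →₀ ℂ, ∀ f : Test, T f = β.sum fun m b => b * deltaR m f := by
  obtain ⟨m, hm⟩ := map_eq_zero_of_flat hT h0
  -- `(e j)⁻¹ * deltaR j f` is the `j`-th Taylor coefficient of `f` at the origin
  set e : ℕ → ℂ := fun j => (-1) ^ j * (j.factorial : ℂ) with he
  have he0 : ∀ j, e j ≠ 0 := fun j =>
    mul_ne_zero (pow_ne_zero _ (by norm_num)) (by exact_mod_cast j.factorial_ne_zero)
  refine ⟨Finsupp.onFinset (Finset.range (m + 1))
    (fun j => if j < m + 1 then (e j)⁻¹ * T (powTest j) else 0) (fun j hj => ?_), fun f => ?_⟩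
  · by_contra h
    rw [Finset.mem_range] at h
    exact hj (if_neg h)
  · rw [Finsupp.onFinset_sum _ fun _ => zero_mul _]
    set g : Test := ∑ j ∈ Finset.range (m + 1), ((e j)⁻¹ * deltaR j f) • powTest j with hg
    have hδ : ∀ k ≤ m, deltaR k g = deltaR k f := by
      intro k hk
      have hl : IsLinearMap ℂ fun f : Test => deltaR k f :=
        ⟨fun f g => deltaR_add k f g, fun c f => deltaR_smul k c f⟩
      have h1 := map_test_sum hl (Finset.range (m + 1)) (fun j => (e j)⁻¹ * deltaR j f) powTest
      rw [← hg] at h1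
      rw [h1, Finset.sum_eq_single k]
      · rw [deltaR_powTest, if_pos rfl, mul_right_comm, inv_mul_cancel₀ (he0 k), one_mul]
      · intro j _ hj
        rw [deltaR_powTest, if_neg (Ne.symm hj), mul_zero]
      · intro hk'
        exact absurd (Finset.mem_range.2 (Nat.lt_succ_of_le hk)) hk'
    have h1 : T (f + (-1 : ℂ) • g) = 0 := by
      refine hm _ fun j hj => ?_
      have h2 : deltaR j (f + (-1 : ℂ) • g : Test) = 0 := by
        rw [deltaR_add, deltaR_smul, hδ j hj]
        ring
      rw [deltaR] at h2
      exact (mul_eq_zero.1 h2).resolve_left (pow_ne_zero _ (by norm_num))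
    rw [hT.1.map_add, hT.1.map_smul, smul_eq_mul, hg, map_test_sum hT.1] at h1
    have h2 : T f = ∑ j ∈ Finset.range (m + 1), (e j)⁻¹ * deltaR j f * T (powTest j) := by
      linear_combination h1
    rw [h2]
    refine Finset.sum_congr rfl fun j hj => ?_
    rw [if_pos (Finset.mem_range.1 hj)]
    ring

/-! ### Existence of the expansion -/

section Existence

variable {μ ν : ℂ} {L : ShiftedLattice}

/-- A test function with support off the origin is embedded in the same way in both charts. -/
theorem flip_iota_of_notMem (f : Test) (hf : (0 : ℝ) ∉ tsupport f) :
    flip (iota μ ν f) = iota μ ν (testInv μ ν f hf) := by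
  refine PS.ext_of_chart fun x => ?_
  rw [chart_flip_iota, chart_iota, extInv_eq_testInv]

theorem iota_eq_flip_iota (f : Test) (hf : (0 : ℝ) ∉ tsupport f) :
    iota μ ν f = flip (iota μ ν (testInv μ ν f hf)) := by
  rw [← flip_iota_of_notMem f hf, flip_flip]

theorem isLinearMap_distInv {lam : PS μ ν → ℂ} (h : IsLinearMap ℂ lam) :
    IsLinearMap ℂ (distInv lam) :=
  ⟨fun F G => by rw [distInv, distInv, distInv, flip_add, h.map_add],
    fun c F => by rw [distInv, distInv, flip_smul, h.map_smul]⟩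

theorem distInv_distInv (lam : PS μ ν → ℂ) : distInv (distInv lam) = lam := by
  funext F
  rw [distInv, distInv, flip_flip]

/-- A linear functional is the sum of its restrictions to the two charts. -/
theorem map_eq_toRDist {lam : PS μ ν → ℂ} (h : IsLinearMap ℂ lam) (F : PS μ ν) :
    lam F = toRDist lam (part₁ F) + toRDist (distInv lam) (part₂ F) := by
  conv_lhs => rw [← isPartition_part F]
  rw [h.map_add]
  rfl

theorem ext_of_toRDist {lam lam' : PS μ ν → ℂ} (h : IsLinearMap ℂ lam) (h' : IsLinearMap ℂ lam')
    (h1 : ∀ f, toRDist lam f = toRDist lam' f)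
    (h2 : ∀ f, toRDist (distInv lam) f = toRDist (distInv lam') f) : lam = lam' := by
  funext F
  rw [map_eq_toRDist h, map_eq_toRDist h', h1, h2]

/-- A functional whose restriction to the big cell is quasi-periodic has a Fourier expansion. -/
theorem exists_eq_expansion {lam : PS μ ν → ℂ} (h : IsLinearMap ℂ lam)
    (h1 : toRDist lam ∈ PeriodicDist L) (h2 : toRDist (distInv lam) ∈ RDist) :
    ∃ α ∈ coeffSpace L, ∃ β : ℕ →₀ ℂ, lam = expansion L μ ν α β := by
  have hα := fourierCoeffs_mem (L := L) h1.1
  set α := fourierCoeffs L (toRDist lam) with hαd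
  have hT := PeriodicDist.map_eq h1
  -- the difference is supported at the origin, as the two charts overlap elsewhere
  have hD : (fun f => toRDist (distInv lam) f
      + (-1) * ∑' l : L.carrier, α l * twistedFourier μ ν f l) ∈ RDist :=
    RDist_add h2 (RDist_smul ((rapidFamily_twistedFourier L μ ν).tsum_mem_RDist hα) (-1))
  obtain ⟨β, hβ⟩ := exists_eq_sum_deltaR hD fun f hf => by
    have e1 : toRDist (distInv lam) f = toRDist lam (testInv μ ν f hf) := by
      rw [toRDist, distInv, flip_iota_of_notMem f hf]
      rfl
    rw [e1, hT]
    simp only [twistedFourier_of_notMem μ ν f hf]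
    rw [← hαd]
    ring
  refine ⟨α, hα, β, ext_of_toRDist h (isLinearMap_expansion hα β) (fun f => ?_) fun f => ?_⟩
  · rw [toRDist_expansion, hT]
  · rw [toRDist_distInv_expansion, ← hβ]
    ring

/-- The coefficients of an expansion are unique. No growth condition is needed, as the test functions
in the proof of `coeff_unique` see only one coefficient. -/
theorem expansion_injective {α α' : L.carrier → ℂ} {β β' : ℕ →₀ ℂ}
    (h : expansion L μ ν α β = expansion L μ ν α' β') : α = α' ∧ β = β' := by
  have h1 : α = α' := coeff_unique fun f => by
    rw [← toRDist_expansion (μ := μ) (ν := ν) α β, h, toRDist_expansion]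
  subst h1
  refine ⟨rfl, deltaCoeff_unique fun f => ?_⟩
  have h2 : toRDist (distInv (expansion L μ ν α β)) f
      = toRDist (distInv (expansion L μ ν α β')) f := by rw [h]
  rw [toRDist_distInv_expansion, toRDist_distInv_expansion] at h2
  exact add_left_cancel h2

end Existence

/-! ### Continuity in terms of the two charts -/

section Continuity

variable {μ ν : ℂ}

theorem rhoEp_iterate (k : ℕ) (F : PS μ ν) : (rhoEp^[k] F).1 = (rhoGen .Ep)^[k] F.1 := by
  induction k with
  | zero => rfl
  | succ k ih =>
    rw [Function.iterate_succ_apply', Function.iterate_succ_apply', ← ih]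
    rfl

theorem tk_zero : tk 0 = 1 := by
  refine Cover.ext ?_ rfl
  ext i j
  fin_cases i <;> fin_cases j <;> simp [tk, Cover.one_g]

theorem ta_one : ta 1 one_pos = 1 := by
  refine Cover.ext ?_ rfl
  ext i j
  fin_cases i <;> fin_cases j <;> simp [ta, Cover.one_g]

theorem iwasawa_rotation (θ : ℝ) : iwasawa (0, 0, θ) = tk θ := by
  have h1 : ta (Real.exp 0) (Real.exp_pos _) = 1 := by
    rw [← ta_one]
    congr 1
    exact Real.exp_zero
  simp only [iwasawa, h1, tu_zero, one_mul]

theorem norm_le_normK (F : PS μ ν) {θ : ℝ} (hθ : θ ∈ Set.Ico (-Real.pi) Real.pi) :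
    ‖F.1 (tk θ)‖ ≤ normK F.1 := by
  have hc : Continuous fun θ : ℝ => F.1 (tk θ) := by
    have h : Continuous fun p => F.1 (iwasawa p) := F.2.2.continuous
    have h2 := h.comp (f := fun θ : ℝ => ((0, 0, θ) : ℝ × ℝ × ℝ)) (by fun_prop)
    refine h2.congr fun θ => ?_
    simp only [Function.comp, iwasawa_rotation]
  obtain ⟨B, hB⟩ := isCompact_Icc.exists_bound_of_continuousOn
    (s := Set.Icc (-Real.pi) Real.pi) hc.continuousOn
  have hbdd : BddAbove (Set.range fun θ : Set.Ico (-Real.pi) Real.pi => ‖F.1 (tk θ)‖) := by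
    refine ⟨B, ?_⟩
    rintro _ ⟨θ, rfl⟩
    exact hB θ (Set.Ico_subset_Icc_self θ.2)
  exact le_ciSup hbdd ⟨θ, hθ⟩

theorem normK_nonneg (F : Cover → ℂ) : 0 ≤ normK F := Real.iSup_nonneg fun _ => norm_nonneg _

theorem norm_apply_le (F : PS μ ν) {a : Cover} (hθ : a.θ ∈ Set.Ico (-Real.pi) Real.pi) :
    ‖F.1 a‖ ≤ (a.g • UpperHalfPlane.I : ℍ).im ^ (ν + 1 / 2).re * normK F.1 := by
  have hy := UpperHalfPlane.im_pos (a.g • UpperHalfPlane.I : ℍ)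
  have h := F.2.1 (a.g • UpperHalfPlane.I : ℍ).re _ hy 0 (tk a.θ)
  rw [Int.cast_zero, zero_mul, tk_zero, mul_one, ← iwasawa_decomp a] at h
  rw [h, norm_mul, norm_mul, norm_cpow_eq_rpow_re_of_pos hy]
  simp only [Int.cast_zero, mul_zero, zero_mul, Complex.exp_zero, norm_one, one_mul]
  exact mul_le_mul_of_nonneg_left (norm_le_normK F hθ) (by positivity)

theorem im_smul_I (a : Cover) :
    (a.g • UpperHalfPlane.I : ℍ).im = 1 / (a.g 1 0 ^ 2 + a.g 1 1 ^ 2) := by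
  rw [← UpperHalfPlane.coe_im, coe_smul_eq, UpperHalfPlane.coe_I, Complex.div_im]
  have hdet : a.g 0 0 * a.g 1 1 - a.g 0 1 * a.g 1 0 = 1 := by
    have := a.g.det_coe
    rwa [Matrix.det_fin_two] at this
  have hn : Complex.normSq (J a.g I) = a.g 1 0 ^ 2 + a.g 1 1 ^ 2 := by
    rw [Complex.normSq_apply]
    simp [J]
    ring
  rw [hn, ← sub_div]
  congr 1
  simp [J]
  linarith

theorem rpow_le_of_mem {x : ℝ} (hx : |x| ≤ 2) (s : ℝ) : (1 / (1 + x ^ 2)) ^ s ≤ 5 ^ |s| := by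
  have h1 : x ^ 2 ≤ 4 := by
    rw [← sq_abs]
    nlinarith [abs_nonneg x]
  have h0 : 0 < 1 + x ^ 2 := by positivity
  rw [one_div, Real.inv_rpow h0.le, ← Real.rpow_neg h0.le]
  calc (1 + x ^ 2) ^ (-s) ≤ (1 + x ^ 2) ^ |s| :=
        Real.rpow_le_rpow_of_exponent_le (by nlinarith [sq_nonneg x]) (neg_le_abs s)
    _ ≤ 5 ^ |s| := Real.rpow_le_rpow h0.le (by linarith) (abs_nonneg s)

theorem arg_I_sub_mem (x : ℝ) : 0 < arg (I - x) ∧ arg (I - x) < Real.pi := by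
  constructor
  · refine lt_of_le_of_ne (arg_nonneg_iff.2 (by simp)) fun h => ?_
    have := (arg_eq_zero_iff.1 h.symm).2
    simp at this
  · refine lt_of_le_of_ne (arg_le_pi _) fun h => ?_
    have := (arg_eq_pi_iff.1 h).2
    simp at this

theorem norm_chart_le (F : PS μ ν) {x : ℝ} (hx : |x| ≤ 2) :
    ‖chart F.1 x‖ ≤ 5 ^ |(ν + 1 / 2).re| * normK F.1 := by
  obtain ⟨h1, h2⟩ := arg_I_sub_mem x
  refine (norm_apply_le F (a := tw * tu (-x)) ?_).trans ?_
  · rw [twtu_θ]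
    exact ⟨by linarith, by linarith⟩
  · refine mul_le_mul_of_nonneg_right ?_ (normK_nonneg _)
    rw [im_smul_I, twtu_g]
    simpa using rpow_le_of_mem hx (ν + 1 / 2).re

theorem tubar_mul_tw (x : ℝ) : tubar x * tw = tw * tu (-x) := by simp [tubar]

theorem tubar_θ (x : ℝ) : (tubar x).θ = Real.pi / 2 - arg (I - x) := by
  have h := congrArg Cover.θ (tubar_mul_tw x)
  rw [Cover.mul_θ, twtu_θ, tw_θ] at h
  have h1 : (tw.g • UpperHalfPlane.I : ℍ) = (I : ℂ) := by
    rw [coe_smul_eq]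
    simp [J, tw_g, neg_div]
  have h2 := J_ne_zero (tubar x).g UpperHalfPlane.I
  rw [UpperHalfPlane.coe_I] at h2
  rw [h1, div_self h2, arg_one] at h
  linarith

theorem norm_tubar_le (F : PS μ ν) {x : ℝ} (hx : |x| ≤ 2) :
    ‖F.1 (tubar x)‖ ≤ 5 ^ |(ν + 1 / 2).re| * normK F.1 := by
  obtain ⟨h1, h2⟩ := arg_I_sub_mem x
  have hpi := Real.pi_pos
  refine (norm_apply_le F (a := tubar x) ?_).trans ?_
  · rw [tubar_θ]
    exact ⟨by linarith, by linarith⟩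
  · refine mul_le_mul_of_nonneg_right ?_ (normK_nonneg _)
    have e10 : (tubar x).g 1 0 = x := by
      have := congrArg (fun a : Cover => a.g 1 1) (tubar_mul_tw x)
      simp only [mul_entry] at this
      simp [tw_g, tu] at this
      exact this
    have e11 : (tubar x).g 1 1 = 1 := by
      have := congrArg (fun a : Cover => a.g 1 0) (tubar_mul_tw x)
      simp only [mul_entry] at this
      simp [tw_g, tu] at this
      exact this
    rw [im_smul_I, e10, e11, one_pow, add_comm]
    exact rpow_le_of_mem hx _

/-- Conjugation by the Weyl element turns `E₊` into `-E₋`. -/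
theorem rhoGen_Ep_mul_tw (k : ℕ) (H : Cover → ℂ) (c : ℂ) (a : Cover) :
    (rhoGen .Ep)^[k] (fun a => c * H (a * tw)) a
      = c * ((-1) ^ k * (rhoGen .Em)^[k] H (a * tw)) := by
  have hcomm : ∀ t : ℝ, tu t * tw = tw * tubar (-t) := by
    intro t
    rw [tubar, neg_neg, eq_comm, ← mul_assoc, ← mul_assoc, mul_inv_eq_iff_eq_mul, mul_assoc _ tw tw,
      tw_mul_tw_comm]
  induction k generalizing a with
  | zero => simp
  | succ k ih =>
    rw [Function.iterate_succ_apply', Function.iterate_succ_apply',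
      show (rhoGen .Ep)^[k] (fun a => c * H (a * tw))
        = fun a => c * ((-1) ^ k * (rhoGen .Em)^[k] H (a * tw)) from funext ih]
    change deriv (fun t : ℝ => c * ((-1) ^ k * (rhoGen .Em)^[k] H (a * tu t * tw))) 0
      = c * ((-1) ^ (k + 1) * deriv (fun t : ℝ => (rhoGen .Em)^[k] H (a * tw * tubar t)) 0)
    rw [deriv_const_mul_field, deriv_const_mul_field]
    have e : (fun t : ℝ => (rhoGen .Em)^[k] H (a * tu t * tw))
        = fun t : ℝ => (fun t : ℝ => (rhoGen .Em)^[k] H (a * tw * tubar t)) (-t) := by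
      funext t
      simp only [mul_assoc, hcomm]
    rw [e, deriv_comp_neg (fun t : ℝ => (rhoGen .Em)^[k] H (a * tw * tubar t)), neg_zero]
    ring

theorem rhoGen_Em_iterate (k : ℕ) (F : PS μ ν) : (rhoGen .Em)^[k] F.1
    = ((cexp (-(Real.pi * I * μ / 2)) * (-1) ^ k) • rho tw⁻¹ (rhoEp^[k] (flip F))).1 := by
  funext a
  change _ = (cexp (-(Real.pi * I * μ / 2)) * (-1) ^ k) * (rhoEp^[k] (flip F)).1 (a * tw⁻¹)
  rw [rhoEp_iterate]
  have h := rhoGen_Ep_mul_tw k F.1 (cexp (Real.pi * I * μ / 2)) (a * tw⁻¹)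
  rw [inv_mul_cancel_right] at h
  rw [show (flip F).1 = fun a => cexp (Real.pi * I * μ / 2) * F.1 (a * tw) from
    funext (flip_apply F), h]
  have e1 : cexp (-(Real.pi * I * μ / 2)) * cexp (Real.pi * I * μ / 2) = 1 := by
    rw [← Complex.exp_add, neg_add_cancel, Complex.exp_zero]
  have e2 : ((-1 : ℂ) ^ k) * (-1) ^ k = 1 := by
    rw [← mul_pow]
    simp
  generalize (rhoGen .Em)^[k] F.1 a = z
  linear_combination (-z * (-1) ^ k * (-1) ^ k) * e1 - z * e2

/-- The word `X ⋯ X` of length `k` as an element of the enveloping algebra. -/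
def powWord (X : Gen) (k : ℕ) : List Gen →₀ ℂ := Finsupp.single (List.replicate k X) 1

theorem rhoU_powWord (X : Gen) (k : ℕ) (F : Cover → ℂ) :
    rhoU (powWord X k) F = (rhoGen X)^[k] F := by
  funext a
  rw [rhoU, powWord, Finsupp.sum_single_index (by simp), one_mul]
  have e : (List.replicate k X).foldr rhoGen F = (rhoGen X)^[k] F := by
    induction k with
    | zero => rfl
    | succ k ih => rw [List.replicate_succ, List.foldr_cons, ih, Function.iterate_succ_apply']
  rw [e]

theorem norm_iteratedDeriv_chart_le (F : PS μ ν) (k : ℕ) {x : ℝ} (hx : |x| ≤ 2) :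
    ‖iteratedDeriv k (chart F.1) x‖
      ≤ 5 ^ |(ν + 1 / 2).re| * normK (rhoU (powWord .Ep k) F.1) := by
  have h := chart_rhoGen_Ep_iterate k F.1 x
  have h2 := norm_chart_le (rhoEp^[k] F) hx
  rw [rhoEp_iterate, h, norm_mul, norm_pow, norm_neg, norm_one, one_pow, one_mul] at h2
  rw [rhoU_powWord]
  exact h2

theorem norm_iteratedDeriv_chart_flip_le (F : PS μ ν) (k : ℕ) {x : ℝ} (hx : |x| ≤ 2) :
    ‖iteratedDeriv k (chart (flip F).1) x‖ ≤ ‖cexp (-(Real.pi * I * μ / 2))‖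
      * (5 ^ |(ν + 1 / 2).re| * normK (rhoU (powWord .Em k) F.1)) := by
  have h := chart_rhoGen_Ep_iterate k (flip F).1 x
  set G : PS μ ν := (cexp (-(Real.pi * I * μ / 2)) * (-1) ^ k) • rho tw⁻¹ (rhoEp^[k] (flip F))
    with hG
  have h2 := norm_tubar_le G hx
  have e : (rhoGen .Em)^[k] F.1 = G.1 := rhoGen_Em_iterate k F
  have h3 := rhoGen_Ep_mul_tw k F.1 (cexp (Real.pi * I * μ / 2)) (tw * tu (-x))
  rw [← show (flip F).1 = fun a => cexp (Real.pi * I * μ / 2) * F.1 (a * tw) from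
    funext (flip_apply F), e, ← tubar_mul_tw, apply_mul_tw_tw, tubar_mul_tw] at h3
  have h4 : iteratedDeriv k (chart (flip F).1) x
    = cexp (-(Real.pi * I * μ / 2)) * G.1 (tubar x) := by
    rw [chart, h3] at h
    have e1 : cexp (Real.pi * I * μ / 2) * cexp (-(Real.pi * I * μ))
        = cexp (-(Real.pi * I * μ / 2)) := by
      rw [← Complex.exp_add]
      ring_nf
    have e2 : ((-1 : ℂ) ^ k) * (-1) ^ k = 1 := by
      rw [← mul_pow]
      simp
    rw [← e1]
    linear_combination (-(-1 : ℂ) ^ k) * h + (cexp (Real.pi * I * μ / 2)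
      * cexp (-(Real.pi * I * μ)) * G.1 (tubar x) - iteratedDeriv k (chart (flip F).1) x) * e2
  rw [h4, norm_mul, rhoU_powWord, e]
  exact mul_le_mul_of_nonneg_left h2 (norm_nonneg _)

theorem tsupport_cutoff : tsupport cutoff ⊆ Set.Icc (-2) 2 :=
  tsupport_subset_Icc fun _ hx => cutoff_eq_zero hx.le

theorem tsupport_coCutoff : tsupport coCutoff ⊆ Set.Icc (-2) 2 := by
  refine tsupport_subset_Icc fun x hx => ?_
  have hx0 : x ≠ 0 := by
    rintro rfl
    norm_num at hx
  rw [coCutoff_apply hx0, cutoff_eq_one, sub_self]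
  rw [abs_div, abs_neg, abs_one, div_le_one (by linarith)]
  linarith

theorem exists_cNorm_smoothMul_le {χ : Test} (hχ : tsupport χ ⊆ Set.Icc (-2) 2) (m : ℕ) :
    ∃ C : ℝ, 0 ≤ C ∧ ∀ (ψ : ℝ → ℂ) (h : ContDiff ℝ ∞ ψ) (B : ℝ), 0 ≤ B →
      (∀ k ≤ m, ∀ x, |x| ≤ 2 → ‖iteratedDeriv k ψ x‖ ≤ B) → cNorm m (smoothMul ψ h χ) ≤ C * B := by
  have := cNorm_nonneg m χ
  refine ⟨(m + 1) * (2 ^ m * cNorm m χ), by positivity, fun ψ h B hB0 hB => ?_⟩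
  refine (cNorm_smoothMul_le h χ hB0 fun k hk x hx => hB k hk x (abs_le.2 (hχ hx))).trans
    (le_of_eq ?_)
  ring

/-- A linear functional on `I_{μ,ν}^∞` is continuous as soon as its restrictions to the two charts
are distributions. -/
theorem mem_PSDist {lam : PS μ ν → ℂ} (h : IsLinearMap ℂ lam) (h1 : toRDist lam ∈ RDist)
    (h2 : toRDist (distInv lam) ∈ RDist) : lam ∈ PSDist μ ν := by
  classical
  obtain ⟨m₁, C₁, hC₁, hb₁⟩ := exists_bound_of_mem_RDist h1 (u := 2) (by norm_num)
  obtain ⟨m₂, C₂, hC₂, hb₂⟩ := exists_bound_of_mem_RDist h2 (u := 2) (by norm_num)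
  obtain ⟨D₁, hD₁, hd₁⟩ := exists_cNorm_smoothMul_le tsupport_cutoff m₁
  obtain ⟨D₂, hD₂, hd₂⟩ := exists_cNorm_smoothMul_le tsupport_coCutoff m₂
  -- derivatives in the two charts are the actions of powers of `E₊` and of `E₋`
  set S : Finset (List Gen →₀ ℂ) := (Finset.range (m₁ + 1)).image (powWord .Ep)
    ∪ (Finset.range (m₂ + 1)).image (powWord .Em) with hS
  set K : ℝ := 5 ^ |(ν + 1 / 2).re| with hK
  have hK0 : 0 < K := by positivity
  set E : ℝ := ‖cexp (-(Real.pi * I * μ / 2))‖ with hE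
  have hE0 : 0 < E := norm_pos_iff.2 (Complex.exp_ne_zero _)
  refine ⟨h, C₁ * (D₁ * K) + C₂ * (D₂ * (E * K)) + 1, by positivity, S, fun F => ?_⟩
  set N : ℝ := ∑ X ∈ S, normK (rhoU X F.1) with hN
  have hN0 : 0 ≤ N := Finset.sum_nonneg fun _ _ => normK_nonneg _
  have hle : ∀ X ∈ S, normK (rhoU X F.1) ≤ N := fun X hX =>
    Finset.single_le_sum (f := fun X => normK (rhoU X F.1)) (fun _ _ => normK_nonneg _) hX
  have b1 : ‖toRDist lam (part₁ F)‖ ≤ C₁ * (D₁ * (K * N)) := by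
    refine (hb₁ _ ((tsupport_smoothMul_subset _ _ _).trans tsupport_cutoff)).trans ?_
    refine mul_le_mul_of_nonneg_left ?_ hC₁.le
    refine hd₁ _ _ (K * N) (by positivity) fun k hk x hx => ?_
    refine (norm_iteratedDeriv_chart_le F k hx).trans (mul_le_mul_of_nonneg_left (hle _ ?_) hK0.le)
    exact Finset.mem_union_left _ (Finset.mem_image_of_mem _
      (Finset.mem_range.2 (Nat.lt_succ_of_le hk)))
  have b2 : ‖toRDist (distInv lam) (part₂ F)‖ ≤ C₂ * (D₂ * (E * (K * N))) := by
    refine (hb₂ _ ((tsupport_smoothMul_subset _ _ _).trans tsupport_coCutoff)).trans ?_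
    refine mul_le_mul_of_nonneg_left ?_ hC₂.le
    refine hd₂ _ _ (E * (K * N)) (by positivity) fun k hk x hx => ?_
    refine (norm_iteratedDeriv_chart_flip_le F k hx).trans (mul_le_mul_of_nonneg_left
      (mul_le_mul_of_nonneg_left (hle _ ?_) hK0.le) hE0.le)
    exact Finset.mem_union_right _ (Finset.mem_image_of_mem _
      (Finset.mem_range.2 (Nat.lt_succ_of_le hk)))
  rw [map_eq_toRDist h]
  refine (norm_add_le _ _).trans ((add_le_add b1 b2).trans ?_)
  rw [← sub_nonneg]
  refine le_of_le_of_eq hN0 ?_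
  ring

end Continuity

/-! ### Averages of monomial sections -/

/-- The first nonvanishing Taylor coefficient from the leading asymptotics. -/
theorem deltaR_of_tendsto {t : ℂ} (k : ℕ) (f : Test)
    (h : Tendsto (fun x : ℝ => f x / (x : ℂ) ^ k) (𝓝[≠] 0) (𝓝 t)) :
    ∀ j ≤ k, deltaR j f = if j = k then (-1) ^ k * (k.factorial : ℂ) * t else 0 := by
  induction k generalizing f with
  | zero =>
    intro j hj
    obtain rfl : j = 0 := by omega
    have h1 : Tendsto f (𝓝[≠] 0) (𝓝 (f 0)) :=
      f.smooth.continuous.continuousAt.tendsto.mono_left nhdsWithin_le_nhds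
    simp only [pow_zero, div_one] at h
    simp [deltaR, tendsto_nhds_unique h1 h]
  | succ k ih =>
    intro j hj
    have h1 : Tendsto f (𝓝[≠] 0) (𝓝 (f 0)) :=
      f.smooth.continuous.continuousAt.tendsto.mono_left nhdsWithin_le_nhds
    have hx : Tendsto (fun x : ℝ => (x : ℂ) ^ (k + 1)) (𝓝[≠] 0) (𝓝 0) := by
      have : Continuous fun x : ℝ => (x : ℂ) ^ (k + 1) := by fun_prop
      have h2 := this.tendsto 0
      simp only [ofReal_zero, ne_eq, Nat.succ_ne_zero, not_false_eq_true, zero_pow] at h2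
      exact h2.mono_left nhdsWithin_le_nhds
    have hf0 : f 0 = 0 := by
      refine tendsto_nhds_unique h1 ?_
      have h2 := h.mul hx
      rw [mul_zero] at h2
      refine h2.congr' ?_
      filter_upwards [self_mem_nhdsWithin] with x hx0
      exact div_mul_cancel₀ _ (pow_ne_zero _ (by exact_mod_cast hx0))
    -- Hadamard's quotient `f(x) / x`
    set q : ℝ → ℂ := fun x => ∫ s in (0 : ℝ)..1, deriv f (x * s) with hq
    have hqs : ContDiff ℝ ∞ q := contDiff_intervalIntegral
      (H := fun p : ℝ × ℝ => deriv f (p.1 * p.2))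
      ((derivT f).smooth.comp (contDiff_fst.mul contDiff_snd)) 0 1
    have hxq : ∀ x : ℝ, f x = x * q x := by
      intro x
      have hd : ∀ s ∈ Set.uIcc (0 : ℝ) 1,
          HasDerivAt (fun s : ℝ => f (x * s)) (x * deriv f (x * s)) s := by
        intro s _
        have h2 := HasDerivAt.scomp s (f.differentiable (x * s)).hasDerivAt
          ((hasDerivAt_id s).const_mul x)
        rw [mul_one, real_smul] at h2
        exact h2
      have hc : Continuous fun s : ℝ => (x : ℂ) * deriv f (x * s) := by
        have := (derivT f).smooth.continuous
        exact continuous_const.mul (this.comp (continuous_const.mul continuous_id))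
      have h2 := intervalIntegral.integral_eq_sub_of_hasDerivAt hd (hc.intervalIntegrable _ _)
      rw [intervalIntegral.integral_const_mul, mul_one, mul_zero, hf0, sub_zero] at h2
      exact h2.symm
    set g : Test := smoothMul q hqs cutoff with hg
    have hev : ∀ᶠ x : ℝ in 𝓝 0, f x = mulX g x ∧ cutoff x = 1 := by
      filter_upwards [Metric.closedBall_mem_nhds (0 : ℝ) one_pos] with x hx
      have hc : cutoff x = 1 := cutoff_eq_one (by simpa using hx)
      rw [mulX_apply, hg, smoothMul_apply, hc, mul_one]
      exact ⟨hxq x, rfl⟩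
    have hlim : Tendsto (fun x : ℝ => g x / (x : ℂ) ^ k) (𝓝[≠] 0) (𝓝 t) := by
      refine h.congr' ?_
      filter_upwards [self_mem_nhdsWithin, nhdsWithin_le_nhds hev] with x hx0 hx1
      have hx0' : (x : ℂ) ≠ 0 := by exact_mod_cast hx0
      rw [hx1.1, mulX_apply, div_eq_div_iff (pow_ne_zero _ hx0') (pow_ne_zero _ hx0')]
      ring
    have he : deltaR j f = deltaR j (mulX g) := by
      rw [deltaR, deltaR]
      congr 1
      exact Filter.EventuallyEq.iteratedDeriv_eq j (hev.mono fun x hx => hx.1)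
    rw [he, deltaR_mulX]
    rcases j with _ | j
    · simp
    · rw [Nat.add_sub_cancel, ih g hlim j (by omega)]
      simp only [Nat.add_right_cancel_iff]
      split_ifs with hjk
      · rw [hjk, Nat.factorial_succ]
        push_cast
        ring
      · simp

theorem Jfac_mul_pos (μ ν : ℂ) {y r : ℝ} (hr : 0 < r) :
    Jfac μ ν (y * r) = Jfac μ ν y * (r : ℂ) ^ (-2 * ν - 1) := by
  have h : Real.sign (y * r) = Real.sign y := by
    rcases lt_trichotomy y 0 with h | rfl | h
    · rw [Real.sign_of_neg h, Real.sign_of_neg (mul_neg_of_neg_of_pos h hr)]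
    · rw [zero_mul]
    · rw [Real.sign_of_pos h, Real.sign_of_pos (mul_pos h hr)]
  rw [Jfac, Jfac, h, abs_mul, abs_of_pos hr, ofReal_mul,
    mul_cpow_ofReal_nonneg (abs_nonneg y) hr.le]
  ring

theorem norm_cpow_le_two_rpow {r : ℝ} (h1 : 1 / 2 ≤ r) (h2 : r ≤ 2) (s : ℂ) :
    ‖(r : ℂ) ^ s‖ ≤ 2 ^ |s.re| := by
  have hr : 0 < r := by linarith
  rw [norm_cpow_eq_rpow_re_of_pos hr]
  rcases le_total 0 s.re with h | h
  · rw [abs_of_nonneg h]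
    exact Real.rpow_le_rpow hr.le h2 h
  · rw [abs_of_nonpos h, ← inv_inv r, Real.inv_rpow (by positivity),
    ← Real.rpow_neg (by positivity)]
    refine Real.rpow_le_rpow (by positivity) ?_ (by linarith)
    rw [inv_le_comm₀ hr (by norm_num)]
    linarith

/-- The kernel is the ratio of the translate of `x ^ k` by `ũ(τ)` in the second chart and `x ^ k`. -/
theorem tendsto_average_kernel (s : ℂ) (k : ℕ) (t : ℝ) :
    Tendsto (fun x : ℝ => ∫ τ in (0 : ℝ)..t, ((1 + τ * x : ℝ) : ℂ) ^ s
      * (((1 + τ * x : ℝ) : ℂ)⁻¹) ^ k)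
      (𝓝[≠] 0) (𝓝 t) := by
  have h := intervalIntegral.tendsto_integral_filter_of_dominated_convergence
    (μ := volume) (a := 0) (b := t) (l := 𝓝[≠] (0 : ℝ))
    (F := fun (x τ : ℝ) => ((1 + τ * x : ℝ) : ℂ) ^ s * (((1 + τ * x : ℝ) : ℂ)⁻¹) ^ k)
    (f := fun _ => (1 : ℂ)) (fun _ => 2 ^ |s.re| * 2 ^ k) ?_ ?_ ?_ ?_
  · simpa using h
  · refine Eventually.of_forall fun x => Measurable.aestronglyMeasurable ?_
    have h1 : Measurable fun τ : ℝ => ((1 + τ * x : ℝ) : ℂ) := by fun_prop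
    exact (h1.pow_const s).mul (h1.inv.pow_const k)
  · have : {x : ℝ | |x| < 1 / (2 * (|t| + 1))} ∈ 𝓝[≠] (0 : ℝ) := by
      refine nhdsWithin_le_nhds ((isOpen_lt continuous_abs continuous_const).mem_nhds ?_)
      simp only [Set.mem_ofPred_eq, abs_zero]
      positivity
    filter_upwards [this] with x hx
    refine Eventually.of_forall fun τ hτ => ?_
    have hτ' : |τ| ≤ |t| := by
      have := Set.abs_sub_left_of_mem_uIcc (Set.uIoc_subset_uIcc hτ)
      simpa using this
    have hx' : |τ * x| ≤ 1 / 2 := by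
      have hx2 : |x| < 1 / (2 * (|t| + 1)) := hx
      rw [lt_div_iff₀ (by positivity)] at hx2
      rw [abs_mul]
      nlinarith [abs_nonneg x, abs_nonneg τ]
    obtain ⟨h1, h2⟩ := abs_le.1 hx'
    rw [norm_mul, norm_pow, norm_inv, norm_real, Real.norm_of_nonneg (by linarith)]
    refine mul_le_mul (norm_cpow_le_two_rpow (by linarith) (by linarith) s) ?_ (by
      have : 0 < 1 + τ * x := by linarith
      positivity) (by positivity)
    have h3 : (1 + τ * x)⁻¹ ≤ 2 := by
      rw [inv_le_comm₀ (by linarith) (by norm_num)]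
      linarith
    have h4 : 0 ≤ (1 + τ * x)⁻¹ := inv_nonneg.2 (by linarith)
    gcongr
  · exact intervalIntegrable_const
  · refine Eventually.of_forall fun τ _ => ?_
    have h1 : ContinuousAt (fun x : ℝ => ((1 + τ * x : ℝ) : ℂ)) 0 := by fun_prop
    have h2 : ContinuousAt (fun x : ℝ => ((1 + τ * x : ℝ) : ℂ) ^ s
      * (((1 + τ * x : ℝ) : ℂ)⁻¹) ^ k) 0 :=
      (h1.cpow continuousAt_const (by simp)).mul ((h1.inv₀ (by simp)).pow k)
    have h3 := h2.tendsto.mono_left (nhdsWithin_le_nhds (s := {0}ᶜ))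
    simpa using h3

section Monomial

variable {μ ν : ℂ}

/-- The section that is equal to `x ^ k` near the origin of the second chart. -/
def monomialSection (μ ν : ℂ) (k : ℕ) : PS μ ν := flip (iota μ ν (powTest k))

theorem deltaInf_monomialSection (k m : ℕ) : deltaInf m (monomialSection μ ν k)
    = if m = k then (-1) ^ k * (k.factorial : ℂ) else 0 := by
  rw [monomialSection, deltaInf_flip_iota, deltaR_powTest]

/-- In the second chart `ũ(τ)` acts by `x ↦ x / (1 + τ x)`, which fixes the origin and has derivative
`1` there, so that averaging over `[0, t]` multiplies the leading coefficient by `t`. -/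
theorem tendsto_chart_flip_average (k : ℕ) (t : ℝ) :
    Tendsto (fun x : ℝ => part₂ (average t (monomialSection μ ν k)) x / (x : ℂ) ^ k)
      (𝓝[≠] 0) (𝓝 t) := by
  refine (tendsto_average_kernel (-2 * ν - 1) k t).congr' ?_
  have hev : {x : ℝ | |x| < 1 / (2 * (|t| + 1))} ∈ 𝓝[≠] (0 : ℝ) := by
    refine nhdsWithin_le_nhds ((isOpen_lt continuous_abs continuous_const).mem_nhds ?_)
    simp only [Set.mem_ofPred_eq, abs_zero]
    positivity
  filter_upwards [self_mem_nhdsWithin, hev] with x hx0 hx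
  have hx0' : x ≠ 0 := hx0
  have hxc : (x : ℂ) ≠ 0 := by exact_mod_cast hx0'
  have hx2 : |x| < 1 / (2 * (|t| + 1)) := hx
  rw [lt_div_iff₀ (by positivity)] at hx2
  have hx3 : |x| ≤ 1 / 2 := by nlinarith [abs_nonneg x, abs_nonneg t]
  have hco : coCutoff x = 1 := by
    rw [coCutoff_apply hx0', cutoff_eq_zero, sub_zero]
    rw [abs_div, abs_neg, abs_one, le_div_iff₀ (abs_pos.2 hx0')]
    linarith
  rw [part₂, smoothMul_apply, hco, mul_one, chart_flip _ hx0', invFun, chart_average,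
    ← intervalIntegral.integral_const_mul, eq_div_iff (pow_ne_zero _ hxc),
    ← intervalIntegral.integral_mul_const]
  refine intervalIntegral.integral_congr fun τ hτ => ?_
  have hτ' : |τ| ≤ |t| := by
    have := Set.abs_sub_left_of_mem_uIcc hτ
    simpa using this
  have hx' : |τ * x| ≤ 1 / 2 := by
    rw [abs_mul]
    nlinarith [abs_nonneg x, abs_nonneg τ]
  obtain ⟨h1, h2⟩ := abs_le.1 hx'
  have hr : 0 < 1 + τ * x := by linarith
  have hrc : ((1 + τ * x : ℝ) : ℂ) ≠ 0 := by exact_mod_cast hr.ne'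
  have ey : -1 / x - τ = -1 / x * (1 + τ * x) := by
    field_simp
    ring
  have hy0 : -1 / x * (1 + τ * x) ≠ 0 := mul_ne_zero (div_ne_zero (by norm_num) hx0') hr.ne'
  have ey2 : -1 / (-1 / x * (1 + τ * x)) = x / (1 + τ * x) := by
    field_simp
  rw [monomialSection, chart_flip_iota, ey, extInv_of_ne _ _ _ hy0, invFun, ey2,
    Jfac_mul_pos μ ν hr, powTest_apply, cutoff_eq_one, mul_one, ← mul_assoc, ← mul_assoc,
    Jfac_mul_Jfac_neg_inv μ ν hx0', one_mul, mul_assoc, ← mul_pow]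
  · congr 2
    push_cast
    rw [div_eq_inv_mul]
  · rw [abs_div, abs_of_pos hr, div_le_one hr]
    linarith

theorem deltaInf_average_monomialSection (t : ℝ) {k m : ℕ} (h : m ≤ k) :
    deltaInf m (average t (monomialSection μ ν k))
      = if m = k then (-1) ^ k * (k.factorial : ℂ) * t else 0 := by
  rw [(isPartition_part _).deltaInf_eq]
  exact deltaR_of_tendsto k _ (tendsto_chart_flip_average k t) m h

end Monomial

/-! ### Equivariance of Fourier expansions -/

/-- A finite triangular system with nonzero diagonal has only the trivial solution. -/
theorem eq_zero_of_triangular (s : Finset ℕ) (c : ℕ → ℂ) (A : ℕ → ℕ → ℂ)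
    (h : ∀ k ∈ s, c k ≠ 0 → ∑ m ∈ s, c m * A k m = 0)
    (hlt : ∀ k ∈ s, c k ≠ 0 → ∀ m ∈ s, c m ≠ 0 → m < k → A k m = 0)
    (hd : ∀ k ∈ s, c k ≠ 0 → A k k ≠ 0) : ∀ k ∈ s, c k = 0 := by
  by_contra! hne
  obtain ⟨k₀, hk₀, hc₀⟩ := hne
  have hne' : (s.filter fun k => c k ≠ 0).Nonempty := ⟨k₀, Finset.mem_filter.2 ⟨hk₀, hc₀⟩⟩
  obtain ⟨k, hk, hmax⟩ := Finset.exists_max_image _ id hne'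
  obtain ⟨hks, hkc⟩ := Finset.mem_filter.1 hk
  have h1 := h k hks hkc
  rw [Finset.sum_eq_single k] at h1
  · exact (mul_ne_zero hkc (hd k hks hkc)) h1
  · intro m hm hmk
    by_cases hcm : c m = 0
    · rw [hcm, zero_mul]
    · have := hmax m (Finset.mem_filter.2 ⟨hm, hcm⟩)
      rw [hlt k hks hkc m hm hcm (lt_of_le_of_ne this hmk), mul_zero]
  · intro h2
    exact absurd hks h2

theorem polarCoeff_eq_zero_iff (μ : ℂ) (n : ℕ) :
    polarCoeff μ n = 0 ↔ ∃ k : ℤ, μ + n - 1 = 2 * k := by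
  have hf : (n.factorial : ℂ) ≠ 0 := by exact_mod_cast n.factorial_ne_zero
  rw [polarCoeff, mul_eq_zero, or_iff_right (pow_ne_zero _ I_ne_zero), div_eq_zero_iff,
    or_iff_left hf, mul_eq_zero, or_iff_right (by norm_num), Complex.cos_eq_zero_iff]
  have hpi : (Real.pi : ℂ) ≠ 0 := by exact_mod_cast Real.pi_ne_zero
  refine exists_congr fun k => ?_
  constructor
  · intro h
    have h2 : (Real.pi : ℂ) * ((n + μ) - (2 * k + 1)) = 0 := by linear_combination 2 * h
    rcases mul_eq_zero.1 h2 with h3 | h3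
    · exact absurd h3 hpi
    · linear_combination h3
  · intro h
    linear_combination Real.pi / 2 * h

section Equivariance

variable {L : ShiftedLattice} {μ ν : ℂ} {α : L.carrier → ℂ} {β : ℕ →₀ ℂ}

theorem rho_eq_add (t : ℝ) (F : PS μ ν) : rho (tu t) F = F + rhoEp (average t F) := by
  rw [rhoEp_average]
  abel

theorem deltaInf_rho (m : ℕ) (t : ℝ) (F : PS μ ν) : deltaInf m (rho (tu t) F)
    = deltaInf m F + m * (2 * ν + m) * deltaInf (m - 1) (average t F) := by
  rw [rho_eq_add, deltaInf_add, deltaInf_rhoEp]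

/-- The defect of the equivariance of a Fourier expansion at a frequency lattice without `0`. -/
theorem expansion_rho_of_notMem (h0 : (0 : ℝ) ∉ L.carrier) {t : ℝ}
    (ht : t ∈ L.dual) (F : PS μ ν) :
    expansion L μ ν α β (rho (tu t) F) - L.omega t * expansion L μ ν α β F
      = ∑ m ∈ β.support, β m * (deltaInf m (rho (tu t) F) - L.omega t * deltaInf m F) := by
  have h1 : ∀ l : L.carrier, α l * jacquet (l : ℝ) (rho (tu t) F)
      = L.omega t * (α l * jacquet (l : ℝ) F) := by
    intro l
    have hl : (l : ℝ) ≠ 0 := fun h => h0 (h ▸ l.2)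
    rw [jacquet_rho_of_ne F hl, L.omega_eq l.2 ht]
    ring
  rw [expansion, expansion]
  simp only [h1, tsum_mul_left, Finsupp.sum, mul_sub, Finset.sum_sub_distrib, mul_add,
    Finset.mul_sum]
  have h2 : ∀ m, L.omega t * (β m * deltaInf m F) = β m * (L.omega t * deltaInf m F) := fun m => by
    ring
  simp only [h2]
  ring

/-- The defect of the equivariance of a Fourier expansion at a frequency lattice with `0`. -/
theorem expansion_rho_of_mem (hα : α ∈ coeffSpace L) (h0 : (0 : ℝ) ∈ L.carrier) {t : ℝ}
    (ht : t ∈ L.dual) (F : PS μ ν) :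
    expansion L μ ν α β (rho (tu t) F) - L.omega t * expansion L μ ν α β F
      = α ⟨0, h0⟩ * jacquet 0 (rhoEp (average t F))
        + ∑ m ∈ β.support, β m * (m * (2 * ν + m) * deltaInf (m - 1) (average t F)) := by
  have hω : L.omega t = 1 := by rw [L.omega_eq h0 ht]; simp
  have h1 : expansion L μ ν α β (rho (tu t) F) - L.omega t * expansion L μ ν α β F
      = expansion L μ ν α β (rhoEp (average t F)) := by
    rw [rho_eq_add, (isLinearMap_expansion hα β).map_add, hω]
    ring
  rw [h1, expansion, tsum_eq_single ⟨0, h0⟩]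
  · simp only [deltaInf_rhoEp, Finsupp.sum]
  · intro l hl
    have hl0 : (l : ℝ) ≠ 0 := fun h => hl (Subtype.ext h)
    have h2 : jacquet (l : ℝ) (rhoEp (average t F)) = 0 := by
      have h3 := jacquet_rho_of_ne F hl0 t
      rw [rho_eq_add, jacquet_add, ← L.omega_eq l.2 ht, hω] at h3
      linear_combination h3
    rw [h2, mul_zero]

theorem exists_omega_ne_one (h0 : (0 : ℝ) ∉ L.carrier) : ∃ t ∈ L.dual, L.omega t ≠ 1 := by
  have hs := L.step_ne_zero
  refine ⟨1 / L.step, L.mem_dual_iff.2 ⟨1, by simp [hs]⟩, fun h => h0 ?_⟩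
  have h1 := omega_period L 1
  rw [Int.cast_one, h, eq_comm, Complex.exp_eq_one_iff] at h1
  obtain ⟨n, hn⟩ := h1
  refine L.mem_iff.2 ⟨-n, ?_⟩
  have hsc : (L.step : ℂ) ≠ 0 := by exact_mod_cast hs
  have h2 : (L.shift : ℂ) * (1 / L.step) = n := by
    apply mul_left_cancel₀ (show (2 * Real.pi * I : ℂ) ≠ 0 by simp [Real.pi_ne_zero])
    rw [← mul_assoc]
    push_cast at hn ⊢
    linear_combination hn
  have h3 : (L.shift : ℂ) = n * L.step := by
    field_simp at h2
    rw [h2, mul_comm]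
  have h4 : L.shift = n * L.step := by exact_mod_cast h3
  rw [h4]
  push_cast
  ring

/-- On the image of `ρ(E₊)` the Jacquet integral of frequency zero is a multiple of `δ_∞^{(n-1)}`. The
multiple is nonzero exactly when `-2ν` is a positive integer and the pole there is genuine. -/
theorem jacquet_zero_rhoEp_cases (μ ν : ℂ) : ∃ (n : ℕ) (κ : ℂ),
    (∀ F : PS μ ν, jacquet 0 (rhoEp F) = -κ * deltaInf (n - 1) F) ∧
    (κ ≠ 0 → 0 < n ∧ -2 * ν = n ∧ ¬ ∃ k : ℤ, μ - 2 * ν - 1 = 2 * k) ∧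
    ((∃ n : ℕ, 0 < n ∧ -2 * ν = n) → (¬ ∃ k : ℤ, μ - 2 * ν - 1 = 2 * k) → κ ≠ 0) := by
  by_cases h : ∃ n : ℕ, -2 * ν = n
  · obtain ⟨n, hn⟩ := h
    have e : μ - 2 * ν - 1 = μ + n - 1 := by rw [← hn]; ring
    rw [e, ← polarCoeff_eq_zero_iff]
    refine ⟨n, n * polarCoeff μ n, fun F => ?_, fun hκ => ?_, ?_⟩
    · rw [jacquet_zero_rhoEp_polar F hn]
      ring
    · obtain ⟨h1, h2⟩ := mul_ne_zero_iff.1 hκ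
      exact ⟨Nat.pos_of_ne_zero (by exact_mod_cast h1), hn, h2⟩
    · rintro ⟨n', hn', hn2⟩ hp
      refine mul_ne_zero ?_ hp
      rw [← hn, hn2]
      exact_mod_cast hn'.ne'
  · push Not at h
    refine ⟨0, 0, fun F => ?_, fun hκ => absurd rfl hκ, ?_⟩
    · rw [jacquet_zero_rhoEp F h]
      ring
    · rintro ⟨n, -, hn⟩
      exact absurd hn (h n)

/-- The conditions on the coefficients are necessary for equivariance: the values of the defect at the
monomial sections form a triangular system. -/
theorem mem_of_equivariant (hα : α ∈ coeffSpace L)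
    (h : ∀ t ∈ L.dual, ∀ F : PS μ ν,
      expansion L μ ν α β (rho (tu t) F) = L.omega t * expansion L μ ν α β F) :
    α ∈ coeffSpace0 L μ ν ∧ β ∈ deltaCoeffs (exponentSet L ν) := by
  classical
  have hfac : ∀ k : ℕ, ((-1 : ℂ) ^ k * (k.factorial : ℂ)) ≠ 0 := fun k =>
    mul_ne_zero (pow_ne_zero _ (by norm_num)) (by exact_mod_cast k.factorial_ne_zero)
  by_cases h0 : (0 : ℝ) ∈ L.carrier
  · have hs := L.step_ne_zero
    set t := 1 / L.step with ht
    have ht0 : (t : ℂ) ≠ 0 := by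
      rw [ht]
      exact_mod_cast one_div_ne_zero hs
    have htd : t ∈ L.dual := L.mem_dual_iff.2 ⟨1, by simp [ht, hs]⟩
    obtain ⟨n, κ, hJ, hκ, hκ'⟩ := jacquet_zero_rhoEp_cases μ ν
    -- the coefficient of `δ_∞^{(m-1)}` of the average in the defect of the equivariance
    set c : ℕ → ℂ := fun m => β m * (m * (2 * ν + m)) - if m = n then α ⟨0, h0⟩ * κ else 0 with hc
    have hc0 : c 0 = 0 := by
      simp only [hc, Nat.cast_zero, zero_mul, mul_zero, zero_sub, neg_eq_zero]
      split_ifs with hn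
      · by_contra hne
        exact absurd (hκ (right_ne_zero_of_mul hne)).1 (by omega)
      · rfl
    have key : ∀ F : PS μ ν, ∑ m ∈ insert n β.support, c m * deltaInf (m - 1) (average t F)
      = 0 := by
      intro F
      have h1 := expansion_rho_of_mem (β := β) hα h0 htd F
      rw [h t htd F, sub_self, hJ] at h1
      have h2 : ∑ m ∈ β.support, β m * (m * (2 * ν + m) * deltaInf (m - 1) (average t F))
          = ∑ m ∈ insert n β.support, β m * (m * (2 * ν + m) * deltaInf (m - 1) (average t F)) := by
        refine Finset.sum_subset (Finset.subset_insert _ _) fun m _ hm => ?_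
        rw [Finsupp.notMem_support_iff.1 hm, zero_mul]
      rw [h2] at h1
      simp only [hc, sub_mul, Finset.sum_sub_distrib, ite_mul, zero_mul]
      rw [Finset.sum_ite_eq' _ n, if_pos (Finset.mem_insert_self _ _)]
      rw [h1]
      simp only [mul_assoc]
      ring
    have hz := eq_zero_of_triangular (insert n β.support) c
      (fun k m => deltaInf (m - 1) (average t (monomialSection μ ν (k - 1))))
      (fun k _ _ => key _)
      (fun k _ hk m _ hm hmk => by
        have hk1 : k ≠ 0 := fun e => hk (e ▸ hc0)
        have hm1 : m ≠ 0 := fun e => hm (e ▸ hc0)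
        rw [deltaInf_average_monomialSection t (by omega), if_neg (by omega)])
      (fun k _ hk => by
        rw [deltaInf_average_monomialSection t le_rfl, if_pos rfl]
        exact mul_ne_zero (hfac _) ht0)
    -- at the exponent `n` the factor `2ν + n` vanishes
    have hακ : α ⟨0, h0⟩ * κ = 0 := by
      by_contra hne
      obtain ⟨-, hn, -⟩ := hκ (right_ne_zero_of_mul hne)
      have h1 := hz n (Finset.mem_insert_self _ _)
      simp only [hc, if_true] at h1
      refine hne ?_
      linear_combination -h1 - β n * n * hn
    refine ⟨⟨hα, fun _ h1 h2 => (mul_eq_zero.1 hακ).resolve_right (hκ' h1 h2)⟩, fun m hm => ?_⟩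
    by_contra hβ
    have h1 := hz m (Finset.mem_insert_of_mem (Finsupp.mem_support_iff.2 hβ))
    simp only [hc, hακ, ite_self, sub_zero] at h1
    refine hm ⟨h0, ?_⟩
    rcases mul_eq_zero.1 ((mul_eq_zero.1 h1).resolve_left hβ) with h2 | h2
    · exact Or.inl (by exact_mod_cast h2)
    · exact Or.inr (by linear_combination h2)
  · refine ⟨⟨hα, fun h1 => absurd h1 h0⟩, fun m _ => ?_⟩
    obtain ⟨t, htd, hω⟩ := exists_omega_ne_one h0
    have hz := eq_zero_of_triangular β.support β
      (fun k m => deltaInf m (rho (tu t) (monomialSection μ ν k))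
        - L.omega t * deltaInf m (monomialSection μ ν k))
      (fun k _ _ => by
        rw [← expansion_rho_of_notMem h0 htd, h t htd, sub_self])
      (fun k _ _ m _ _ hmk => by
        rw [deltaInf_rho, deltaInf_average_monomialSection t (by omega), if_neg (by omega),
          deltaInf_monomialSection, if_neg hmk.ne]
        ring)
      (fun k _ _ => by
        have e : (k : ℂ) * (2 * ν + k) * deltaInf (k - 1) (average t (monomialSection μ ν k))
          = 0 := by
          rcases k with _ | k
          · simp
          · rw [deltaInf_average_monomialSection t (by omega), if_neg (by omega), mul_zero]
        rw [deltaInf_rho, e, deltaInf_monomialSection, if_pos rfl, add_zero, ← one_sub_mul]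
        exact mul_ne_zero (sub_ne_zero.2 (Ne.symm hω)) (hfac k))
    by_cases hm : m ∈ β.support
    · exact hz m hm
    · exact Finsupp.notMem_support_iff.1 hm

theorem equivariant_of_mem (hα : α ∈ coeffSpace0 L μ ν) (hβ : β ∈ deltaCoeffs (exponentSet L ν))
    {t : ℝ} (ht : t ∈ L.dual) (F : PS μ ν) :
    expansion L μ ν α β (rho (tu t) F) = L.omega t * expansion L μ ν α β F := by
  rw [← sub_eq_zero]
  by_cases h0 : (0 : ℝ) ∈ L.carrier
  · rw [expansion_rho_of_mem hα.1 h0 ht]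
    obtain ⟨n, κ, hJ, hκ, -⟩ := jacquet_zero_rhoEp_cases μ ν
    have hακ : α ⟨0, h0⟩ * κ = 0 := by
      by_cases hk : κ = 0
      · rw [hk, mul_zero]
      · obtain ⟨h1, h2, h3⟩ := hκ hk
        rw [hα.2 h0 ⟨n, h1, h2⟩ h3, zero_mul]
    rw [hJ, Finset.sum_eq_zero fun m _ => ?_]
    · linear_combination -(deltaInf (n - 1) (average t F)) * hακ
    · by_cases hm : m ∈ exponentSet L ν
      · rcases hm.2 with h1 | h1
        · simp [h1]
        · linear_combination β m * m * deltaInf (m - 1) (average t F) * h1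
      · rw [hβ m hm, zero_mul]
  · rw [expansion_rho_of_notMem h0 ht]
    refine Finset.sum_eq_zero fun m _ => ?_
    rw [hβ m fun hm => h0 hm.1, zero_mul]

end Equivariance

/-! ### The polynomial sections -/

section Polynomial

variable {μ ν : ℂ} {n : ℕ}

theorem mul_deriv_extInv (f : Test) {x : ℝ} (hx : x ≠ 0) :
    x * deriv (extInv μ ν f) x = extInv μ ν (eulerT ν f) x := by
  have hxc : (x : ℂ) ≠ 0 := by exact_mod_cast hx
  rw [deriv_extInv]
  beta_reduce
  rw [extInv_of_ne _ _ _ hx, extInv_of_ne _ _ _ hx, invFun, invFun, Jfac_shift μ ν hx]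
  generalize eulerT ν f (-1 / x) = A
  field_simp
  linear_combination (-(A * Jfac μ ν x)) * I_sq

theorem fourier_zero_mulX_derivT (f : Test) : fourier (mulX (derivT f)) 0 = -fourier f 0 := by
  have e : derivT (mulX f) = f + mulX (derivT f) := by
    ext x
    have h1 : HasDerivAt (fun x : ℝ => (x : ℂ) * f x) (1 * f x + x * deriv f x) x :=
      (hasDerivAt_id' x).ofReal_comp.mul (f.differentiable x).hasDerivAt
    change deriv (fun x : ℝ => (x : ℂ) * f x) x = f x + x * deriv f x
    rw [h1.deriv, one_mul]
  have h := fourier_derivT (mulX f) 0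
  rw [e, fourier_test_add] at h
  simp only [ofReal_zero, mul_zero, neg_zero, zero_mul] at h
  linear_combination h

/-- Where the continuation has no pole, the Jacquet integral of frequency zero is homogeneous, so
it vanishes on the sections that are homogeneous of another degree. -/
theorem jacquet_zero_of_homogeneous (hν : -2 * ν = n) (hR : polarCoeff μ n = 0) (F : PS μ ν) {k : ℕ}
    (hk : ∀ x : ℝ, x * deriv (chart F.1) x = k * chart F.1 x) : jacquet 0 F = 0 := by
  have h := isPartition_part F
  set f₁ := part₁ F
  set f₂ := part₂ F
  have hp : IsPartition (((n : ℂ) - 1 - k) • F)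
      (((n : ℂ) - 1) • f₁ + (-1 : ℂ) • mulX (derivT f₁), mulX (derivT f₂)) := by
    refine PS.ext_of_chart fun x => ?_
    rw [chart_add, chart_iota, chart_flip_iota, chart_smul]
    have h1 : deriv (chart F.1) x = deriv f₁ x + deriv (extInv μ ν f₂) x := by
      rw [show chart F.1 = (f₁ : ℝ → ℂ) + extInv μ ν f₂ from funext h.chart_eq]
      exact deriv_add f₁.differentiable.differentiableAt
        ((contDiff_extInv μ ν f₂).differentiable (by simp) x)
    have h2 := hk x
    have h3 := h.chart_eq x
    have e1 : (((n : ℂ) - 1) • f₁ + (-1 : ℂ) • mulX (derivT f₁) : Test) x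
        = ((n : ℂ) - 1) * f₁ x + (-1) * (x * deriv f₁ x) := rfl
    simp only at h3
    rw [e1]
    by_cases hx : x = 0
    · subst hx
      rw [extInv_zero] at h3 ⊢
      rw [ofReal_zero, zero_mul] at h2
      rw [ofReal_zero]
      linear_combination -h2 - ((n : ℂ) - 1) * h3
    · have h4 := mul_deriv_extInv (μ := μ) (ν := ν) f₂ hx
      have e2 : extInv μ ν (eulerT ν f₂) x
          = -(2 * ν + 1) * extInv μ ν f₂ x - extInv μ ν (mulX (derivT f₂)) x := by
        rw [eulerT, extInv_add, extInv_smul, extInv_smul]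
        ring
      rw [e2] at h4
      rw [h1] at h2
      linear_combination -h2 + h4 - ((n : ℂ) - 1) * h3 + extInv μ ν f₂ x * hν
  have h1 := hp.jacquet_eq 0
  simp only at h1
  rw [jacquet_smul, fourier_test_add, fourier_test_smul, fourier_test_smul,
    fourier_zero_mulX_derivT, twistedFourier_mulX_derivT_polar _ hν hR] at h1
  have h2 := h.jacquet_eq 0
  simp only at h2
  have h3 : ((k : ℂ) + 1) * jacquet 0 F = 0 := by linear_combination -h1 + (n : ℂ) * h2
  exact (mul_eq_zero.1 h3).resolve_left (by exact_mod_cast k.succ_ne_zero)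

/-- The Jacquet integrals of nonzero frequency vanish on polynomial sections. -/
theorem jacquet_of_polynomial (F : PS μ ν) {l : ℝ} (hl : l ≠ 0) {N : ℕ} (hN : 0 < 2 * ν.re + N)
    (h : ∀ x, x ≠ 0 → iteratedDeriv N (chart F.1) x = 0) : jacquet l F = 0 := by
  rw [jacquet_of_ne F hl hN, fourier_congr_of_ne (h := fun _ => 0) h]
  simp [fourier]

theorem hasDerivAt_monomial (c : ℂ) (k : ℕ) (x : ℝ) :
    HasDerivAt (fun x : ℝ => c * (x : ℂ) ^ k) (c * k * (x : ℂ) ^ (k - 1)) x := by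
  have h := (((hasDerivAt_id' x).ofReal_comp).pow k).const_mul c
  rw [ofReal_one, mul_one, ← mul_assoc] at h
  exact h

theorem iteratedDeriv_monomial (c : ℂ) {k N : ℕ} (h : k < N) (x : ℝ) :
    iteratedDeriv N (fun x : ℝ => c * (x : ℂ) ^ k) x = 0 := by
  induction N generalizing c k with
  | zero => omega
  | succ N ih =>
    rw [iteratedDeriv_succ', funext fun x => (hasDerivAt_monomial c k x).deriv]
    rcases Nat.eq_zero_or_pos k with h0 | h0
    · simp [h0]
    · exact ih (c * k) (by omega)

/-- When `-2ν = n` and `μ - 2ν - 1` is even, the inversion preserves polynomials. -/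
theorem exists_Jfac_eq (hν : -2 * ν = n) (hn : 0 < n) (hμ : ∃ k : ℤ, μ - 2 * ν - 1 = 2 * k) :
    ∃ c : ℂ, c ≠ 0 ∧ ∀ x : ℝ, x ≠ 0 → Jfac μ ν x = c * (x : ℂ) ^ (n - 1) := by
  obtain ⟨k, hk⟩ := hμ
  obtain ⟨p, rfl⟩ : ∃ p, n = p + 1 := ⟨n - 1, by omega⟩
  have hμ' : μ = 2 * k - p := by
    push_cast at hν
    linear_combination hk - hν
  have hs : -2 * ν - 1 = (p : ℂ) := by
    push_cast at hν
    linear_combination hν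
  refine ⟨(-1) ^ k * I ^ p, mul_ne_zero (zpow_ne_zero _ (by norm_num))
    (pow_ne_zero _ I_ne_zero), fun x hx => ?_⟩
  rw [Nat.add_sub_cancel, Jfac, hs, cpow_natCast, hμ']
  rcases lt_or_gt_of_ne hx with h | h
  · have e : -((-1 : ℝ) : ℂ) * Real.pi * I * (2 * k - p) / 2
        = k * (Real.pi * I) + p * (-(Real.pi / 2) * I) := by
      push_cast
      ring
    rw [Real.sign_of_neg h, e, Complex.exp_add, Complex.exp_int_mul, Complex.exp_nat_mul,
      exp_pi_mul_I,
      show -(Real.pi / 2 : ℂ) * I = -Real.pi / 2 * I by ring, exp_neg_pi_div_two_mul_I,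
        abs_of_neg h,
      mul_assoc, mul_assoc, ← mul_pow, ← mul_pow]
    congr 2
    push_cast
    ring
  · have e : -((1 : ℝ) : ℂ) * Real.pi * I * (2 * k - p) / 2
        = (-k : ℤ) * (Real.pi * I) + p * (Real.pi / 2 * I) := by
      push_cast
      ring
    rw [Real.sign_of_pos h, e, Complex.exp_add, Complex.exp_int_mul, Complex.exp_nat_mul,
      exp_pi_mul_I,
      exp_pi_div_two_mul_I, abs_of_pos h, zpow_neg, ← inv_zpow, inv_neg_one]

/-- The section whose chart is the constant function `1`, with a partition, and its inversion. -/
theorem exists_constant_section (hν : -2 * ν = n) (hn : 0 < n)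
    (hμ : ∃ k : ℤ, μ - 2 * ν - 1 = 2 * k) :
    ∃ (Q : PS μ ν) (d c : ℂ), IsPartition Q (coCutoff, d • powTest (n - 1)) ∧
      (∀ x, chart Q.1 x = 1) ∧ ∀ x : ℝ, x ≠ 0 → chart (flip Q).1 x = c * (x : ℂ) ^ (n - 1) := by
  obtain ⟨c, hc, h⟩ := exists_Jfac_eq hν hn hμ
  -- chosen such that the twisted inversion of `d * powTest (n - 1)` is `cutoff (-1 / x)`
  set d : ℂ := c⁻¹ * (-1) ^ (n - 1) with hd
  set Q : PS μ ν := iota μ ν coCutoff + flip (iota μ ν (d • powTest (n - 1))) with hQ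
  have h1 : ∀ x, chart Q.1 x = 1 := by
    intro x
    rw [hQ, chart_add, chart_iota, chart_flip_iota]
    by_cases hx : x = 0
    · rw [hx, coCutoff_zero, extInv_zero, add_zero]
    · have hxc : (x : ℂ) ≠ 0 := by exact_mod_cast hx
      rw [coCutoff_apply hx, extInv_of_ne _ _ _ hx, invFun, h x hx]
      change 1 - cutoff (-1 / x) + c * (x : ℂ) ^ (n - 1) * (d * powTest (n - 1) (-1 / x)) = 1
      rw [powTest_apply, hd]
      have e : c * (x : ℂ) ^ (n - 1) * (c⁻¹ * (-1) ^ (n - 1) * (((-1 / x : ℝ) : ℂ) ^ (n - 1)))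
        = 1 := by
        have e' : (x : ℂ) ^ (n - 1) * (-1) ^ (n - 1) * ((-1 / x : ℝ) : ℂ) ^ (n - 1) = 1 := by
          rw [← mul_pow, ← mul_pow, show (x : ℂ) * -1 * ((-1 / x : ℝ) : ℂ) = 1 by
            push_cast
            field_simp, one_pow]
        linear_combination c * c⁻¹ * e' + mul_inv_cancel₀ hc
      linear_combination cutoff (-1 / x) * e
  refine ⟨Q, d, c, rfl, h1, fun x hx => ?_⟩
  rw [chart_flip Q hx, invFun, h1, mul_one, h x hx]

theorem deltaR_coCutoff (m : ℕ) : deltaR m coCutoff = if m = 0 then 1 else 0 := by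
  have h : (coCutoff : ℝ → ℂ) =ᶠ[𝓝 0] fun _ => 1 := by
    filter_upwards [Metric.closedBall_mem_nhds (0 : ℝ) (show (0 : ℝ) < 1 / 2 by norm_num)] with x hx
    by_cases hx0 : x = 0
    · rw [hx0, coCutoff_zero]
    · have hx' : |x| ≤ 1 / 2 := by simpa using hx
      rw [coCutoff_apply hx0, cutoff_eq_zero, sub_zero]
      rw [abs_div, abs_neg, abs_one, le_div_iff₀ (abs_pos.2 hx0)]
      linarith
  rw [deltaR, h.iteratedDeriv_eq m, iteratedDeriv_const]
  split_ifs with h0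
  · simp [h0]
  · simp

theorem tsum_jacquet_eq_zero {L : ShiftedLattice} (α : L.carrier → ℂ) {F : PS μ ν}
    (h : ∀ l : ℝ, jacquet l F = 0) : ∑' l : L.carrier, α l * jacquet (l : ℝ) F = 0 := by
  simp [h]

/-- On the section with chart a multiple of `x ^ (n - 1)` the expansion has the value `β₁ 0`. Its
inversion is the constant section, where the other expansion is a multiple of `β₂ (n - 1)`. -/
theorem coeff_zero_of_vanishingCondition {L₁ L₂ : ShiftedLattice} {α₁ : L₁.carrier → ℂ}
    {α₂ : L₂.carrier → ℂ} {β₁ β₂ : ℕ →₀ ℂ}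
    (h : distInv (expansion L₁ μ ν α₁ β₁) = expansion L₂ μ ν α₂ β₂)
    (hβ : β₂ ∈ deltaCoeffs (exponentSet L₂ ν)) (hV : VanishingCondition L₂ μ ν) : β₁ 0 = 0 := by
  obtain ⟨n, hn, hν, hμ, hL⟩ := hV
  have hR : polarCoeff μ n = 0 := by
    rw [polarCoeff_eq_zero_iff]
    obtain ⟨k, hk⟩ := hμ
    exact ⟨k, by rw [← hk, ← hν]; ring⟩
  obtain ⟨Q, d, c, hQ, h1, h2⟩ := exists_constant_section hν hn hμ
  have hP : IsPartition (flip Q) (d • powTest (n - 1), coCutoff) := by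
    have := hQ
    rw [IsPartition] at this ⊢
    rw [← this, flip_add, flip_flip, add_comm]
  have hre : 2 * ν.re = -n := by
    have := congrArg Complex.re hν
    simp at this
    linarith
  have hN : 0 < 2 * ν.re + (n + 1 : ℕ) := by
    rw [hre]
    push_cast
    linarith
  have hcQ : chart Q.1 = fun _ => 1 := funext h1
  -- all Jacquet integrals vanish on both sections
  have jQ : ∀ l : ℝ, jacquet l Q = 0 := by
    intro l
    by_cases hl : l = 0
    · rw [hl]
      refine jacquet_zero_of_homogeneous (k := 0) hν hR Q fun x => ?_
      rw [hcQ]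
      simp
    · refine jacquet_of_polynomial Q hl hN fun x _ => ?_
      rw [hcQ, iteratedDeriv_const, if_neg (Nat.succ_ne_zero n)]
  have hev : ∀ x : ℝ, x ≠ 0 → chart (flip Q).1 =ᶠ[𝓝 x] fun x => c * (x : ℂ) ^ (n - 1) := by
    intro x hx
    filter_upwards [isOpen_ne.mem_nhds hx] with y hy
    exact h2 y hy
  have jP : ∀ l : ℝ, jacquet l (flip Q) = 0 := by
    intro l
    by_cases hl : l = 0
    · rw [hl]
      refine jacquet_zero_of_homogeneous (k := n - 1) hν hR (flip Q) fun x => ?_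
      by_cases hx : x = 0
      · have h3 := hP.chart_eq 0
        simp only at h3
        rw [hx, ofReal_zero, zero_mul, h3, extInv_zero, add_zero]
        change 0 = ((n - 1 : ℕ) : ℂ) * (d * powTest (n - 1) 0)
        rw [powTest_apply]
        rcases Nat.eq_zero_or_pos (n - 1) with h0 | h0
        · rw [h0, Nat.cast_zero, zero_mul]
        · rw [ofReal_zero, zero_pow h0.ne', zero_mul, mul_zero, mul_zero]
      · rw [(hev x hx).deriv_eq, h2 x hx, (hasDerivAt_monomial c (n - 1) x).deriv]
        rcases Nat.eq_zero_or_pos (n - 1) with h0 | h0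
        · simp [h0]
        · rw [← Nat.sub_add_cancel h0, Nat.add_sub_cancel, pow_succ]
          ring
    · refine jacquet_of_polynomial (flip Q) hl hN fun x hx => ?_
      rw [(hev x hx).iteratedDeriv_eq, iteratedDeriv_monomial c (by omega)]
  have e1 : expansion L₁ μ ν α₁ β₁ (flip Q) = β₁ 0 := by
    rw [expansion, tsum_jacquet_eq_zero α₁ jP, zero_add, Finsupp.sum, Finset.sum_eq_single 0]
    · rw [hP.deltaInf_eq, deltaR_coCutoff, if_pos rfl, mul_one]
    · intro m _ hm
      rw [hP.deltaInf_eq, deltaR_coCutoff, if_neg hm, mul_zero]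
    · intro h0
      rw [Finsupp.notMem_support_iff.1 h0, zero_mul]
  have e2 : expansion L₂ μ ν α₂ β₂ Q = 0 := by
    rw [expansion, tsum_jacquet_eq_zero α₂ jQ, zero_add]
    refine Finset.sum_eq_zero fun m _ => ?_
    change β₂ m * deltaInf m Q = 0
    rw [hQ.deltaInf_eq]
    simp only
    rw [deltaR_smul, deltaR_powTest]
    by_cases hm : m = n - 1
    · rw [hβ m ?_, zero_mul]
      rintro ⟨h0, h3⟩
      have hn1 : 1 < n := hL.resolve_left (fun h => h h0)
      rcases h3 with h3 | h3
      · omega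
      · rw [hν] at h3
        have : m = n := by exact_mod_cast h3
        omega
    · rw [if_neg hm, mul_zero, mul_zero]
  rw [← e1, ← e2, ← h]
  rfl

end Polynomial

/-! ### Quasi-automorphic distributions -/

section QuasiPeriodic

variable {L : ShiftedLattice} {μ ν : ℂ} {α : L.carrier → ℂ} {β : ℕ →₀ ℂ}

theorem expansion_mem_PSDist (hα : α ∈ coeffSpace L) (β : ℕ →₀ ℂ) :
    expansion L μ ν α β ∈ PSDist μ ν :=
  mem_PSDist (isLinearMap_expansion hα β) (toRDist_expansion_mem_RDist hα β)
    (toRDist_distInv_expansion_mem_RDist hα β)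

theorem ShiftedLattice.neg_mem_dual {t : ℝ} (ht : t ∈ L.dual) : -t ∈ L.dual := by
  obtain ⟨k, hk⟩ := L.mem_dual_iff.1 ht
  exact L.mem_dual_iff.2 ⟨-k, by push_cast; rw [← hk]; ring⟩

theorem toRDist_expansion_mem_PeriodicDist (hα : α ∈ coeffSpace L) (β : ℕ →₀ ℂ) :
    toRDist (expansion L μ ν α β) ∈ PeriodicDist L := by
  refine ⟨toRDist_expansion_mem_RDist hα β, fun t ht f => ?_⟩
  rw [toRDist_expansion, toRDist_expansion, ← tsum_mul_left]
  congr 1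
  funext l
  have e : (translate t f : ℝ → ℂ) = fun x => f (x - (-t)) := by
    funext x
    rw [sub_neg_eq_add]
    rfl
  rw [e, fourier_comp_sub, L.omega_eq l.2 (ShiftedLattice.neg_mem_dual ht)]
  ring

end QuasiPeriodic

end QAD

end

theorem mainTheorem4 (L₁ L₂ : QAD.ShiftedLattice) (μ ν : ℂ) :
    -- the series in the definition of the expansions converge absolutely
    (∀ (α : L₁.carrier → ℂ), α ∈ QAD.coeffSpace L₁ → ∀ F : QAD.PS μ ν,
      Summable fun l : L₁.carrier => α l * QAD.jacquet (l : ℝ) F) ∧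
    (∀ (α : L₂.carrier → ℂ), α ∈ QAD.coeffSpace L₂ → ∀ F : QAD.PS μ ν,
      Summable fun l : L₂.carrier => α l * QAD.jacquet (l : ℝ) F) ∧
    -- part (i)
    (∀ lam : QAD.PS μ ν → ℂ, lam ∈ QAD.QuasiAutomorphic L₁ L₂ μ ν →
      ∃ (α₁ : L₁.carrier → ℂ) (β₁ : ℕ →₀ ℂ) (α₂ : L₂.carrier → ℂ) (β₂ : ℕ →₀ ℂ),
        (α₁ ∈ QAD.coeffSpace L₁ ∧ α₂ ∈ QAD.coeffSpace L₂ ∧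
          lam = QAD.expansion L₁ μ ν α₁ β₁ ∧
          QAD.distInv (QAD.expansion L₁ μ ν α₁ β₁) = QAD.expansion L₂ μ ν α₂ β₂) ∧
        (∀ (α₁' : L₁.carrier → ℂ) (β₁' : ℕ →₀ ℂ) (α₂' : L₂.carrier → ℂ) (β₂' : ℕ →₀ ℂ),
          α₁' ∈ QAD.coeffSpace L₁ → α₂' ∈ QAD.coeffSpace L₂ →
          lam = QAD.expansion L₁ μ ν α₁' β₁' →
          QAD.distInv (QAD.expansion L₁ μ ν α₁' β₁') = QAD.expansion L₂ μ ν α₂' β₂' →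
          α₁' = α₁ ∧ β₁' = β₁ ∧ α₂' = α₂ ∧ β₂' = β₂) ∧
        (lam ∈ QAD.Automorphic L₁ L₂ μ ν →
          α₁ ∈ QAD.coeffSpace0 L₁ μ ν ∧ β₁ ∈ QAD.deltaCoeffs (QAD.exponentSet L₁ ν) ∧
          α₂ ∈ QAD.coeffSpace0 L₂ μ ν ∧ β₂ ∈ QAD.deltaCoeffs (QAD.exponentSet L₂ ν) ∧
          (QAD.VanishingCondition L₂ μ ν → β₁ 0 = 0) ∧
          (QAD.VanishingCondition L₁ μ ν → β₂ 0 = 0))) ∧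
    -- part (ii)
    (∀ (α₁ : L₁.carrier → ℂ) (β₁ : ℕ →₀ ℂ) (α₂ : L₂.carrier → ℂ) (β₂ : ℕ →₀ ℂ),
      α₁ ∈ QAD.coeffSpace L₁ → α₂ ∈ QAD.coeffSpace L₂ →
      QAD.distInv (QAD.expansion L₁ μ ν α₁ β₁) = QAD.expansion L₂ μ ν α₂ β₂ →
      QAD.expansion L₁ μ ν α₁ β₁ ∈ QAD.QuasiAutomorphic L₁ L₂ μ ν ∧
      (α₁ ∈ QAD.coeffSpace0 L₁ μ ν → β₁ ∈ QAD.deltaCoeffs (QAD.exponentSet L₁ ν) →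
        α₂ ∈ QAD.coeffSpace0 L₂ μ ν → β₂ ∈ QAD.deltaCoeffs (QAD.exponentSet L₂ ν) →
        QAD.expansion L₁ μ ν α₁ β₁ ∈ QAD.Automorphic L₁ L₂ μ ν)) := by
  -- the first and the second condition are the periodicity of the two expansions, and the third
  -- holds as a test function supported off the origin is embedded in the same way in both charts
  have quasi : ∀ {L₁ L₂ : QAD.ShiftedLattice} {α₁ : L₁.carrier → ℂ} {β₁ : ℕ →₀ ℂ}
      {α₂ : L₂.carrier → ℂ} {β₂ : ℕ →₀ ℂ}, α₁ ∈ QAD.coeffSpace L₁ → α₂ ∈ QAD.coeffSpace L₂ →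
      QAD.distInv (QAD.expansion L₁ μ ν α₁ β₁) = QAD.expansion L₂ μ ν α₂ β₂ →
      QAD.expansion L₁ μ ν α₁ β₁ ∈ QAD.QuasiAutomorphic L₁ L₂ μ ν := by
    intro L₁ L₂ α₁ β₁ α₂ β₂ hα₁ hα₂ h
    refine ⟨QAD.expansion_mem_PSDist hα₁ β₁, QAD.toRDist_expansion_mem_PeriodicDist hα₁ β₁, ?_,
      fun f hf => ?_⟩
    · simp only [h]
      exact QAD.toRDist_expansion_mem_PeriodicDist hα₂ β₂
    · simp only [QAD.toRDist, QAD.distInv]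
      rw [← QAD.iota_eq_flip_iota f hf]
  refine ⟨fun α hα F => QAD.summable_jacquet hα F, fun α hα F => QAD.summable_jacquet hα F,
    fun lam hlam => ?_, fun α₁ β₁ α₂ β₂ hα₁ hα₂ h => ⟨quasi hα₁ hα₂ h, fun m₁ n₁ m₂ n₂ => ?_⟩⟩
  · obtain ⟨hd, h1, h2, -⟩ := hlam
    simp only at h1 h2
    obtain ⟨α₁, hα₁, β₁, e₁⟩ := QAD.exists_eq_expansion hd.1 h1 h2.1
    obtain ⟨α₂, hα₂, β₂, e₂⟩ := QAD.exists_eq_expansion (QAD.isLinearMap_distInv hd.1) h2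
      (by rw [QAD.distInv_distInv]; exact h1.1)
    have e : QAD.distInv (QAD.expansion L₁ μ ν α₁ β₁) = QAD.expansion L₂ μ ν α₂ β₂ := by
      rw [← e₁, e₂]
    -- as the inversion is an involution, the two expansions play symmetric roles
    have e' : QAD.distInv (QAD.expansion L₂ μ ν α₂ β₂) = QAD.expansion L₁ μ ν α₁ β₁ := by
      rw [← e, QAD.distInv_distInv]
    refine ⟨α₁, β₁, α₂, β₂, ⟨hα₁, hα₂, e₁, e⟩, ?_, fun ha => ?_⟩
    · intro α₁' β₁' α₂' β₂' _ _ f₁ f₂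
      obtain ⟨rfl, rfl⟩ := QAD.expansion_injective (f₁.symm.trans e₁)
      obtain ⟨rfl, rfl⟩ := QAD.expansion_injective (f₂.symm.trans e)
      exact ⟨rfl, rfl, rfl, rfl⟩
    · rw [e₁] at ha
      obtain ⟨⟨-, ha₁⟩, -, ha₂⟩ := ha
      rw [e] at ha₂
      obtain ⟨m₁, n₁⟩ := QAD.mem_of_equivariant hα₁ ha₁
      obtain ⟨m₂, n₂⟩ := QAD.mem_of_equivariant hα₂ ha₂
      exact ⟨m₁, n₁, m₂, n₂, QAD.coeff_zero_of_vanishingCondition e n₂,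
        QAD.coeff_zero_of_vanishingCondition e' n₁⟩
  · refine ⟨⟨QAD.expansion_mem_PSDist hα₁ β₁, fun t ht F => QAD.equivariant_of_mem m₁ n₁ ht F⟩, ?_⟩
    rw [h]
    exact ⟨QAD.expansion_mem_PSDist hα₂ β₂, fun t ht F => QAD.equivariant_of_mem m₂ n₂ ht F⟩
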